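/- Let $q\ge 2$ be an even integer. **The SYK model.** For even $n$ let $\psi_1,\dots,\psi_n$ be Majorana operators on $\mathbb{C}^{2^{n/2}}$, i.e. Hermitian operators with $\psi_i\psi_j+\psi_j\psi_i=\delta_{ij}\mathbb{I}$. For $I=\{i_1<\dots<i_q\}\subseteq[n]$ put $\psi_I=i^{q/2}\psi_{i_1}\cdots\psi_{i_q}$ and let $H_{\rm SYK}=\sum_{I}\sigma \bar J_I\,\psi_I$, the sum being over all $q$-subsets of $[n]$, with $\sigma^2=(q-1)!/n^{q-1}$ and $\bar J_I$ i.i.d. Rademacher ($\pm1$ with probability $1/2$). With the normalized trace $\mathrm{tr}=2^{-n/2}\mathrm{Tr}$, for real $\beta\neq0$ the annealed free energy is $f_{n,q}(\beta)=\frac1\beta\log\mathbb{E}\,\mathrm{tr}(e^{\beta H_{\rm SYK}})$. **Chords.** Let $\Omega=[0,1]^2$. For $x=(u_1,u_2),\,y=(v_1,v_2)\in\Omega$ let $K(x,y)=-1$ if $u_1<v_1<u_2<v_2$ or $v_1<u_1<v_2<u_2$, and $K(x,y)=1$ otherwise. Let $\nu$ be the law of $(\min(U_1,U_2),\max(U_1,U_2))$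 for independent uniform $U_1,U_2$ on $[0,1]$. **Trees.** A $q$-uniform hypertree on $[v]$ is a connected simple hypergraph on the node set $[v]$ with exactly $(v-1)/(q-1)$ hyperedges, all of size $q$ (a single node without hyperedges counts). For a hypertree $T$ with edge set $E$ let $b_T=\mathbb{E}\prod_{\{e,f\}\subseteq E:\ |e\cap f|\ \mathrm{odd}}K(X(e),X(f))$, where the chords $X(e)$, $e\in E$, are i.i.d. with law $\nu$. Put $\rho=\big((q-1)!\,\beta^2/2^{q+1}\big)^{1/(q-1)}$, $\mu_v=\frac{\rho^{v-1}}{v!}\sum_T b_T$ (sum over the hypertrees on $[v]$; by convention $\rho^0=1$), and $\Phi(z)=\sum_{v\ge1}\mu_vz^v$. **Theorem.** (a) There is a unique continuous function $H:\{z\in\mathbb{C}:|z|\le e^{-2}\}\times\Omega\to\mathbb{C}$ with $\sup|H|\le1$ such that for all $(z,x)$ $$H(z,x)=z+z\sum_{d\ge1}\frac1{d!}\int_{\Omega^d}\prod_{i=1}^d\Big[K(x,y_i)\frac{H(z,y_i)^{q-1}}{(q-1)!}\Big]\prod_{1\le i<j\le d}K(y_i,y_j)\,\nu^{\otimes d}(dy_1\cdots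 dy_d).$$ With this $H$ (the Chord-Cavity-Generator) define, for $|z|\le e^{-2}$, $$\mathcal{R}(z)=z+z\sum_{d\ge1}\frac1{d!}\int_{\Omega^d}\prod_{i=1}^d\frac{H(z,y_i)^{q-1}}{(q-1)!}\prod_{1\le i<j\le d}K(y_i,y_j)\,\nu^{\otimes d}(dy_1\cdots dy_d),\qquad \mathcal{E}(z)=\frac1{q!}\int_\Omega H(z,x)^q\,\nu(dx),$$ and, for $\beta\ne0$ and $|\rho z|\le e^{-2}$, $\mathcal{F}(z)=\rho^{-1}\left[\mathcal{R}(\rho z)-(q-1)\mathcal{E}(\rho z)\right]$. (b) There is $\beta^*=\beta^*(q)>0$ such that for all real $\beta$ with $|\beta|\le\beta^*$: the series $\Phi$ converges and is analytic on $\{|z|\le2\}$; there is a unique $t^*=t^*(\beta)\in(1/2,3/2)$ with $t^*\Phi'(t^*)=1$; one has $\rho t^*\le e^{-2}$, so that $\mathcal{F}$ is defined at $t^*$ when $\beta\neq 0$; and if $\beta\neq0$, then $$\lim_{n\to\infty,\ n\ \mathrm{even}}\frac{f_{n,q}(\beta)}{n}=\frac{\mathcal{F}(t^*)-1-\log t^*}{\beta}.$$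 -/

import Mathlib

open MeasureTheory Filter Topology Finset
open scoped Nat

noncomputable section

/-! ### The SYK model -/

/-- A family of `n` Majorana operators on a finite-dimensional Hilbert space `ℂ^ι`:
Hermitian operators with `ψ i * ψ j + ψ j * ψ i = δ_{ij}`. -/
structure IsMajorana {ι : Type*} [Fintype ι] [DecidableEq ι] {n : ℕ}
    (ψ : Fin n → Matrix ι ι ℂ) : Prop where
  isHermitian : ∀ i, (ψ i).IsHermitian
  anticomm : ∀ i j, ψ i * ψ j + ψ j * ψ i = if i = j then 1 else 0

/-- The index set of the standard basis of `(ℂ²)^{⊗ m}`, a Hilbert space of dimension `2 ^ m`. -/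
abbrev Qubits (m : ℕ) : Type := Fin m → Fin 2

/-- `ψ_I = i^{q/2} ψ_{i₁} ⋯ ψ_{i_q}` for `I = {i₁ < ⋯ < i_q}`, where `q` is the size of `I`. -/
def majoranaMonomial {ι : Type*} [Fintype ι] [DecidableEq ι] {n : ℕ}
    (ψ : Fin n → Matrix ι ι ℂ) (I : Finset (Fin n)) : Matrix ι ι ℂ :=
  Complex.I ^ (#I / 2) • ((I.sort (· ≤ ·)).map ψ).prod

/-- The `q`-element subsets of `[n]`. -/
abbrev Interactions (n q : ℕ) : Type := {I : Finset (Fin n) // #I = q}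

/-- `σ = √((q-1)! / n^{q-1})`. -/
def couplingScale (n q : ℕ) : ℝ := √(((q - 1)! : ℝ) / (n : ℝ) ^ (q - 1))

/-- `H_SYK = ∑_I J_I ψ_I`, with `J_I = σ ε_I`. -/
def sykHamiltonian {ι : Type*} [Fintype ι] [DecidableEq ι] {n : ℕ} (q : ℕ)
    (ψ : Fin n → Matrix ι ι ℂ) (ε : Interactions n q → ℝ) : Matrix ι ι ℂ :=
  ∑ I : Interactions n q, ((couplingScale n q * ε I : ℝ) : ℂ) • majoranaMonomial ψ I

/-- `Z = tr exp(β H_SYK)` with the normalized trace (a real number, as `H_SYK` is Hermitian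
for even `q`). -/
def sykPartition {ι : Type*} [Fintype ι] [DecidableEq ι] {n : ℕ} (q : ℕ) (β : ℝ)
    (ψ : Fin n → Matrix ι ι ℂ) (ε : Interactions n q → ℝ) : ℝ :=
  (Matrix.trace (NormedSpace.exp ((β : ℂ) • sykHamiltonian q ψ ε))).re / Fintype.card ι

/-- The Rademacher law: `±1` with probability `1/2` each. -/
def rademacher : Measure ℝ :=
  (2⁻¹ : ENNReal) • Measure.dirac 1 + (2⁻¹ : ENNReal) • Measure.dirac (-1)

instance : IsProbabilityMeasure rademacher :=
  ⟨by simp [rademacher, ENNReal.inv_two_add_inv_two]⟩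

/-- The annealed free energy `f_{n,q}(β) = (1/β) log E[Z_{n,q}(β)]`, for i.i.d. Rademacher signs. -/
def annealedFreeEnergy {ι : Type*} [Fintype ι] [DecidableEq ι] {n : ℕ} (q : ℕ) (β : ℝ)
    (ψ : Fin n → Matrix ι ι ℂ) : ℝ :=
  1 / β * Real.log
    (∫ ε : Interactions n q → ℝ, sykPartition q β ψ ε ∂(Measure.pi fun _ => rademacher))

/-! ### Majorana operators exist: the Jordan-Wigner construction -/

/-- The tensor product of `2 × 2` matrices. -/
def pauliTensor {m : ℕ} (A : Fin m → Matrix (Fin 2) (Fin 2) ℂ) :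
    Matrix (Qubits m) (Qubits m) ℂ :=
  fun s t => ∏ k, A k (s k) (t k)

/-- The `k`-th tensor factor of the `a`-th Jordan-Wigner operator. -/
def jordanWignerFactor {m : ℕ} (a : Fin (2 * m)) (k : Fin m) : Matrix (Fin 2) (Fin 2) ℂ :=
  if (k : ℕ) < a / 2 then !![1, 0; 0, -1]
  else if (k : ℕ) = a / 2 then
    (if (a : ℕ) % 2 = 0 then !![0, 1; 1, 0] else !![0, -Complex.I; Complex.I, 0])
  else 1

/-- `Z ⊗ ⋯ ⊗ Z ⊗ X ⊗ 1 ⊗ ⋯ ⊗ 1 / √2` and `Z ⊗ ⋯ ⊗ Z ⊗ Y ⊗ 1 ⊗ ⋯ ⊗ 1 / √2`. -/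
def jordanWigner (m : ℕ) (a : Fin (2 * m)) : Matrix (Qubits m) (Qubits m) ℂ :=
  ((1 / √2 : ℝ) : ℂ) • pauliTensor (jordanWignerFactor a)

theorem pauliTensor_mul {m : ℕ} (A B : Fin m → Matrix (Fin 2) (Fin 2) ℂ) :
    pauliTensor A * pauliTensor B = pauliTensor (fun k => A k * B k) := by
  ext s t
  simp only [pauliTensor, Matrix.mul_apply, ← Finset.prod_mul_distrib]
  rw [Finset.prod_univ_sum]
  simp

theorem pauliTensor_one {m : ℕ} : pauliTensor (fun _ : Fin m => 1) = 1 := by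
  ext s t
  simp only [pauliTensor, Matrix.one_apply]
  by_cases h : s = t
  · simp [h]
  · obtain ⟨k, hk⟩ := Function.ne_iff.1 h
    rw [if_neg h]
    exact Finset.prod_eq_zero (Finset.mem_univ k) (by simp [hk])

theorem jordanWignerFactor_sq {m : ℕ} (a : Fin (2 * m)) (k : Fin m) :
    jordanWignerFactor a k * jordanWignerFactor a k = 1 := by
  unfold jordanWignerFactor
  split_ifs <;> ext i j <;> fin_cases i <;> fin_cases j <;> simp [Matrix.mul_apply]

theorem jordanWignerFactor_anticomm {m : ℕ} {a b : Fin (2 * m)} (h : (a : ℕ) < b) (k : Fin m) :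
    jordanWignerFactor a k * jordanWignerFactor b k =
      (if (k : ℕ) = a / 2 then (-1 : ℂ) else 1) •
        (jordanWignerFactor b k * jordanWignerFactor a k) := by
  have hab : (a : ℕ) / 2 ≤ b / 2 := Nat.div_le_div_right h.le
  unfold jordanWignerFactor
  split_ifs <;> first
    | (exfalso; omega)
    | (ext i j; fin_cases i <;> fin_cases j <;> simp [Matrix.mul_apply])

theorem pauliTensor_anticomm {m : ℕ} {a b : Fin (2 * m)} (h : (a : ℕ) < b) :
    pauliTensor (jordanWignerFactor a) * pauliTensor (jordanWignerFactor b) =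
      -(pauliTensor (jordanWignerFactor b) * pauliTensor (jordanWignerFactor a)) := by
  have ha : (a : ℕ) / 2 < m := by omega
  rw [pauliTensor_mul, pauliTensor_mul]
  ext s t
  have hs : (∏ k : Fin m, if (k : ℕ) = a / 2 then (-1 : ℂ) else 1) = -1 := by
    rw [Finset.prod_eq_single (⟨a / 2, ha⟩ : Fin m)]
    · simp
    · intro k _ hk
      rw [if_neg]
      intro h'
      exact hk (Fin.ext h')
    · simp
  simp only [pauliTensor, Matrix.neg_apply, jordanWignerFactor_anticomm h, Matrix.smul_apply,
    smul_eq_mul, Finset.prod_mul_distrib]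
  rw [hs, neg_one_mul]

/-- The Jordan-Wigner operators are Majorana operators. -/
theorem isMajorana_jordanWigner (m : ℕ) : IsMajorana (jordanWigner m) where
  isHermitian a := by
    ext s t
    simp only [jordanWigner, pauliTensor, Matrix.conjTranspose_apply, Matrix.smul_apply,
      smul_eq_mul, star_mul', star_prod]
    congr 1
    · simp
    · refine Finset.prod_congr rfl fun k _ => ?_
      have h : ∀ i j, star (jordanWignerFactor a k i j) = jordanWignerFactor a k j i := by
        intro i j
        unfold jordanWignerFactor
        split_ifs <;> fin_cases i <;> fin_cases j <;> simp
      exact h _ _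
  anticomm a b := by
    have hc : ((1 / √2 : ℝ) : ℂ) * ((1 / √2 : ℝ) : ℂ) = 1 / 2 := by
      rw [← Complex.ofReal_mul, div_mul_div_comm, Real.mul_self_sqrt (by norm_num)]
      norm_num
    simp only [jordanWigner, Matrix.smul_mul, Matrix.mul_smul, smul_smul, hc, ← smul_add]
    rcases lt_trichotomy (a : ℕ) b with h | h | h
    · rw [pauliTensor_anticomm h, if_neg (fun e => by simp [e] at h)]
      simp
    · rw [if_pos (Fin.ext h), Fin.ext h, pauliTensor_mul]
      simp only [jordanWignerFactor_sq, pauliTensor_one]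
      rw [← two_smul ℂ, smul_smul]
      norm_num
    · rw [pauliTensor_anticomm h, if_neg (fun e => by simp [e] at h)]
      simp

/-! ### Chords -/

/-- `Ω = [0,1]²`. -/
abbrev Chord : Type := unitInterval × unitInterval

open Classical in
/-- `K x y = -1` if the chords `x` and `y` cross, `1` otherwise. -/
def chordSign (x y : Chord) : ℝ :=
  if (x.1 < y.1 ∧ y.1 < x.2 ∧ x.2 < y.2) ∨ (y.1 < x.1 ∧ x.1 < y.2 ∧ y.2 < x.2) then -1 else 1

theorem chordSign_comm (x y : Chord) : chordSign x y = chordSign y x := by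
  unfold chordSign
  simp only [or_comm]

/-- `ν`: the law of `(min U₁ U₂, max U₁ U₂)` for independent uniform `U₁, U₂` on `[0,1]`. -/
def chordLaw : Measure Chord :=
  ((volume : Measure unitInterval).prod volume).map fun u => (min u.1 u.2, max u.1 u.2)

instance : IsProbabilityMeasure chordLaw :=
  Measure.isProbabilityMeasure_map (by fun_prop)

/-! ### The Chord-Cavity-Generator -/

/-- `{z : |z| ≤ 1/e²}`. -/
abbrev CCGDisc : Type := Metric.closedBall (0 : ℂ) (1 / Real.exp 1 ^ 2)

/-- `∏_{i < j} K(y_i, y_j)`. -/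
def chordPairSign {d : ℕ} (y : Fin d → Chord) : ℝ :=
  ∏ i, ∏ j ∈ Finset.Ioi i, chordSign (y i) (y j)

/-- `H` is a continuous function on `{|z| ≤ 1/e²} × Ω` with sup norm at most `1` that solves
the Chord-Cavity-Generator equation (the sum over `d ≥ 1` is written with `d + 1`, `d ≥ 0`). -/
structure IsCCG (q : ℕ) (H : C(CCGDisc × Chord, ℂ)) : Prop where
  norm_le : ∀ p, ‖H p‖ ≤ 1
  fixedPoint : ∀ (z : CCGDisc) (x : Chord),
    H (z, x) = z + z * ∑' d : ℕ, 1 / ((d + 1)! : ℂ) *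
      ∫ y : Fin (d + 1) → Chord,
        (∏ i, (chordSign x (y i) : ℂ) * (H (z, y i) ^ (q - 1) / ((q - 1)! : ℂ))) *
          (chordPairSign y : ℂ) ∂(Measure.pi fun _ => chordLaw)

/-- The function `𝓡`. -/
def ccgR (q : ℕ) (H : C(CCGDisc × Chord, ℂ)) (z : CCGDisc) : ℂ :=
  z + z * ∑' d : ℕ, 1 / ((d + 1)! : ℂ) *
    ∫ y : Fin (d + 1) → Chord,
      (∏ i, H (z, y i) ^ (q - 1) / ((q - 1)! : ℂ)) *
        (chordPairSign y : ℂ) ∂(Measure.pi fun _ => chordLaw)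

/-- The function `𝓔`. -/
def ccgE (q : ℕ) (H : C(CCGDisc × Chord, ℂ)) (z : CCGDisc) : ℂ :=
  1 / (q ! : ℂ) * ∫ x, H (z, x) ^ q ∂chordLaw

/-- `ρ = ((q-1)! β² / 2^{q+1})^{1/(q-1)}`. -/
def sykRho (q : ℕ) (β : ℝ) : ℝ :=
  (((q - 1)! : ℝ) * β ^ 2 / 2 ^ (q + 1)) ^ (1 / ((q : ℝ) - 1))

/-- `𝓕(z) = ρ⁻¹ (𝓡(ρ z) - (q-1) 𝓔(ρ z))`, for `z` such that `𝓡` and `𝓔` are defined at `ρ z`. -/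
def ccgF (q : ℕ) (β : ℝ) (H : C(CCGDisc × Chord, ℂ)) (z : ℂ)
    (hz : (sykRho q β : ℂ) * z ∈ Metric.closedBall (0 : ℂ) (1 / Real.exp 1 ^ 2)) : ℂ :=
  (sykRho q β : ℂ)⁻¹ * (ccgR q H ⟨_, hz⟩ - ((q : ℂ) - 1) * ccgE q H ⟨_, hz⟩)

/-! ### Hypertrees and the generating function `Φ` -/

/-- `E` is the edge set of a `q`-uniform hypertree on the node set `[v]`: it is connected and has
exactly `(v-1)/(q-1)` hyperedges. A single node without hyperedges is a hypertree. -/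
structure IsHypertree (q v : ℕ) (E : Finset (Finset (Fin v))) : Prop where
  uniform : ∀ e ∈ E, #e = q
  connected : ∀ a b : Fin v, Relation.ReflTransGen (fun c d => ∃ e ∈ E, c ∈ e ∧ d ∈ e) a b
  card_edges : #E * (q - 1) + 1 = v

/-- `B_H(X)`: the product of `K(X(e), X(f))` over the unordered pairs of hyperedges `e, f`
that share an odd number of nodes (a pair `e = e` would share `q` nodes, which is even). -/
def crossingSign {v : ℕ} (E : Finset (Finset (Fin v))) (X : E → Chord) : ℝ :=
  ∏ p : Sym2 E, Sym2.lift
    ⟨fun e f => if Odd #(e.1 ∩ f.1) then chordSign (X e) (X f) else 1, fun e f => by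
      beta_reduce
      rw [Finset.inter_comm e.1 f.1, chordSign_comm (X e) (X f)]⟩ p

/-- `b_H = E[B_H(X)]` for i.i.d. chords. -/
def crossingMean {v : ℕ} (E : Finset (Finset (Fin v))) : ℝ :=
  ∫ X : E → Chord, crossingSign E X ∂(Measure.pi fun _ => chordLaw)

open Classical in
/-- `μ_v = ((∑_T b_T) / v!) ρ^{v-1}`, the sum being over the hypertrees on `[v]`, for `v ≥ 1`. -/
def treeCoeff (q : ℕ) (β : ℝ) (v : ℕ) : ℝ :=
  (∑ E : Finset (Finset (Fin v)) with IsHypertree q v E, crossingMean E) / (v ! : ℝ) *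
    sykRho q β ^ (v - 1)

/-- `Φ(z) = ∑_{v ≥ 1} μ_v z^v`. -/
def treePhi (q : ℕ) (β : ℝ) (z : ℂ) : ℂ :=
  ∑' v : ℕ, (treeCoeff q β (v + 1) : ℂ) * z ^ (v + 1)

/-- `t` is a root of `t Φ'(t) = 1` in `(1/2, 3/2)`. -/
def IsTStar (q : ℕ) (β : ℝ) (t : ℝ) : Prop :=
  t ∈ Set.Ioo (1 / 2 : ℝ) (3 / 2) ∧ (t : ℂ) * deriv (treePhi q β) (t : ℂ) = 1

end

/-! Normalized to `2 ^ (q / 2) • ψ_I`, the monomials are involutions that commute or anticommute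
according to the parity of `#(I ∩ J)`. Expanding the exponential into words and averaging over the
Rademacher signs leaves the words in which every letter occurs an even number of times, and each of
them is a sign times the identity (`integral_sykPartition`). Grouped by the set of letters used, the
averaged partition function is a sum over `q`-uniform hypergraphs on `[n]` with weights `wordSum`.
Letters from different components commute, so the weights factorize over components
(`wordSum_union`). By the exponential formula, `n ^ n` times the partition function is the `n`-th
derivative at `0` of `exp (n Φ_n)`, where `Φ_n` is the generating polynomial of connected
hypergraphs (`clusterPartition_eq_iteratedDeriv`).

Two facts control `Φ_n`. Dropping all signs bounds the weight of `G` by `(cosh s - 1) ^ #G`, and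
deleting a marked hyperedge gives a functional inequality for the weighted number of connected
hypergraphs. For small coupling the coefficients therefore decay geometrically, uniformly in `n`
(`exists_rootedWeightSum_le`, `isDominated_clusterCoeff`). Moreover, a connected hypergraph with `k`
edges has at most `k (q - 1) + 1` nodes, so with the given scaling of the couplings only hypertrees
survive in the limit, and in them only the words that use every letter exactly twice
(`tendsto_clusterCoeff`). Such a word is the order in which one meets the endpoints of independent
chords, and its sign is the product of the crossing signs; this produces `b_T`
(`wordCoeff_eq_crossingMean`). Hence `Φ_n` tends to `Φ`. As `Φ_n` is a small perturbation of `z`,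
Cauchy's formula on the circle through the saddle `t Φ_n'(t) = 1`, together with Stirling's formula,
gives the limit `Φ(t*) - 1 - log t*` (`tendsto_log_coeff`).

It remains to evaluate `Φ`. The series of rooted hypertrees, with the edges at the root weighted by
their crossing sign with a chord `x`, solves the cavity equation, because a tree decomposes at the
edges of its root (`IsSmall.rootedSeries_eq`). On `|z| ≤ e⁻²` the right-hand side of that equation
is a contraction with factor `1 / e`, so its solution exists and is unique (`exists_isCCG`,
`IsCavitySolution.unique`). At `ρ t*` the function `H` is thus the tree series, `𝓡` counts
hypertrees with a marked node and `𝓔` those with a marked edge. Since nodes minus `q - 1` times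
edges is `1` in a hypertree, `𝓡 - (q - 1) 𝓔` counts hypertrees without marks (`rootedCoeff_sub`,
`IsSmall.tsum_treeSum`). -/

noncomputable section

/-! ### Connected hypergraphs -/

section Hypergraph

variable {V : Type*}

/-- `a` and `b` are joined by a path of hyperedges of `G`. -/
def Linked (G : Finset (Finset V)) : V → V → Prop :=
  Relation.ReflTransGen fun c d => ∃ e ∈ G, c ∈ e ∧ d ∈ e

theorem Linked.refl (G : Finset (Finset V)) (a : V) : Linked G a a := Relation.ReflTransGen.refl

theorem Linked.trans {G : Finset (Finset V)} {a b c : V} (h : Linked G a b) (h' : Linked G b c) :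
    Linked G a c := Relation.ReflTransGen.trans h h'

theorem Linked.symm {G : Finset (Finset V)} {a b : V} (h : Linked G a b) : Linked G b a := by
  induction h with
  | refl => exact Linked.refl _ _
  | tail _ h ih =>
    obtain ⟨e, he, hc, hd⟩ := h
    exact (Relation.ReflTransGen.single ⟨e, he, hd, hc⟩).trans ih

theorem Linked.of_mem {G : Finset (Finset V)} {e : Finset V} (he : e ∈ G) {a b : V} (ha : a ∈ e)
    (hb : b ∈ e) : Linked G a b := Relation.ReflTransGen.single ⟨e, he, ha, hb⟩

theorem Linked.mono {G G' : Finset (Finset V)} (hG : G ⊆ G') {a b : V} (h : Linked G a b) :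
    Linked G' a b :=
  Relation.ReflTransGen.mono (fun _ _ ⟨e, he, h⟩ => ⟨e, hG he, h⟩) a b h

/-- A property that is constant along the hyperedges is constant along paths. -/
theorem Linked.eq_of_const {G : Finset (Finset V)} {β : Type*} (c : V → β)
    (hc : ∀ e ∈ G, ∀ a ∈ e, ∀ b ∈ e, c a = c b) {a b : V} (h : Linked G a b) : c a = c b := by
  induction h with
  | refl => rfl
  | tail _ h ih =>
    obtain ⟨e, he, hc', hd⟩ := h
    exact ih.trans (hc e he _ hc' _ hd)

/-- A path stays inside the union of those hyperedges that are in the same class. -/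
theorem Linked.filter_of_const {G : Finset (Finset V)} (P : V → Prop)
    (hc : ∀ e ∈ G, ∀ a ∈ e, ∀ b ∈ e, P a → P b) {G' : Finset (Finset V)}
    (hG' : ∀ e ∈ G, (∀ a ∈ e, P a) → e ∈ G') {a b : V} (ha : P a) (h : Linked G a b) :
    Linked G' a b ∧ P b := by
  induction h with
  | refl => exact ⟨Linked.refl _ _, ha⟩
  | tail _ h ih =>
    obtain ⟨e, he, hc', hd⟩ := h
    refine ⟨ih.1.trans (Linked.of_mem (hG' e he fun a ha => hc e he _ hc' _ ha ih.2) hc' hd),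
      hc e he _ hc' _ hd ih.2⟩

open Classical in
/-- The connected `q`-uniform hypergraphs with node set `B`. -/
def connectedOn (q : ℕ) (B : Finset V) : Finset (Finset (Finset V)) :=
  {G ∈ (B.powersetCard q).powerset | ∀ a ∈ B, ∀ b ∈ B, Linked G a b}

/-- The `q`-uniform hypertrees with node set `B`. -/
def treesOn (q : ℕ) (B : Finset V) : Finset (Finset (Finset V)) :=
  {G ∈ connectedOn q B | #G * (q - 1) + 1 = #B}

theorem mem_connectedOn {q : ℕ} {B : Finset V} {G : Finset (Finset V)} :
    G ∈ connectedOn q B ↔ (∀ e ∈ G, e ⊆ B ∧ #e = q) ∧ ∀ a ∈ B, ∀ b ∈ B, Linked G a b := by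
  classical
  simp only [connectedOn, Finset.mem_filter, Finset.mem_powerset, Finset.subset_iff,
    Finset.mem_powersetCard]

theorem mem_treesOn {q : ℕ} {B : Finset V} {G : Finset (Finset V)} :
    G ∈ treesOn q B ↔ G ∈ connectedOn q B ∧ #G * (q - 1) + 1 = #B := by
  simp [treesOn]

variable [DecidableEq V]

/-- If `insert e G` links `a` to `b` then either `G` does, or both are linked to a vertex of `e`
by `G`. -/
theorem Linked.of_insert {G : Finset (Finset V)} {e : Finset V} {a b : V}
    (h : Linked (insert e G) a b) : Linked G a b ∨ ∃ x ∈ e, Linked G x b := by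
  induction h with
  | refl => exact Or.inl (Linked.refl _ _)
  | tail _ h ih =>
    obtain ⟨f, hf, hc, hd⟩ := h
    rcases Finset.mem_insert.1 hf with rfl | hf
    · exact Or.inr ⟨_, hd, Linked.refl _ _⟩
    · rcases ih with ih | ⟨x, hx, ih⟩
      · exact Or.inl (ih.trans (Linked.of_mem hf hc hd))
      · exact Or.inr ⟨x, hx, ih.trans (Linked.of_mem hf hc hd)⟩

/-- A connected hypergraph with `k` hyperedges of size `q` has at most `k (q-1) + 1` nodes. -/
theorem card_le_of_mem_connectedOn {q : ℕ} {B : Finset V} {G : Finset (Finset V)}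
    (hG : G ∈ connectedOn q B) : #B ≤ #G * (q - 1) + 1 := by
  classical
  obtain ⟨hG, hc⟩ := mem_connectedOn.1 hG
  rcases B.eq_empty_or_nonempty with rfl | ⟨a, ha⟩
  · simp
  -- `S F` consists of `a` and the nodes covered by `F`. Take `F` with the most edges among those
  -- obeying the bound. If `S F` missed a node, connectedness would give an edge that meets `S F`
  -- and leaves it; this edge adds at most `q - 1` nodes, against maximality.
  let S : Finset (Finset V) → Finset V := fun F => insert a (F.biUnion id)
  have hne : ({F ∈ G.powerset | #(S F) ≤ #F * (q - 1) + 1}).Nonempty :=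
    ⟨∅, by simp [S]⟩
  obtain ⟨F, hF, hmax⟩ := Finset.exists_max_image _ Finset.card hne
  simp only [Finset.mem_filter, Finset.mem_powerset] at hF hmax
  have hall : ∀ b ∈ B, b ∈ S F := by
    by_contra! hb
    obtain ⟨b, hbB, hb⟩ := hb
    have hex : ∃ e ∈ G, (∃ x ∈ e, x ∈ S F) ∧ ∃ y ∈ e, y ∉ S F := by
      by_contra! hno
      have := (Linked.filter_of_const (G' := G) (fun x => x ∈ S F)
        (fun e he x hx y hy hxS => by
          by_contra hyS
          exact hyS (hno e he ⟨x, hx, hxS⟩ y hy)) (fun e he _ => he)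
        (by simp [S]) (hc a ha b hbB)).2
      exact hb this
    obtain ⟨e, he, ⟨x, hx, hxS⟩, y, hy, hyS⟩ := hex
    have heF : e ∉ F := fun h => hyS (by
      simp only [S, Finset.mem_insert, Finset.mem_biUnion, id]
      exact Or.inr ⟨e, h, hy⟩)
    have hS : S (insert e F) = S F ∪ e := by
      ext z
      simp only [S, Finset.mem_insert, Finset.mem_biUnion, id, Finset.mem_union]
      constructor
      · rintro (h | ⟨f, rfl | hf, h⟩)
        · exact Or.inl (Or.inl h)
        · exact Or.inr h
        · exact Or.inl (Or.inr ⟨f, hf, h⟩)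
      · rintro ((h | ⟨f, hf, h⟩) | h)
        · exact Or.inl h
        · exact Or.inr ⟨f, Or.inr hf, h⟩
        · exact Or.inr ⟨e, Or.inl rfl, h⟩
    have h1 : #(S F ∪ e) + 1 ≤ #(S F) + q := by
      have := Finset.card_union_add_card_inter (S F) e
      have h2 : 0 < #(S F ∩ e) := Finset.card_pos.2 ⟨x, Finset.mem_inter.2 ⟨hxS, hx⟩⟩
      rw [(hG e he).2] at this
      omega
    have hq : 0 < q := (hG e he).2 ▸ Finset.card_pos.2 ⟨x, hx⟩
    have h3 := hmax (insert e F) ⟨Finset.insert_subset he hF.1, by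
      rw [hS, Finset.card_insert_of_notMem heF, add_mul]
      omega⟩
    rw [Finset.card_insert_of_notMem heF] at h3
    omega
  calc #B ≤ #(S F) := Finset.card_le_card hall
    _ ≤ #F * (q - 1) + 1 := hF.2
    _ ≤ #G * (q - 1) + 1 := by gcongr; exact hF.1

/-- A hypergraph on `A ∋ a` is a connected hypergraph on the component of `a` and a hypergraph on
the rest. -/
theorem sum_powerset_powersetCard_eq {q : ℕ} (hq : 0 < q) {M : Type*} [AddCommMonoid M]
    (F : Finset (Finset V) → M) {A : Finset V} {a : V} (ha : a ∈ A) :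
    ∑ G ∈ (A.powersetCard q).powerset, F G =
      ∑ B ∈ A.powerset with a ∈ B, ∑ G₁ ∈ connectedOn q B,
        ∑ G₂ ∈ ((A \ B).powersetCard q).powerset, F (G₁ ∪ G₂) := by
  classical
  simp_rw [← Finset.sum_product']
  rw [Finset.sum_sigma']
  -- The set `B` is the component of `a`. An edge that meets it lies inside it, so every edge is
  -- contained in `B` or in `A \ B`.
  refine Finset.sum_bij'
    (i := fun G _ => ⟨A.filter (Linked G a), G.filter (· ⊆ A.filter (Linked G a)),
      G.filter fun e => ¬ (e ⊆ A.filter (Linked G a))⟩)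
    (j := fun p _ => p.2.1 ∪ p.2.2) ?_ ?_ ?_ ?_ ?_
  · intro G hG
    simp only [Finset.mem_powerset, Finset.subset_iff, Finset.mem_powersetCard] at hG
    have hsub : ∀ e ∈ G, ∀ x ∈ e, Linked G a x → ∀ y ∈ e, Linked G a y :=
      fun e he x hx hax y hy => hax.trans (Linked.of_mem he hx hy)
    simp only [Finset.mem_sigma, Finset.mem_filter, Finset.mem_powerset, Finset.mem_product,
      mem_connectedOn]
    refine ⟨⟨Finset.filter_subset _ _, ha, Linked.refl _ _⟩, ⟨fun e he => ⟨he.2, (hG he.1).2⟩, ?_⟩,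
      ?_⟩
    · have key : ∀ x, Linked G a x →
          Linked (G.filter (· ⊆ A.filter (Linked G a))) a x := fun x hx =>
        (Linked.filter_of_const (fun y => Linked G a y)
          (fun e he x hx y hy hax => hsub e he x hx hax y hy)
          (fun e he h => Finset.mem_filter.2 ⟨he, fun y hy =>
            Finset.mem_filter.2 ⟨(hG he).1 hy, h y hy⟩⟩) (Linked.refl G a) hx).1
      exact fun x hx y hy => (key x hx.2).symm.trans (key y hy.2)
    · intro e he
      obtain ⟨he, hne⟩ := Finset.mem_filter.1 he
      refine Finset.mem_powersetCard.2 ⟨fun x hx => ?_, (hG he).2⟩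
      refine Finset.mem_sdiff.2 ⟨(hG he).1 hx, fun hx' => hne fun y hy => ?_⟩
      exact Finset.mem_filter.2 ⟨(hG he).1 hy, hsub e he x hx (Finset.mem_filter.1 hx').2 y hy⟩
  · rintro ⟨B, G₁, G₂⟩ h
    simp only [Finset.mem_sigma, Finset.mem_filter, Finset.mem_powerset, Finset.mem_product,
      mem_connectedOn] at h
    obtain ⟨⟨hB, haB⟩, ⟨h1, h1c⟩, h2⟩ := h
    simp only [Finset.mem_powerset]
    refine Finset.union_subset (fun e he => ?_) (fun e he => ?_)
    · exact Finset.mem_powersetCard.2 ⟨(h1 e he).1.trans hB, (h1 e he).2⟩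
    · have := Finset.mem_powersetCard.1 (h2 he)
      exact Finset.mem_powersetCard.2 ⟨this.1.trans Finset.sdiff_subset, this.2⟩
  · intro G _
    exact Finset.filter_union_filter_not_eq _ _
  · rintro ⟨B, G₁, G₂⟩ h
    simp only [Finset.mem_sigma, Finset.mem_filter, Finset.mem_powerset, Finset.mem_product,
      mem_connectedOn] at h
    obtain ⟨⟨hB, haB⟩, ⟨h1, h1c⟩, h2⟩ := h
    have hG2 : ∀ e ∈ G₂, e ⊆ A \ B ∧ #e = q := fun e he => Finset.mem_powersetCard.1 (h2 he)
    have hcomp : A.filter (Linked (G₁ ∪ G₂) a) = B := by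
      ext x
      simp only [Finset.mem_filter]
      constructor
      · rintro ⟨_, hx⟩
        refine (Linked.filter_of_const (G' := G₁ ∪ G₂) (fun y => y ∈ B) ?_
          (fun e he _ => he) haB hx).2
        intro e he y hy z hz hyB
        rcases Finset.mem_union.1 he with he | he
        · exact (h1 e he).1 hz
        · exact absurd hyB (Finset.mem_sdiff.1 ((hG2 e he).1 hy)).2
      · exact fun hx => ⟨hB hx, (h1c a haB x hx).mono Finset.subset_union_left⟩
    -- Here `0 < q` matters: an empty edge would be contained in both parts.
    have hno : ∀ e ∈ G₂, ¬ e ⊆ B := fun e he heB => by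
      obtain ⟨x, hx⟩ : e.Nonempty := Finset.card_pos.1 ((hG2 e he).2 ▸ hq)
      exact (Finset.mem_sdiff.1 ((hG2 e he).1 hx)).2 (heB hx)
    have e1 : (G₁ ∪ G₂).filter (· ⊆ B) = G₁ := by
      ext e
      simp only [Finset.mem_filter, Finset.mem_union]
      exact ⟨fun ⟨h, hB⟩ => h.resolve_right fun h' => hno e h' hB,
        fun h => ⟨Or.inl h, (h1 e h).1⟩⟩
    have e2 : (G₁ ∪ G₂).filter (fun e => ¬ e ⊆ B) = G₂ := by
      ext e
      simp only [Finset.mem_filter, Finset.mem_union]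
      exact ⟨fun ⟨h, hB⟩ => h.resolve_left fun h' => hB (h1 e h').1,
        fun h => ⟨Or.inr h, hno e h⟩⟩
    simp only [hcomp, e1, e2]
  · intro G _
    exact congrArg F (Finset.filter_union_filter_not_eq _ _).symm

end Hypergraph

/-! ### Removing a hyperedge -/

section EdgeRemoval

set_option linter.unusedSectionVars false

variable {V : Type*} [Fintype V] [DecidableEq V] {q : ℕ}

/-- The fiber of `c : V → Fin q` over `j`. -/
def fiber (c : V → Fin q) (j : Fin q) : Finset V := univ.filter fun x => c x = j

@[simp]
theorem mem_fiber {c : V → Fin q} {j : Fin q} {x : V} : x ∈ fiber c j ↔ c x = j := by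
  simp [fiber]

/-- Removing a hyperedge `r 0, …, r (q-1)` from a connected hypergraph leaves connected
hypergraphs on the fibers of some `c`, where each nonempty fiber contains `r j`. -/
theorem exists_retraction (hq : 0 < q) {G : Finset (Finset V)} (hG : G ∈ connectedOn q univ)
    {r : Fin q → V} (hr : univ.image r ∈ G) :
    ∃ (c : V → Fin q) (T : Fin q → Finset (Finset V)), (∀ j, (fiber c j).Nonempty → c (r j) = j) ∧
      (∀ j, T j ∈ connectedOn q (fiber c j)) ∧ univ.biUnion T = G.erase (univ.image r) := by
  classical
  have : Nonempty (Fin q) := ⟨⟨0, hq⟩⟩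
  obtain ⟨hu, hc⟩ := mem_connectedOn.1 hG
  set G' := G.erase (univ.image r) with hG'
  have hins : insert (univ.image r) G' = G := Finset.insert_erase hr
  have hex : ∀ x, ∃ j, Linked G' (r j) x := fun x => by
    have := hc (r ⟨0, hq⟩) (mem_univ _) x (mem_univ _)
    rw [← hins] at this
    rcases this.of_insert with h | ⟨y, hy, h⟩
    · exact ⟨_, h⟩
    · obtain ⟨j, _, rfl⟩ := Finset.mem_image.1 hy
      exact ⟨j, h⟩
  -- `epsilon` depends only on the predicate, and linked nodes have the same predicate. So `c` is
  -- constant on the components of `G'`, and every nonempty fiber is one component. If several `r j`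
  -- share a component, all but one of their fibers are empty.
  let c : V → Fin q := fun x => Classical.epsilon fun j => Linked G' (r j) x
  have hcs : ∀ x, Linked G' (r (c x)) x := fun x => Classical.epsilon_spec (hex x)
  have hcc : ∀ x y, Linked G' x y → c x = c y := fun x y h => by
    have : (fun j => Linked G' (r j) x) = fun j => Linked G' (r j) y := by
      funext j
      exact propext ⟨fun h' => h'.trans h, fun h' => h'.trans h.symm⟩
    simp only [c, this]
  refine ⟨c, fun j => G'.filter (· ⊆ fiber c j), ?_, ?_, ?_⟩
  · rintro j ⟨x, hx⟩
    have := hcs x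
    rw [mem_fiber.1 hx] at this
    rw [hcc _ _ this, mem_fiber.1 hx]
  · intro j
    rw [mem_connectedOn]
    refine ⟨fun e he => ⟨(Finset.mem_filter.1 he).2,
      (hu e (Finset.mem_of_mem_erase (Finset.mem_filter.1 he).1)).2⟩, ?_⟩
    intro a ha b hb
    rw [mem_fiber] at ha hb
    have hab : Linked G' a b := by
      have h1 := hcs a
      have h2 := hcs b
      rw [ha] at h1
      rw [hb] at h2
      exact h1.symm.trans h2
    refine (Linked.filter_of_const (fun y => c y = j) ?_ ?_ ha hab).1
    · intro e he x hx y hy hxj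
      rw [← hcc x y (Linked.of_mem he hx hy), hxj]
    · intro e he h
      exact Finset.mem_filter.2 ⟨he, fun x hx => mem_fiber.2 (h x hx)⟩
  · ext e
    simp only [Finset.mem_biUnion, Finset.mem_univ, true_and, Finset.mem_filter]
    refine ⟨fun ⟨_, h, _⟩ => h, fun h => ?_⟩
    have hcard := (hu e (Finset.mem_of_mem_erase h)).2
    obtain ⟨x, hx⟩ : e.Nonempty := Finset.card_pos.1 (hcard ▸ hq)
    exact ⟨c x, h, fun y hy => mem_fiber.2 (hcc _ _ (Linked.of_mem h hy hx))⟩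

theorem pairwise_disjoint_of_fiber (hq : 0 < q) {c : V → Fin q} {T : Fin q → Finset (Finset V)}
    (hT : ∀ j, ∀ e ∈ T j, e ⊆ fiber c j ∧ #e = q) {i j : Fin q} (hij : i ≠ j) :
    Disjoint (T i) (T j) := by
  rw [Finset.disjoint_left]
  intro e hi hj
  obtain ⟨x, hx⟩ : e.Nonempty := Finset.card_pos.1 ((hT i e hi).2 ▸ hq)
  have h1 := mem_fiber.1 ((hT i e hi).1 hx)
  have h2 := mem_fiber.1 ((hT j e hj).1 hx)
  exact hij (h1.symm.trans h2)

theorem card_biUnion_of_fiber (hq : 0 < q) {c : V → Fin q} {T : Fin q → Finset (Finset V)}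
    (hT : ∀ j, ∀ e ∈ T j, e ⊆ fiber c j ∧ #e = q) :
    #(univ.biUnion T) = ∑ j, #(T j) :=
  Finset.card_biUnion fun _ _ _ _ hij => pairwise_disjoint_of_fiber hq hT hij

theorem sum_card_fiber (c : V → Fin q) : ∑ j, #(fiber c j) = Fintype.card V := by
  simp only [fiber]
  rw [← Finset.card_univ, Finset.card_eq_sum_card_fiberwise (f := c) (t := univ) (by simp)]

theorem image_notMem_biUnion (hq : 2 ≤ q) {c : V → Fin q} {T : Fin q → Finset (Finset V)}
    (hT : ∀ j, ∀ e ∈ T j, e ⊆ fiber c j ∧ #e = q) {r : Fin q → V} (hr : ∀ j, c (r j) = j) :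
    univ.image r ∉ univ.biUnion T := by
  intro h
  obtain ⟨j, _, h⟩ := Finset.mem_biUnion.1 h
  have h0 := mem_fiber.1 ((hT j _ h).1 (Finset.mem_image_of_mem r (mem_univ ⟨0, by omega⟩)))
  have h1 := mem_fiber.1 ((hT j _ h).1 (Finset.mem_image_of_mem r (mem_univ ⟨1, by omega⟩)))
  rw [hr] at h0 h1
  have := h0.trans h1.symm
  simp at this

/-- A hypertree with a marked (ordered) hyperedge is the same as `q` disjoint hypertrees that
cover all nodes, with one marked node each. -/
theorem sum_treesOn_edges (hq : 2 ≤ q) {M : Type*} [AddCommMonoid M]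
    (F : Finset (Finset V) → (Fin q → V) → M) :
    ∑ T ∈ treesOn q (univ : Finset V), ∑ r : Fin q → V with univ.image r ∈ T, F T r =
      ∑ c : V → Fin q, ∑ r ∈ Fintype.piFinset (fiber c),
        ∑ T ∈ Fintype.piFinset fun j => treesOn q (fiber c j),
          F (insert (univ.image r) (univ.biUnion T)) r := by
  classical
  have hq0 : 0 < q := by omega
  simp_rw [← Finset.sum_product']
  rw [Finset.sum_sigma', Finset.sum_sigma']
  symm
  refine Finset.sum_bij (fun x _ => ⟨insert (univ.image x.2.1) (univ.biUnion x.2.2), x.2.1⟩)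
    ?_ ?_ ?_ ?_
  · rintro ⟨c, r, T⟩ h
    simp only [Finset.mem_sigma, Finset.mem_univ, true_and, Finset.mem_product,
      Fintype.mem_piFinset, mem_fiber, mem_treesOn, mem_connectedOn] at h
    obtain ⟨hr, hT⟩ := h
    have hinj : Function.Injective r := fun i j hij => by rw [← hr i, hij, hr j]
    simp only [Finset.mem_sigma, Finset.mem_filter, Finset.mem_univ,
      Finset.mem_insert_self, and_true]
    rw [mem_treesOn, mem_connectedOn]
    refine ⟨⟨fun e he => ⟨Finset.subset_univ e, ?_⟩, ?_⟩, ?_⟩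
    · rcases Finset.mem_insert.1 he with rfl | he
      · rw [Finset.card_image_of_injective _ hinj, Finset.card_univ, Fintype.card_fin]
      · obtain ⟨j, _, he⟩ := Finset.mem_biUnion.1 he
        exact ((hT j).1.1 e he).2
    · have hx : ∀ x, Linked (insert (univ.image r) (univ.biUnion T)) (r ⟨0, hq0⟩) x := by
        intro x
        refine (Linked.of_mem (Finset.mem_insert_self _ _)
          (Finset.mem_image_of_mem r (mem_univ _))
          (Finset.mem_image_of_mem r (mem_univ (c x)))).trans ?_
        refine ((hT (c x)).1.2 (r (c x)) (hr _) x rfl).mono ?_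
        exact (Finset.subset_biUnion_of_mem T (mem_univ (c x))).trans (Finset.subset_insert _ _)
      exact fun a _ b _ => (hx a).symm.trans (hx b)
    · rw [Finset.card_insert_of_notMem (image_notMem_biUnion hq (fun j => (hT j).1.1) hr),
        card_biUnion_of_fiber hq0 (fun j => (hT j).1.1), Finset.card_univ, ← sum_card_fiber c,
        add_mul, Finset.sum_mul, one_mul]
      have : ∀ j, #(fiber c j) = #(T j) * (q - 1) + 1 := fun j => (hT j).2.symm
      simp_rw [this, Finset.sum_add_distrib]
      simp
      omega
  · rintro ⟨c, r, T⟩ h ⟨c', r', T'⟩ h' heq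
    simp only [Finset.mem_sigma, Finset.mem_univ, true_and, Finset.mem_product,
      Fintype.mem_piFinset, mem_fiber, mem_treesOn, mem_connectedOn] at h h'
    obtain ⟨hr, hT⟩ := h
    obtain ⟨hr', hT'⟩ := h'
    simp only [Sigma.mk.injEq, heq_eq_eq] at heq
    obtain ⟨heq, rfl⟩ := heq
    have hb : univ.biUnion T = univ.biUnion T' := by
      rw [← Finset.erase_insert (image_notMem_biUnion hq (fun j => (hT j).1.1) hr), heq,
        Finset.erase_insert (image_notMem_biUnion hq (fun j => (hT' j).1.1) hr')]
    -- The fibers are recovered as the components that remain when the marked edge is removed,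
    -- labelled by the `r j` they contain.
    have hcc : c = c' := by
      funext x
      have hl : Linked (univ.biUnion T) (r (c x)) x :=
        ((hT (c x)).1.2 (r (c x)) (hr _) x rfl).mono
          (Finset.subset_biUnion_of_mem T (mem_univ (c x)))
      rw [hb] at hl
      have := hl.eq_of_const c' (fun e he a ha b hb => by
        obtain ⟨j, _, he⟩ := Finset.mem_biUnion.1 he
        rw [mem_fiber.1 (((hT' j).1.1 e he).1 ha), mem_fiber.1 (((hT' j).1.1 e he).1 hb)])
      rw [← this, hr']
    subst hcc
    have hTT : ∀ {S : Fin q → Finset (Finset V)}, (∀ j, ∀ e ∈ S j, e ⊆ fiber c j ∧ #e = q) →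
        ∀ j, S j = (univ.biUnion S).filter (· ⊆ fiber c j) := by
      intro S hS j
      ext e
      simp only [Finset.mem_filter, Finset.mem_biUnion, Finset.mem_univ, true_and]
      refine ⟨fun he => ⟨⟨j, he⟩, (hS j e he).1⟩, fun ⟨⟨i, hi⟩, he⟩ => ?_⟩
      obtain ⟨x, hx⟩ : e.Nonempty := Finset.card_pos.1 ((hS i e hi).2 ▸ hq0)
      have := (mem_fiber.1 ((hS i e hi).1 hx)).symm.trans (mem_fiber.1 (he hx))
      exact this ▸ hi
    have : T = T' := by
      funext j
      rw [hTT (fun j => (hT j).1.1) j, hTT (fun j => (hT' j).1.1) j, hb]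
    rw [this]
  · rintro ⟨T, r⟩ h
    simp only [Finset.mem_sigma, Finset.mem_filter, Finset.mem_univ, true_and] at h
    obtain ⟨hT, hr⟩ := h
    obtain ⟨hTc, hcard⟩ := mem_treesOn.1 hT
    obtain ⟨c, S, h1, h2, h3⟩ := exists_retraction hq0 hTc hr
    have hS : ∀ j, ∀ e ∈ S j, e ⊆ fiber c j ∧ #e = q := fun j => (mem_connectedOn.1 (h2 j)).1
    have hle : ∀ j, #(fiber c j) ≤ #(S j) * (q - 1) + 1 := fun j =>
      card_le_of_mem_connectedOn (h2 j)
    -- Each branch obeys the upper bound for connected hypergraphs, and the edge count of a tree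
    -- makes the totals agree. Hence equality holds in every branch: all of them are trees, in
    -- particular nonempty.
    have hsum : ∑ j, #(fiber c j) = ∑ j, (#(S j) * (q - 1) + 1) := by
      rw [sum_card_fiber, ← Finset.card_univ, ← hcard, Finset.sum_add_distrib, ← Finset.sum_mul,
        ← card_biUnion_of_fiber hq0 hS, h3, Finset.card_erase_of_mem hr]
      have : 0 < #T := Finset.card_pos.2 ⟨_, hr⟩
      obtain ⟨k, hk⟩ : ∃ k, #T = k + 1 := ⟨#T - 1, by omega⟩
      rw [hk, Nat.add_sub_cancel, add_mul]
      simp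
      omega
    have heq := (Finset.sum_eq_sum_iff_of_le fun j _ => hle j).1 hsum
    have hr' : ∀ j, c (r j) = j := fun j => h1 j (Finset.card_pos.1 (by
      rw [heq j (mem_univ j)]; omega))
    refine ⟨⟨c, r, S⟩, ?_, ?_⟩
    · simp only [Finset.mem_sigma, Finset.mem_univ, true_and, Finset.mem_product,
        Fintype.mem_piFinset, mem_fiber, mem_treesOn]
      exact ⟨hr', fun j => ⟨h2 j, (heq j (mem_univ j)).symm⟩⟩
    · simp only [h3, Finset.insert_erase hr]
  · intro _ _
    rfl

/-- The ordered enumerations of a hyperedge. -/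
theorem sum_image_mem {T : Finset (Finset V)} (hT : ∀ e ∈ T, #e = q) {M : Type*}
    [AddCommMonoid M] (F : Finset V → M) :
    ∑ r : Fin q → V with univ.image r ∈ T, F (univ.image r) = q ! • ∑ e ∈ T, F e := by
  classical
  rw [← Finset.sum_fiberwise_of_maps_to (t := T) (g := fun r : Fin q → V => univ.image r)
    (fun r hr => (Finset.mem_filter.1 hr).2), Finset.smul_sum]
  refine Finset.sum_congr rfl fun e he => ?_
  rw [Finset.sum_congr rfl (g := fun _ => F e) (fun r hr => by rw [(Finset.mem_filter.1 hr).2]),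
    Finset.sum_const]
  congr 1
  have hcard : Fintype.card (Fin q ≃ e) = q ! := by
    have := Fintype.card_equiv (Fintype.equivOfCardEq (by simp [hT e he]) : Fin q ≃ e)
    simpa using this
  rw [← hcard, ← Finset.card_univ]
  symm
  refine Finset.card_bij (fun (f : Fin q ≃ e) _ => fun i => (f i : V)) ?_ ?_ ?_
  · intro f _
    have : univ.image (fun i => (f i : V)) = e := by
      ext x
      simp only [Finset.mem_image, Finset.mem_univ, true_and]
      exact ⟨fun ⟨i, hi⟩ => hi ▸ (f i).2, fun hx => ⟨f.symm ⟨x, hx⟩, by simp⟩⟩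
    simp only [Finset.mem_filter, Finset.mem_univ, this, he, and_self]
  · intro f _ g _ h
    ext i
    exact congrFun h i
  · intro r hr
    have hr := (Finset.mem_filter.1 hr).2
    have hmem : ∀ i, r i ∈ e := fun i => hr ▸ Finset.mem_image_of_mem r (mem_univ i)
    have hb : Function.Bijective fun i => (⟨r i, hmem i⟩ : e) := by
      rw [Fintype.bijective_iff_surjective_and_card]
      refine ⟨fun x => ?_, by simp [hT e he]⟩
      have hx : (x : V) ∈ univ.image r := hr ▸ x.2
      obtain ⟨i, _, hi⟩ := Finset.mem_image.1 hx
      exact ⟨i, Subtype.ext hi⟩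
    exact ⟨Equiv.ofBijective _ hb, mem_univ _, rfl⟩

/-- The same, with a marked node of the hyperedge. -/
theorem sum_image_mem_zero (hq : 0 < q) {T : Finset (Finset V)} (hT : ∀ e ∈ T, #e = q)
    (F : Finset V → V → ℝ) :
    ∑ r : Fin q → V with univ.image r ∈ T, F (univ.image r) (r ⟨0, hq⟩) =
      (q - 1)! * ∑ e ∈ T, ∑ a ∈ e, F e a := by
  classical
  -- Swapping positions shows that each of the `q` positions contributes equally; together they run
  -- through all nodes of the edge.
  have key : ∀ i : Fin q,
      ∑ r : Fin q → V with univ.image r ∈ T, F (univ.image r) (r i) =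
        ∑ r : Fin q → V with univ.image r ∈ T, F (univ.image r) (r ⟨0, hq⟩) := by
    intro i
    have him : ∀ (s : Equiv.Perm (Fin q)) (r : Fin q → V),
        univ.image (fun j => r (s j)) = univ.image r := fun s r => by
      ext x
      simp only [Finset.mem_image, Finset.mem_univ, true_and]
      exact ⟨fun ⟨j, hj⟩ => ⟨s j, hj⟩, fun ⟨j, hj⟩ => ⟨s.symm j, by simpa using hj⟩⟩
    refine Finset.sum_equiv ((Equiv.swap i ⟨0, hq⟩).arrowCongr (Equiv.refl V)) ?_ ?_
    · intro r
      simp only [Finset.mem_filter, Finset.mem_univ, true_and]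
      rw [show univ.image ((Equiv.swap i ⟨0, hq⟩).arrowCongr (Equiv.refl V) r) = univ.image r from
        him (Equiv.swap i ⟨0, hq⟩) r]
    · intro r _
      rw [show univ.image ((Equiv.swap i ⟨0, hq⟩).arrowCongr (Equiv.refl V) r) = univ.image r from
        him (Equiv.swap i ⟨0, hq⟩) r]
      simp [Equiv.arrowCongr]
  have h1 : (q : ℝ) * ∑ r : Fin q → V with univ.image r ∈ T, F (univ.image r) (r ⟨0, hq⟩) =
      q ! * ∑ e ∈ T, ∑ a ∈ e, F e a := by
    have h2 := sum_image_mem hT (fun e => ∑ a ∈ e, F e a)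
    rw [nsmul_eq_mul] at h2
    rw [← h2]
    calc (q : ℝ) * ∑ r : Fin q → V with univ.image r ∈ T, F (univ.image r) (r ⟨0, hq⟩)
        = ∑ i : Fin q, ∑ r : Fin q → V with univ.image r ∈ T, F (univ.image r) (r i) := by
          simp [key]
      _ = _ := by
          rw [Finset.sum_comm]
          refine Finset.sum_congr rfl fun r hr => ?_
          have hinj : Function.Injective r := by
            rw [← Set.injOn_univ, ← Finset.coe_univ, ← Finset.card_image_iff,
              hT _ (Finset.mem_filter.1 hr).2, Finset.card_univ, Fintype.card_fin]
          rw [Finset.sum_image fun i _ j _ h => hinj h]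
  have h3 : (q ! : ℝ) = q * (q - 1)! := by
    exact_mod_cast (Nat.mul_factorial_pred hq.ne').symm
  rw [h3, mul_assoc] at h1
  exact mul_left_cancel₀ (by positivity) h1

open Classical in
/-- The weighted number of connected hypergraphs with a marked hyperedge is at most that of
connected hypergraphs on the fibers of a map. -/
theorem sum_connectedOn_edges_le (hq : 0 < q) {lam : ℝ} (hl : 0 ≤ lam) :
    ∑ G ∈ connectedOn q (univ : Finset V), ∑ r : Fin q → V with univ.image r ∈ G, lam ^ #G ≤
      lam * ∑ c : V → Fin q, ∏ j, ((if (fiber c j).Nonempty then #(fiber c j) else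
        Fintype.card V : ℕ) * ∑ G ∈ connectedOn q (fiber c j), lam ^ #G) := by
  have hR : lam * ∑ c : V → Fin q, ∏ j, ((if (fiber c j).Nonempty then #(fiber c j) else
        Fintype.card V : ℕ) * ∑ G ∈ connectedOn q (fiber c j), lam ^ #G) =
      ∑ x ∈ (univ : Finset (V → Fin q)).sigma fun c =>
        (Fintype.piFinset fun j => if (fiber c j).Nonempty then fiber c j else univ) ×ˢ
          Fintype.piFinset fun j => connectedOn q (fiber c j),
        lam * ∏ j, lam ^ #(x.2.2 j) := by
    rw [Finset.sum_sigma, Finset.mul_sum]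
    refine Finset.sum_congr rfl fun c _ => ?_
    rw [Finset.sum_product]
    simp only [Finset.sum_const, Finset.prod_mul_distrib, Fintype.card_piFinset, nsmul_eq_mul,
      ← Finset.mul_sum, Finset.prod_univ_sum, Nat.cast_prod]
    rw [mul_left_comm]
    congr 1
    refine Finset.prod_congr rfl fun j _ => ?_
    split_ifs <;> simp
  rw [hR, Finset.sum_sigma']
  -- For an upper bound an injection is enough: the marked hypergraph is recovered from `c`, `r` and
  -- `T`. A nonempty fiber must contain its `r j`, whereas for an empty fiber `r j` can be any node,
  -- which costs the factor `Fintype.card V`.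
  have hex : ∀ p ∈ (connectedOn q (univ : Finset V)).sigma fun G =>
      univ.filter fun r : Fin q → V => univ.image r ∈ G,
      ∃ x ∈ (univ : Finset (V → Fin q)).sigma fun c =>
        (Fintype.piFinset fun j => if (fiber c j).Nonempty then fiber c j else univ) ×ˢ
          Fintype.piFinset fun j => connectedOn q (fiber c j),
        lam ^ #p.1 = lam * ∏ j, lam ^ #(x.2.2 j) ∧
          p = ⟨insert (univ.image x.2.1) (univ.biUnion x.2.2), x.2.1⟩ := by
    rintro ⟨G, r⟩ hp
    simp only [Finset.mem_sigma, Finset.mem_filter, Finset.mem_univ, true_and] at hp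
    obtain ⟨c, T, h1, h2, h3⟩ := exists_retraction hq hp.1 hp.2
    refine ⟨⟨c, r, T⟩, ?_, ?_, ?_⟩
    · simp only [Finset.mem_sigma, Finset.mem_univ, true_and, Finset.mem_product,
        Fintype.mem_piFinset]
      refine ⟨fun j => ?_, h2⟩
      split_ifs with h
      · exact mem_fiber.2 (h1 j h)
      · exact mem_univ _
    · have : #G = 1 + ∑ j, #(T j) := by
        rw [← card_biUnion_of_fiber hq (fun j => (mem_connectedOn.1 (h2 j)).1), h3,
          Finset.card_erase_of_mem hp.2]
        have : 0 < #G := Finset.card_pos.2 ⟨_, hp.2⟩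
        omega
      simp only [this, pow_add, pow_one, Finset.prod_pow_eq_pow_sum]
    · simp only [h3, Finset.insert_erase hp.2]
  rcases isEmpty_or_nonempty V with hV | hV
  · have : IsEmpty (Fin q → V) := ⟨fun r => hV.elim (r ⟨0, hq⟩)⟩
    rw [Finset.sum_sigma]
    simp only [Finset.univ_eq_empty, Finset.filter_empty, Finset.sum_empty, Finset.sum_const_zero]
    exact Finset.sum_nonneg fun x _ => mul_nonneg hl (Finset.prod_nonneg fun j _ => pow_nonneg hl _)
  have : Nonempty ((_ : V → Fin q) × (Fin q → V) × (Fin q → Finset (Finset V))) :=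
    ⟨fun _ => ⟨0, hq⟩, fun _ => Classical.arbitrary V, fun _ => ∅⟩
  choose! i hi1 hi2 hi3 using hex
  have hinj : Set.InjOn i ((connectedOn q (univ : Finset V)).sigma fun G =>
      univ.filter fun r : Fin q → V => univ.image r ∈ G) := fun p hp p' hp' h => by
    rw [hi3 p hp, hi3 p' hp', h]
  rw [Finset.sum_congr rfl hi2, ← Finset.sum_image (g := i)
    (f := fun x => lam * ∏ j, lam ^ #(x.2.2 j)) hinj]
  refine Finset.sum_le_sum_of_subset_of_nonneg (fun x hx => ?_) fun x _ _ => by positivity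
  obtain ⟨p, hp, rfl⟩ := Finset.mem_image.1 hx
  exact hi1 p hp

end EdgeRemoval

/-! ### Relabeling -/

section Relabel

set_option linter.unusedSectionVars false

variable {V W : Type*}

/-- The action of an embedding on hyperedges. -/
def edgeMap (u : W ↪ V) : Finset W ↪ Finset V := ⟨Finset.map u, Finset.map_injective u⟩

@[simp]
theorem edgeMap_apply (u : W ↪ V) (e : Finset W) : edgeMap u e = e.map u := rfl

theorem linked_map {u : W ↪ V} {G : Finset (Finset W)} {a b : W} :
    Linked (G.map (edgeMap u)) (u a) (u b) ↔ Linked G a b := by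
  constructor
  · intro h
    suffices ∀ y, Linked (G.map (edgeMap u)) (u a) y → ∃ b, u b = y ∧ Linked G a b by
      obtain ⟨b', hb, h⟩ := this _ h
      exact u.injective hb ▸ h
    intro y hy
    induction hy with
    | refl => exact ⟨a, rfl, Linked.refl _ _⟩
    | tail _ h ih =>
      obtain ⟨c, rfl, ih⟩ := ih
      obtain ⟨e, he, hc, hd⟩ := h
      obtain ⟨f, hf, rfl⟩ := Finset.mem_map.1 he
      obtain ⟨c', hc', hcc⟩ := Finset.mem_map.1 hc
      obtain ⟨d, hd', rfl⟩ := Finset.mem_map.1 hd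
      exact ⟨d, rfl, ih.trans (Linked.of_mem hf (u.injective hcc ▸ hc') hd')⟩
  · intro h
    induction h with
    | refl => exact Linked.refl _ _
    | tail _ h ih =>
      obtain ⟨e, he, hc, hd⟩ := h
      exact ih.trans (Linked.of_mem (e := e.map u)
        (Finset.mem_map.2 ⟨e, he, rfl⟩) (Finset.mem_map_of_mem _ hc) (Finset.mem_map_of_mem _ hd))

theorem connectedOn_map (u : W ↪ V) (q : ℕ) (B : Finset W) :
    connectedOn q (B.map u) = (connectedOn q B).map ⟨Finset.map (edgeMap u),
      Finset.map_injective _⟩ := by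
  ext G
  rw [mem_connectedOn, Finset.mem_map]
  constructor
  · rintro ⟨h1, h2⟩
    have : G ⊆ (B.powersetCard q).map (edgeMap u) := fun e he => by
      obtain ⟨w, hw, rfl⟩ := Finset.subset_map_iff.1 (h1 e he).1
      have := (h1 _ he).2
      rw [Finset.card_map] at this
      exact Finset.mem_map.2 ⟨w, Finset.mem_powersetCard.2 ⟨hw, this⟩, rfl⟩
    obtain ⟨G', hG', rfl⟩ := Finset.subset_map_iff.1 this
    refine ⟨G', mem_connectedOn.2 ⟨fun e he => Finset.mem_powersetCard.1 (hG' he), ?_⟩, rfl⟩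
    exact fun a ha b hb =>
      linked_map.1 (h2 _ (Finset.mem_map_of_mem _ ha) _ (Finset.mem_map_of_mem _ hb))
  · rintro ⟨G', hG', rfl⟩
    obtain ⟨h1, h2⟩ := mem_connectedOn.1 hG'
    constructor
    · intro e he
      obtain ⟨f, hf, rfl⟩ := Finset.mem_map.1 he
      exact ⟨Finset.map_subset_map.2 (h1 f hf).1, by simp [(h1 f hf).2]⟩
    · intro a ha b hb
      obtain ⟨a, ha', rfl⟩ := Finset.mem_map.1 ha
      obtain ⟨b, hb', rfl⟩ := Finset.mem_map.1 hb
      exact linked_map.2 (h2 a ha' b hb')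

theorem sum_connectedOn_map (u : W ↪ V) (q : ℕ) (B : Finset W) {M : Type*} [AddCommMonoid M]
    (F : Finset (Finset V) → M) :
    ∑ G ∈ connectedOn q (B.map u), F G =
      ∑ G ∈ connectedOn q B, F (G.map (edgeMap u)) := by
  rw [connectedOn_map, Finset.sum_map]
  rfl

theorem sum_treesOn_map (u : W ↪ V) (q : ℕ) (B : Finset W) {M : Type*} [AddCommMonoid M]
    (F : Finset (Finset V) → M) :
    ∑ G ∈ treesOn q (B.map u), F G =
      ∑ G ∈ treesOn q B, F (G.map (edgeMap u)) := by
  simp only [treesOn, Finset.sum_filter, sum_connectedOn_map, Finset.card_map]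

/-- A numbering of a finite set. -/
theorem exists_map_univ_eq (B : Finset V) : ∃ u : Fin #B ↪ V, univ.map u = B := by
  refine ⟨B.equivFin.symm.toEmbedding.trans (Function.Embedding.subtype _), ?_⟩
  ext x
  simp only [Finset.mem_map, Finset.mem_univ, true_and]
  refine ⟨fun ⟨i, hi⟩ => hi ▸ (B.equivFin.symm i).2, fun hx => ⟨B.equivFin ⟨x, hx⟩, ?_⟩⟩
  simp

theorem sum_connectedOn_card (q : ℕ) (B : Finset V) {M : Type*} [AddCommMonoid M] (F : ℕ → M) :
    ∑ G ∈ connectedOn q B, F #G = ∑ G ∈ connectedOn q (univ : Finset (Fin #B)), F #G := by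
  obtain ⟨u, hu⟩ := exists_map_univ_eq B
  conv_lhs => rw [← hu, sum_connectedOn_map]
  simp

/-- The empty node set counts as connected, whereas `treesOn q ∅` is empty by its edge count. This
is why empty fibers need separate care for connected hypergraphs but not for trees. -/
theorem connectedOn_empty {q : ℕ} (hq : 0 < q) : connectedOn q (∅ : Finset V) = {∅} := by
  ext G
  rw [mem_connectedOn, Finset.mem_singleton]
  constructor
  · rintro ⟨h, _⟩
    refine Finset.eq_empty_of_forall_notMem fun e he => ?_
    have := h e he
    rw [Finset.subset_empty.1 this.1, Finset.card_empty] at this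
    omega
  · rintro rfl
    simp

theorem connectedOn_singleton {q : ℕ} (hq : 2 ≤ q) (a : V) :
    connectedOn q ({a} : Finset V) = {∅} := by
  ext G
  rw [mem_connectedOn, Finset.mem_singleton]
  constructor
  · rintro ⟨h, _⟩
    refine Finset.eq_empty_of_forall_notMem fun e he => ?_
    have h1 := h e he
    have := Finset.card_le_card h1.1
    rw [h1.2, Finset.card_singleton] at this
    omega
  · rintro rfl
    simp [Linked.refl]

end Relabel

/-! ### Sums over maps to `Fin q` -/

/-- The product formula for exponential generating functions. -/
theorem sum_prod_card_fiber {V : Type*} [Fintype V] [DecidableEq V] {q : ℕ} (f : Fin q → ℕ → ℝ) :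
    (∑ c : V → Fin q, ∏ j, f j #(fiber c j)) / ((Fintype.card V)! : ℝ) =
      ∑ m ∈ piAntidiag univ (Fintype.card V), ∏ j, (f j (m j) / ((m j)! : ℝ)) := by
  classical
  -- An umbral argument: `L` replaces each monomial `∏ X_j ^ k_j` by `∏ f j (k_j)`. Apply it to the
  -- two expansions of `(∑ X_j) ^ card V`, one over maps `c` and one with multinomial coefficients.
  let L : MvPolynomial (Fin q) ℝ →ₗ[ℝ] ℝ :=
    (MvPolynomial.basisMonomials (Fin q) ℝ).constr ℝ fun k => ∏ j, f j (k j)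
  have hL : ∀ k : Fin q → ℕ, L (∏ j, MvPolynomial.X j ^ k j) = ∏ j, f j (k j) := by
    intro k
    have : (∏ j, MvPolynomial.X j ^ k j : MvPolynomial (Fin q) ℝ) =
        MvPolynomial.basisMonomials (Fin q) ℝ (Finsupp.equivFunOnFinite.symm k) := by
      simp only [MvPolynomial.coe_basisMonomials]
      rw [← MvPolynomial.prod_X_pow_eq_monomial]
      symm
      refine Finset.prod_subset (Finset.subset_univ _) fun x _ hx => ?_
      have : k x = 0 := by simpa using hx
      simp [this]
    rw [this]
    exact Module.Basis.constr_basis _ _ _ _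
  have h1 : (∑ j, MvPolynomial.X j : MvPolynomial (Fin q) ℝ) ^ Fintype.card V =
      ∑ c : V → Fin q, ∏ j, MvPolynomial.X j ^ #(fiber c j) := by
    rw [← Finset.card_univ, ← Finset.prod_const, Finset.prod_univ_sum, Fintype.piFinset_univ]
    refine Finset.sum_congr rfl fun c _ => ?_
    rw [← Finset.prod_fiberwise univ c]
    refine Finset.prod_congr rfl fun j _ => ?_
    rw [Finset.prod_congr rfl (g := fun _ => MvPolynomial.X j)
      (fun x hx => by rw [(Finset.mem_filter.1 hx).2]), Finset.prod_const]
    rfl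
  rw [Finset.sum_pow_eq_sum_piAntidiag] at h1
  have h2 := congrArg L h1
  simp only [map_sum, hL] at h2
  rw [← h2, Finset.sum_div]
  refine Finset.sum_congr rfl fun k hk => ?_
  have hk' : ∑ j, k j = Fintype.card V := (Finset.mem_piAntidiag.1 hk).1
  have h3 : ((Nat.multinomial univ k : MvPolynomial (Fin q) ℝ) * ∏ j, MvPolynomial.X j ^ k j) =
      (Nat.multinomial univ k : ℝ) • ∏ j, MvPolynomial.X j ^ k j := by
    rw [MvPolynomial.smul_eq_C_mul]
    simp
  rw [h3, map_smul, hL, smul_eq_mul, Finset.prod_div_distrib]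
  have h4 := Nat.multinomial_spec univ k
  rw [hk'] at h4
  rw [← h4]
  push_cast
  have h5 : (∏ j, ((k j)! : ℝ)) ≠ 0 := Finset.prod_ne_zero_iff.2 fun j _ => by positivity
  have h6 : (Nat.multinomial univ k : ℝ) ≠ 0 := by
    exact_mod_cast (Nat.multinomial_pos univ k).ne'
  field_simp

/-! ### The number of connected hypergraphs -/

/-- The weighted number of connected hypergraphs on `[v]`, each hyperedge having weight `lam`. -/
def connectedWeight (q : ℕ) (lam : ℝ) (v : ℕ) : ℝ :=
  ∑ G ∈ connectedOn q (univ : Finset (Fin v)), lam ^ #G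

theorem connectedWeight_nonneg {q : ℕ} {lam : ℝ} (hl : 0 ≤ lam) (v : ℕ) :
    0 ≤ connectedWeight q lam v := Finset.sum_nonneg fun _ _ => by positivity

theorem connectedWeight_one {q : ℕ} (hq : 2 ≤ q) (lam : ℝ) : connectedWeight q lam 1 = 1 := by
  have : (univ : Finset (Fin 1)) = {0} := rfl
  rw [connectedWeight, this, connectedOn_singleton hq]
  simp

theorem continuous_connectedWeight (q v : ℕ) : Continuous fun lam => connectedWeight q lam v := by
  unfold connectedWeight
  fun_prop

/-- Count connected hypergraphs with a marked ordered edge. There are `q! * #G` markings and `#G *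
(q - 1) ≥ v - 1`; removing the edge leaves one rooted connected piece per position. The value `n` at
`m j = 0` bounds the free choice of a node for an empty piece. -/
theorem connectedWeight_le {q : ℕ} (hq : 2 ≤ q) {lam : ℝ} (hl : 0 ≤ lam) {n v : ℕ} (hv : v ≤ n) :
    ((v : ℝ) - 1) * (q ! : ℝ) * (connectedWeight q lam v / (v ! : ℝ)) ≤
      (q - 1) * (lam * ∑ m ∈ piAntidiag (univ : Finset (Fin q)) v,
        ∏ j, ((if m j = 0 then (n : ℝ) else m j * connectedWeight q lam (m j)) /
          ((m j)! : ℝ))) := by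
  classical
  have h1 := sum_connectedOn_edges_le (V := Fin v) (by omega : 0 < q) hl
  have h2 : ∑ c : Fin v → Fin q, ∏ j, ((if (fiber c j).Nonempty then #(fiber c j) else
        Fintype.card (Fin v) : ℕ) * ∑ G ∈ connectedOn q (fiber c j), lam ^ #G) ≤
      ∑ c : Fin v → Fin q, ∏ j, (if #(fiber c j) = 0 then (n : ℝ) else
        #(fiber c j) * connectedWeight q lam #(fiber c j)) := by
    refine Finset.sum_le_sum fun c _ => Finset.prod_le_prod (fun j _ => ?_) fun j _ => ?_
    · exact mul_nonneg (Nat.cast_nonneg _) (Finset.sum_nonneg fun _ _ => by positivity)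
    · rcases (fiber c j).eq_empty_or_nonempty with h | h
      · rw [h, connectedOn_empty (by omega)]
        simp [hv]
      · rw [if_pos h, if_neg h.card_pos.ne', sum_connectedOn_card q (fiber c j) (fun k => lam ^ k)]
        rfl
  have h3 := sum_prod_card_fiber (V := Fin v) (q := q) fun _ m =>
    if m = 0 then (n : ℝ) else m * connectedWeight q lam m
  rw [Fintype.card_fin] at h3
  rw [← h3, ← mul_div_assoc, ← mul_div_assoc, ← mul_div_assoc]
  refine div_le_div_of_nonneg_right ?_ (by positivity)
  calc ((v : ℝ) - 1) * (q ! : ℝ) * connectedWeight q lam v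
      ≤ (q - 1) * ∑ G ∈ connectedOn q (univ : Finset (Fin v)),
          ∑ r : Fin q → Fin v with univ.image r ∈ G, lam ^ #G := by
        rw [connectedWeight, Finset.mul_sum, Finset.mul_sum]
        refine Finset.sum_le_sum fun G hG => ?_
        rw [sum_image_mem (fun e he => ((mem_connectedOn.1 hG).1 e he).2) (fun _ => lam ^ #G)]
        have h4 := card_le_of_mem_connectedOn hG
        rw [Finset.card_univ, Fintype.card_fin] at h4
        have h5 : (v : ℝ) ≤ #G * (q - 1) + 1 := by
          have : ((q - 1 : ℕ) : ℝ) = q - 1 := by push_cast [show 1 ≤ q by omega]; ring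
          rw [← this]
          exact_mod_cast h4
        simp only [Finset.sum_const, nsmul_eq_mul]
        have : (0 : ℝ) ≤ q ! * lam ^ #G := by positivity
        nlinarith
    _ ≤ (q - 1) * (lam * _) := by
        have : (0 : ℝ) ≤ (q : ℝ) - 1 := by
          have : (2 : ℝ) ≤ q := by exact_mod_cast hq
          linarith
        exact mul_le_mul_of_nonneg_left (h1.trans (mul_le_mul_of_nonneg_left h2 hl)) this

/-- Sums over compositions with bounded total are bounded by the power of the sum. -/
theorem sum_piAntidiag_le {q n : ℕ} {f : ℕ → ℝ} (hf : ∀ m, 0 ≤ f m) (s : Finset ℕ)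
    (hs : ∀ v ∈ s, v ≤ n) :
    ∑ v ∈ s, ∑ m ∈ piAntidiag (univ : Finset (Fin q)) v, ∏ j, f (m j) ≤
      (∑ m ∈ range (n + 1), f m) ^ q := by
  have h : (∑ m ∈ range (n + 1), f m) ^ q =
      ∑ m ∈ Fintype.piFinset fun _ : Fin q => range (n + 1), ∏ j, f (m j) := by
    rw [← Finset.prod_univ_sum]
    simp
  rw [h, ← Finset.sum_biUnion]
  · refine Finset.sum_le_sum_of_subset_of_nonneg (fun m hm => ?_) fun m _ _ =>
      Finset.prod_nonneg fun j _ => hf _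
    obtain ⟨v, hv, hm⟩ := Finset.mem_biUnion.1 hm
    have hm := (Finset.mem_piAntidiag.1 hm).1
    refine Fintype.mem_piFinset.2 fun j => Finset.mem_range.2 ?_
    have := Finset.single_le_sum (f := m) (fun _ _ => Nat.zero_le _) (mem_univ j)
    have h3 : m j ≤ v := this.trans hm.le
    have := hs v hv
    omega
  · intro v _ w _ hvw
    rw [Function.onFun, Finset.disjoint_left]
    intro m hm hm'
    exact hvw ((Finset.mem_piAntidiag.1 hm).1.symm.trans (Finset.mem_piAntidiag.1 hm').1)

/-- The generating function of rooted connected hypergraphs with at least two of `n` nodes. -/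
def rootedWeightSum (q : ℕ) (s : ℝ) (n : ℕ) (lam : ℝ) : ℝ :=
  ∑ v ∈ Icc 2 n, (v : ℝ) * connectedWeight q lam v * (n : ℝ) ^ (v - 1) * s ^ v / (v ! : ℝ)

theorem rootedWeightSum_nonneg {q n : ℕ} {s lam : ℝ} (hs : 0 ≤ s) (hl : 0 ≤ lam) :
    0 ≤ rootedWeightSum q s n lam := by
  refine Finset.sum_nonneg fun v _ => ?_
  have := connectedWeight_nonneg (q := q) hl v
  positivity

/-- Sum `connectedWeight_le` over `v` with weight `(n s) ^ v`. Pieces with no node or one node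
contribute `n` and `n s`, which gives the factor `n (1 + s + A)`. The constant `2` comes from `v - 1
≥ v / 2` and `q - 1 ≤ q!`. -/
theorem rootedWeightSum_le {q : ℕ} (hq : 2 ≤ q) {n : ℕ} (hn : 1 ≤ n) {s lam : ℝ} (hs : 0 ≤ s)
    (hl : 0 ≤ lam) :
    rootedWeightSum q s n lam ≤
      2 * (lam * (n : ℝ) ^ (q - 1)) * (1 + s + rootedWeightSum q s n lam) ^ q := by
  have hn0 : (0 : ℝ) < n := by exact_mod_cast hn
  set f : ℕ → ℝ := fun m => (if m = 0 then (n : ℝ) else m * connectedWeight q lam m) /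
    (m ! : ℝ) * (n * s) ^ m with hf
  have hf0 : ∀ m, 0 ≤ f m := fun m => by
    have := connectedWeight_nonneg (q := q) hl m
    simp only [hf]
    positivity
  have hsum : ∑ m ∈ range (n + 1), f m = n * (1 + s + rootedWeightSum q s n lam) := by
    have h1 : range (n + 1) = insert 0 (insert 1 (Icc 2 n)) := by
      ext k
      simp only [Finset.mem_range, Finset.mem_insert, Finset.mem_Icc]
      omega
    rw [h1, Finset.sum_insert (by simp), Finset.sum_insert (by simp), rootedWeightSum,
      mul_add, mul_add, Finset.mul_sum, ← add_assoc]
    congr 1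
    · simp [hf, connectedWeight_one hq]
    · refine Finset.sum_congr rfl fun v hv => ?_
      have hv := (Finset.mem_Icc.1 hv).1
      have : (n : ℝ) ^ v = n * (n : ℝ) ^ (v - 1) := by
        rw [← pow_succ', Nat.sub_add_cancel (by omega)]
      simp only [hf, if_neg (by omega : v ≠ 0), mul_pow, this]
      ring
  have hterm : ∀ v ∈ Icc 2 n, (n : ℝ) * (q ! / 2) *
      ((v : ℝ) * connectedWeight q lam v * (n : ℝ) ^ (v - 1) * s ^ v / (v ! : ℝ)) ≤
      (q - 1) * (lam * ∑ m ∈ piAntidiag (univ : Finset (Fin q)) v, ∏ j, f (m j)) := by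
    intro v hv
    obtain ⟨hv2, hvn⟩ := Finset.mem_Icc.1 hv
    have h := mul_le_mul_of_nonneg_right (connectedWeight_le hq hl hvn)
      (by positivity : 0 ≤ ((n : ℝ) * s) ^ v)
    have hc := connectedWeight_nonneg (q := q) hl v
    have hp : (n : ℝ) ^ v = n * (n : ℝ) ^ (v - 1) := by
      rw [← pow_succ', Nat.sub_add_cancel (by omega)]
    have hv' : (2 : ℝ) ≤ v := by exact_mod_cast hv2
    have e1 : ∑ m ∈ piAntidiag (univ : Finset (Fin q)) v, ∏ j, f (m j) =
        (∑ m ∈ piAntidiag (univ : Finset (Fin q)) v,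
        ∏ j, ((if m j = 0 then (n : ℝ) else m j * connectedWeight q lam (m j)) /
          ((m j)! : ℝ))) * ((n : ℝ) * s) ^ v := by
      rw [Finset.sum_mul]
      refine Finset.sum_congr rfl fun m hm => ?_
      rw [← (Finset.mem_piAntidiag.1 hm).1, ← Finset.prod_pow_eq_pow_sum,
        ← Finset.prod_mul_distrib]
    rw [e1]
    refine le_trans ?_ (h.trans (le_of_eq (by ring)))
    rw [mul_pow, hp]
    have : (0 : ℝ) ≤ q ! * (connectedWeight q lam v / (v ! : ℝ)) * (n * (n : ℝ) ^ (v - 1) * s ^ v) := by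
      positivity
    have h6 : (n : ℝ) * (q ! / 2) *
      ((v : ℝ) * connectedWeight q lam v * (n : ℝ) ^ (v - 1) * s ^ v / (v ! : ℝ)) =
      v / 2 * (q ! * (connectedWeight q lam v / (v ! : ℝ)) * (n * (n : ℝ) ^ (v - 1) * s ^ v)) := by
      ring
    rw [h6]
    nlinarith
  have h2 := Finset.sum_le_sum hterm
  rw [← Finset.mul_sum, ← Finset.mul_sum, ← Finset.mul_sum] at h2
  have h3 := sum_piAntidiag_le (q := q) (n := n) hf0 (Icc 2 n) fun v hv => (Finset.mem_Icc.1 hv).2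
  rw [hsum] at h3
  have hqr : (2 : ℝ) ≤ q := by exact_mod_cast hq
  have h4 : (n : ℝ) * (q ! / 2) * rootedWeightSum q s n lam ≤
      (q - 1) * (lam * (n * (1 + s + rootedWeightSum q s n lam)) ^ q) :=
    h2.trans (mul_le_mul_of_nonneg_left (mul_le_mul_of_nonneg_left h3 hl) (by linarith))
  have hA := rootedWeightSum_nonneg (q := q) (n := n) hs hl
  set A := rootedWeightSum q s n lam
  have hfac : (q - 1 : ℝ) ≤ q ! := by
    have : (q : ℝ) ≤ q ! := by exact_mod_cast Nat.self_le_factorial q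
    linarith
  have hfac0 : (0 : ℝ) < q ! := by positivity
  have hnq : (n : ℝ) ^ q = n * (n : ℝ) ^ (q - 1) := by
    rw [← pow_succ', Nat.sub_add_cancel (by omega)]
  have h5 : (n : ℝ) * (q ! / 2) * A ≤
      (n * (q ! / 2)) * (2 * (lam * (n : ℝ) ^ (q - 1)) * (1 + s + A) ^ q) := by
    refine h4.trans ?_
    rw [mul_pow, hnq]
    have : 0 ≤ lam * (n * (n : ℝ) ^ (q - 1) * (1 + s + A) ^ q) := by positivity
    nlinarith
  exact le_of_mul_le_mul_left h5 (by positivity)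

/-- For small `lam n^{q-1}`, the generating function of rooted connected hypergraphs is small. -/
theorem exists_rootedWeightSum_le {q : ℕ} (hq : 2 ≤ q) {s η : ℝ} (hs : 0 ≤ s) (hη : 0 < η) :
    ∃ κ : ℝ, 0 < κ ∧ ∀ n : ℕ, 1 ≤ n → ∀ lam : ℝ, 0 ≤ lam → lam * (n : ℝ) ^ (q - 1) ≤ κ →
      rootedWeightSum q s n lam ≤ η := by
  refine ⟨η / (4 * (1 + s + η) ^ q), by positivity, fun n hn lam hl hk => ?_⟩
  by_contra! hlt
  have hcont : Continuous (rootedWeightSum q s n) := by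
    unfold rootedWeightSum
    have := continuous_connectedWeight q
    fun_prop
  have h0 : rootedWeightSum q s n 0 ≤ η := by
    have := rootedWeightSum_le hq hn hs le_rfl
    simp only [zero_mul, mul_zero] at this
    linarith
  -- Continuity in the edge weight: to exceed `η` at `lam`, the sum must equal `η` at some `l ≤
  -- lam`, and there the functional inequality would say `η ≤ η / 2`.
  obtain ⟨l, ⟨hl0, hl1⟩, hl2⟩ := intermediate_value_Icc hl hcont.continuousOn ⟨h0, hlt.le⟩
  have := rootedWeightSum_le hq hn hs hl0
  rw [hl2] at this
  have h1 : l * (n : ℝ) ^ (q - 1) ≤ η / (4 * (1 + s + η) ^ q) :=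
    (mul_le_mul_of_nonneg_right hl1 (by positivity)).trans hk
  have h2 : 2 * (l * (n : ℝ) ^ (q - 1)) * (1 + s + η) ^ q ≤
      2 * (η / (4 * (1 + s + η) ^ q)) * (1 + s + η) ^ q := by gcongr
  have h3 : 2 * (η / (4 * (1 + s + η) ^ q)) * (1 + s + η) ^ q = η / 2 := by
    have : (1 + s + η) ^ q ≠ 0 := by positivity
    field_simp
    ring
  linarith

/-! ### Words in commuting or anticommuting involutions -/

section Words

set_option linter.unusedSectionVars false

variable {α : Type*} [DecidableEq α]

/-- The sign picked up when a word is sorted according to the key `e`. -/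
def wordSign (η : α → α → ℝ) (e : α → ℕ) : List α → ℝ
  | [] => 1
  | a :: l => (l.map fun b => if e b < e a then η a b else 1).prod * wordSign η e l

/-- The elements `g a`, `a ∈ S`, of an algebra are involutions with `g a * g b = η a b • g b * g a`. -/
structure IsInvolutive {A : Type*} [Ring A] [Algebra ℝ A] (η : α → α → ℝ) (g : α → A)
    (S : Finset α) : Prop where
  sq : ∀ a ∈ S, g a * g a = 1
  comm : ∀ a ∈ S, ∀ b ∈ S, g a * g b = η a b • (g b * g a)

variable {A : Type*} [Ring A] [Algebra ℝ A] {η : α → α → ℝ} {g : α → A} {S : Finset α}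

/-- In the sorted list the letter `a` moves past exactly those letters `b` that have a smaller key,
each exchange costing `η a b`. -/
theorem IsInvolutive.mul_prod_orderedInsert (h : IsInvolutive η g S) (e : α → ℕ) {a : α}
    (ha : a ∈ S) (l : List α) (hl : ∀ b ∈ l, b ∈ S) (hs : l.Pairwise fun a b => e a ≤ e b) :
    g a * (l.map g).prod = (l.map fun b => if e b < e a then η a b else 1).prod •
      ((l.orderedInsert (fun a b => e a ≤ e b) a).map g).prod := by
  induction l with
  | nil => simp
  | cons b l ih =>
    rw [List.orderedInsert_cons]
    have hs' := List.pairwise_cons.1 hs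
    split_ifs with hab
    · have : ((b :: l).map fun b => if e b < e a then η a b else 1).prod = 1 := by
        refine List.prod_eq_one fun x hx => ?_
        obtain ⟨c, hc, rfl⟩ := List.mem_map.1 hx
        rw [if_neg]
        rcases List.mem_cons.1 hc with rfl | hc
        · omega
        · have := hs'.1 c hc
          omega
      rw [this]
      simp
    · simp only [List.map_cons, List.prod_cons]
      rw [← mul_assoc, h.comm a ha b (hl b (by simp)), smul_mul_assoc, mul_assoc,
        ih (fun c hc => hl c (by simp [hc])) hs'.2, if_pos (by omega), mul_smul_comm, smul_smul]

theorem IsInvolutive.prod_eq_insertionSort (h : IsInvolutive η g S) (e : α → ℕ) (l : List α)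
    (hl : ∀ b ∈ l, b ∈ S) :
    (l.map g).prod =
      wordSign η e l • ((l.insertionSort fun a b => e a ≤ e b).map g).prod := by
  induction l with
  | nil => simp [wordSign]
  | cons a l ih =>
    have ht : IsTrans α fun a b => e a ≤ e b := ⟨fun _ _ _ => le_trans⟩
    have htot : Std.Total fun a b : α => e a ≤ e b := ⟨fun a b => le_total (e a) (e b)⟩
    have hp := l.perm_insertionSort fun a b => e a ≤ e b
    rw [List.map_cons, List.prod_cons, ih fun c hc => hl c (by simp [hc]), mul_smul_comm,
      h.mul_prod_orderedInsert e (hl a (by simp)) _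
        (fun b hb => hl b (by simp [hp.mem_iff.1 hb])) (List.pairwise_insertionSort _ l),
      smul_smul, List.insertionSort_cons, wordSign, mul_comm,
      (hp.map fun b => if e b < e a then η a b else 1).prod_eq]

/-- As the key is injective, sorting puts equal letters next to each other, and an even word then
cancels in pairs from the left. -/
theorem IsInvolutive.prod_sorted (h : IsInvolutive η g S) {e : α → ℕ} (he : Function.Injective e) :
    ∀ (n : ℕ) (l : List α), l.length ≤ n → (∀ b ∈ l, b ∈ S) → (∀ a, Even (l.count a)) →
      l.Pairwise (fun a b => e a ≤ e b) → (l.map g).prod = 1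
  | _, [], _, _, _, _ => by simp
  | 0, a :: l, hn, _, _, _ => by simp at hn
  | n + 1, a :: l, hn, hl, hc, hs => by
    have hs' := List.pairwise_cons.1 hs
    have ha : a ∈ l := by
      by_contra ha
      have := hc a
      rw [List.count_cons_self, List.count_eq_zero_of_not_mem ha] at this
      simp at this
    obtain ⟨b, l, rfl⟩ : ∃ b l', l = b :: l' := List.exists_cons_of_ne_nil (List.ne_nil_of_mem ha)
    have hs'' := List.pairwise_cons.1 hs'.2
    have hba : b = a := by
      rcases List.mem_cons.1 ha with h | h
      · exact h.symm
      · exact he (le_antisymm (hs''.1 a h) (hs'.1 b (by simp)))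
    subst hba
    simp only [List.map_cons, List.prod_cons]
    rw [← mul_assoc, h.sq b (hl b (by simp)), one_mul]
    refine IsInvolutive.prod_sorted h he n l (by simp at hn; omega)
      (fun c hc => hl c (by simp [hc])) (fun c => ?_) hs''.2
    have := hc c
    simp only [List.count_cons] at this
    split_ifs at this
    · rwa [add_assoc, Nat.even_add, (by decide : Even (1 + 1) ↔ True), iff_true] at this
    · simpa using this

/-- A word in which every letter occurs an even number of times is a sign. -/
theorem IsInvolutive.prod_eq (h : IsInvolutive η g S) {e : α → ℕ} (he : Function.Injective e)
    (l : List α) (hl : ∀ b ∈ l, b ∈ S) (hc : ∀ a, Even (l.count a)) :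
    (l.map g).prod = wordSign η e l • (1 : A) := by
  have ht : IsTrans α fun a b => e a ≤ e b := ⟨fun _ _ _ => le_trans⟩
  have htot : Std.Total fun a b : α => e a ≤ e b := ⟨fun a b => le_total (e a) (e b)⟩
  have hp := l.perm_insertionSort fun a b => e a ≤ e b
  rw [h.prod_eq_insertionSort e l hl, h.prod_sorted he _ (l.insertionSort fun a b => e a ≤ e b)
    le_rfl (fun b hb => hl b (hp.mem_iff.1 hb)) (fun a => by rw [hp.count_eq]; exact hc a)
    (List.pairwise_insertionSort _ l)]

theorem abs_wordSign (hη : ∀ a b, |η a b| = 1) (e : α → ℕ) (l : List α) :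
    |wordSign η e l| = 1 := by
  induction l with
  | nil => simp [wordSign]
  | cons a l ih =>
    rw [wordSign, abs_mul, ih, mul_one]
    clear ih
    induction l with
    | nil => simp
    | cons b l ih =>
      rw [List.map_cons, List.prod_cons, abs_mul, ih]
      split_ifs <;> simp [hη]

theorem wordSign_one (e : α → ℕ) (l : List α) : wordSign (fun _ _ => 1) e l = 1 := by
  induction l with
  | nil => simp [wordSign]
  | cons a l ih => simp [wordSign, ih]

theorem count_ofFn {k : ℕ} (f : Fin k → α) (a : α) :
    (List.ofFn f).count a = #(univ.filter fun i => f i = a) := by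
  induction k with
  | zero => simp
  | succ k ih =>
    rw [List.ofFn_succ, List.count_cons, ih, Fin.card_filter_univ_succ]
    simp [beq_iff_eq, add_comm]
    split_ifs <;> omega

variable [Fintype α]

/-- The words of length `k` in exactly the letters of `S`, each occurring an even number of
times. -/
def evenWords (S : Finset α) (k : ℕ) : Finset (Fin k → α) :=
  univ.filter fun f => univ.image f = S ∧ ∀ a, Even #(univ.filter fun i => f i = a)

theorem mem_evenWords {S : Finset α} {k : ℕ} {f : Fin k → α} :
    f ∈ evenWords S k ↔ univ.image f = S ∧ ∀ a, Even #(univ.filter fun i => f i = a) := by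
  simp [evenWords]

/-- The signed number of even words. -/
def wordCoeff (η : α → α → ℝ) (e : α → ℕ) (S : Finset α) (k : ℕ) : ℝ :=
  ∑ f ∈ evenWords S k, wordSign η e (List.ofFn f)

/-- The exponential generating function of even words in exactly the letters of `S`. -/
def wordSum (η : α → α → ℝ) (e : α → ℕ) (S : Finset α) (s : ℝ) : ℝ :=
  ∑' k : ℕ, s ^ k / (k ! : ℝ) * wordCoeff η e S k

theorem wordCoeff_one (e : α → ℕ) (S : Finset α) (k : ℕ) :
    wordCoeff (fun _ _ => 1) e S k = #(evenWords S k) := by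
  simp [wordCoeff, wordSign_one]

theorem abs_wordCoeff_le_card (hη : ∀ a b, |η a b| = 1) (e : α → ℕ) (S : Finset α) (k : ℕ) :
    |wordCoeff η e S k| ≤ #(evenWords S k) := by
  refine (Finset.abs_sum_le_sum_abs _ _).trans ?_
  simp [abs_wordSign hη]

theorem abs_wordCoeff_le (hη : ∀ a b, |η a b| = 1) (e : α → ℕ) (S : Finset α) (k : ℕ) :
    |wordCoeff η e S k| ≤ (Fintype.card α : ℝ) ^ k := by
  refine (abs_wordCoeff_le_card hη e S k).trans ?_
  have := Finset.card_le_univ (evenWords S k)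
  rw [Fintype.card_fun, Fintype.card_fin] at this
  exact_mod_cast this

theorem summable_wordSum_of_le {c : ℕ → ℝ} {N : ℝ} (hc : ∀ k, |c k| ≤ N ^ k) (s : ℝ) :
    Summable fun k : ℕ => s ^ k / (k ! : ℝ) * c k := by
  refine Summable.of_norm_bounded (Real.summable_pow_div_factorial (|s| * N)) fun k => ?_
  rw [norm_mul, norm_div, norm_pow, Real.norm_eq_abs, Real.norm_eq_abs, Real.norm_eq_abs,
    Nat.abs_cast, mul_pow, div_mul_eq_mul_div]
  gcongr
  exact hc k

theorem summable_wordSum (hη : ∀ a b, |η a b| = 1) (e : α → ℕ) (S : Finset α) (s : ℝ) :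
    Summable fun k : ℕ => s ^ k / (k ! : ℝ) * wordCoeff η e S k :=
  summable_wordSum_of_le (abs_wordCoeff_le hη e S) s

/-- An even number of occurrences that is positive is at least two. -/
theorem wordCoeff_eq_zero {S : Finset α} {k : ℕ} (hk : k < 2 * #S) (e : α → ℕ) :
    wordCoeff η e S k = 0 := by
  have : evenWords S k = ∅ := by
    refine Finset.eq_empty_of_forall_notMem fun f hf => ?_
    obtain ⟨hS, hev⟩ := mem_evenWords.1 hf
    have h1 : k = ∑ a ∈ S, #(univ.filter fun i => f i = a) := by
      rw [← Finset.card_eq_sum_card_fiberwise (fun i hi => hS ▸ Finset.mem_image_of_mem f hi)]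
      simp
    have h2 : ∑ a ∈ S, 2 ≤ ∑ a ∈ S, #(univ.filter fun i => f i = a) := by
      refine Finset.sum_le_sum fun a ha => ?_
      rw [← hS] at ha
      obtain ⟨i, _, hi⟩ := Finset.mem_image.1 ha
      have h3 : 0 < #(univ.filter fun i => f i = a) :=
        Finset.card_pos.2 ⟨i, Finset.mem_filter.2 ⟨mem_univ _, hi⟩⟩
      obtain ⟨m, hm⟩ := hev a
      omega
    simp only [Finset.sum_const, smul_eq_mul] at h2
    omega
  simp [wordCoeff, this]

/-- The leading behavior of `wordSum` for small parameter. -/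
theorem tendsto_wordSum_div (hη : ∀ a b, |η a b| = 1) (e : α → ℕ) (S : Finset α) {u : ℕ → ℝ}
    (hu : Tendsto u atTop (𝓝 0)) (hu0 : ∀ᶠ n in atTop, u n ≠ 0) :
    Tendsto (fun n => wordSum η e S (u n) / u n ^ (2 * #S)) atTop
      (𝓝 (wordCoeff η e S (2 * #S) / ((2 * #S)! : ℝ))) := by
  set r := 2 * #S
  -- By `wordCoeff_eq_zero` the series starts at the index `r`. After division by `u n ^ r` only the
  -- term `j = 0` has a nonzero limit, and `|u n| ≤ 1` supplies the dominating series.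
  have h1 : Tendsto (fun n => ∑' j : ℕ, u n ^ j / ((j + r)! : ℝ) * wordCoeff η e S (j + r)) atTop
      (𝓝 (∑' j : ℕ, (if j = 0 then wordCoeff η e S r / (r ! : ℝ) else 0))) := by
    refine tendsto_tsum_of_dominated_convergence
      (bound := fun j => (Fintype.card α : ℝ) ^ (j + r) / ((j + r)! : ℝ)) ?_ ?_ ?_
    · exact (summable_nat_add_iff (f := fun j => (Fintype.card α : ℝ) ^ j / (j ! : ℝ)) r).2
        (Real.summable_pow_div_factorial _)
    · intro j
      have := ((hu.pow j).div_const ((j + r)! : ℝ)).mul_const (wordCoeff η e S (j + r))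
      convert this using 2
      rcases eq_or_ne j 0 with rfl | hj
      · simp [div_eq_inv_mul]
      · simp [hj]
    · filter_upwards [hu.eventually (Metric.closedBall_mem_nhds (0 : ℝ) one_pos)] with n hn j
      rw [norm_mul, norm_div, norm_pow, Real.norm_natCast, div_mul_eq_mul_div]
      have h1 : ‖u n‖ ≤ 1 := by simpa using hn
      have h2 := abs_wordCoeff_le hη e S (j + r)
      rw [← Real.norm_eq_abs] at h2
      gcongr
      calc ‖u n‖ ^ j * ‖wordCoeff η e S (j + r)‖
          ≤ 1 * (Fintype.card α : ℝ) ^ (j + r) :=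
            mul_le_mul (pow_le_one₀ (norm_nonneg _) h1) h2 (norm_nonneg _) zero_le_one
        _ = _ := one_mul _
  rw [tsum_ite_eq] at h1
  refine h1.congr' ?_
  filter_upwards [hu0] with n hn
  have h2 := (summable_wordSum hη e S (u n)).sum_add_tsum_nat_add r
  rw [Finset.sum_eq_zero fun k hk => by
    rw [wordCoeff_eq_zero (Finset.mem_range.1 hk), mul_zero], zero_add] at h2
  rw [wordSum, ← h2, ← tsum_div_const]
  refine tsum_congr fun j => ?_
  rw [pow_add]
  field_simp

/-- Words depend only on the commutation signs of their letters. -/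
theorem wordCoeff_map {β : Type*} [DecidableEq β] [Fintype β] [Nontrivial A] (u : β ↪ α)
    {η' : β → β → ℝ} {S : Finset β} (hη : ∀ a ∈ S, ∀ b ∈ S, η (u a) (u b) = η' a b)
    (h : IsInvolutive η g (S.map u)) {e : α → ℕ} (he : Function.Injective e) {e' : β → ℕ}
    (he' : Function.Injective e') (k : ℕ) :
    wordCoeff η e (S.map u) k = wordCoeff η' e' S k := by
  have hinv : IsInvolutive η' (fun b => g (u b)) S :=
    ⟨fun a ha => h.sq _ (Finset.mem_map_of_mem _ ha), fun a ha b hb => by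
      rw [h.comm _ (Finset.mem_map_of_mem _ ha) _ (Finset.mem_map_of_mem _ hb), hη a ha b hb]⟩
  have hcount : ∀ (f : Fin k → β) (b : β),
      #(univ.filter fun i => u (f i) = u b) = #(univ.filter fun i => f i = b) := fun f b => by
    simp [u.injective.eq_iff]
  symm
  refine Finset.sum_bij (fun f _ i => u (f i)) ?_ ?_ ?_ ?_
  · intro f hf
    obtain ⟨h1, h2⟩ := mem_evenWords.1 hf
    refine mem_evenWords.2 ⟨?_, fun a => ?_⟩
    · rw [← h1, Finset.map_eq_image, Finset.image_image]
      rfl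
    · by_cases ha : ∃ b, u b = a
      · obtain ⟨b, rfl⟩ := ha
        rw [hcount]
        exact h2 b
      · rw [Finset.filter_false_of_mem fun i _ hi => ha ⟨_, hi⟩]
        simp
  · intro f _ f' _ hff
    funext i
    exact u.injective (congrFun hff i)
  · intro f hf
    obtain ⟨h1, h2⟩ := mem_evenWords.1 hf
    have : ∀ i, ∃ b, u b = f i := fun i => by
      have : f i ∈ S.map u := h1 ▸ Finset.mem_image_of_mem f (mem_univ i)
      obtain ⟨b, _, hb⟩ := Finset.mem_map.1 this
      exact ⟨b, hb⟩
    choose f' hf' using this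
    have hff : f = fun i => u (f' i) := funext fun i => (hf' i).symm
    refine ⟨f', mem_evenWords.2 ⟨?_, fun b => ?_⟩, hff.symm⟩
    · apply Finset.map_injective u
      rw [← h1, hff, Finset.map_eq_image, Finset.image_image]
      rfl
    · rw [← hcount]
      have := h2 (u b)
      rwa [hff] at this
  · intro f hf
    obtain ⟨h1, h2⟩ := mem_evenWords.1 hf
    have hmem : ∀ b ∈ List.ofFn f, b ∈ S := fun b hb => by
      obtain ⟨i, rfl⟩ := (List.mem_ofFn' f b).1 hb
      exact h1 ▸ Finset.mem_image_of_mem f (mem_univ i)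
    have hmap : (List.ofFn fun i => u (f i)) = (List.ofFn f).map u := by
      rw [List.map_ofFn]
      rfl
    -- The keys `e` and `e'` may sort the letters differently. The two signs agree because both are
    -- the scalar by which the same product in `A` acts.
    have e1 := hinv.prod_eq he' (List.ofFn f) hmem fun b => by
      rw [count_ofFn]
      exact h2 b
    have e2 := h.prod_eq he ((List.ofFn f).map u) (fun a ha => by
      obtain ⟨b, hb, rfl⟩ := List.mem_map.1 ha
      exact Finset.mem_map_of_mem _ (hmem b hb)) fun a => by
        by_cases ha : ∃ b, u b = a
        · obtain ⟨b, rfl⟩ := ha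
          rw [List.count_map_of_injective _ _ u.injective, count_ofFn]
          exact h2 b
        · rw [List.count_eq_zero_of_not_mem fun h' => ha (by
            obtain ⟨b, _, hb⟩ := List.mem_map.1 h'
            exact ⟨b, hb⟩)]
          simp
    rw [List.map_map] at e2
    have e3 : wordSign η' e' (List.ofFn f) • (1 : A) =
        wordSign η e ((List.ofFn f).map u) • (1 : A) := e1.symm.trans e2
    rw [hmap]
    exact smul_left_injective ℝ (one_ne_zero (α := A)) e3

theorem wordSum_map {β : Type*} [DecidableEq β] [Fintype β] [Nontrivial A] (u : β ↪ α)
    {η' : β → β → ℝ} {S : Finset β} (hη : ∀ a ∈ S, ∀ b ∈ S, η (u a) (u b) = η' a b)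
    (h : IsInvolutive η g (S.map u)) {e : α → ℕ} (he : Function.Injective e) {e' : β → ℕ}
    (he' : Function.Injective e') (s : ℝ) :
    wordSum η e (S.map u) s = wordSum η' e' S s := by
  simp only [wordSum, wordCoeff_map u hη h he he']

end Words

/-! ### Averages over signs -/

section Average

set_option linter.unusedSectionVars false

variable {α : Type*} [DecidableEq α] [Fintype α]

/-- The sign encoded by a Boolean. -/
def boolSign (b : Bool) : ℝ := if b then 1 else -1

/-- The average over all choices of signs. -/
def signAverage {M : Type*} [AddCommGroup M] [Module ℝ M] (F : (α → Bool) → M) : M :=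
  ((2 : ℝ) ^ Fintype.card α)⁻¹ • ∑ τ, F τ

/-- The average factorizes over the letters, and odd moments of a fair sign vanish. -/
theorem signAverage_prod {k : ℕ} (f : Fin k → α) :
    signAverage (fun τ => ∏ i, boolSign (τ (f i))) =
      if ∀ a, Even #(univ.filter fun i => f i = a) then 1 else 0 := by
  have h1 : ∀ τ : α → Bool, ∏ i, boolSign (τ (f i)) =
      ∏ a, boolSign (τ a) ^ #(univ.filter fun i => f i = a) := fun τ => by
    rw [← Finset.prod_fiberwise univ f]
    refine Finset.prod_congr rfl fun a _ => ?_
    rw [Finset.prod_congr rfl (g := fun _ => boolSign (τ a))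
      (fun x hx => by rw [(Finset.mem_filter.1 hx).2]), Finset.prod_const]
  have h2 : ∑ τ : α → Bool, ∏ a, boolSign (τ a) ^ #(univ.filter fun i => f i = a) =
      ∏ a, ∑ b, boolSign b ^ #(univ.filter fun i => f i = a) := by
    rw [Finset.prod_univ_sum, Fintype.piFinset_univ]
  simp only [signAverage, h1, h2]
  simp only [Fintype.sum_bool, boolSign, if_true, one_pow, Bool.false_eq_true, if_false]
  split_ifs with h
  · rw [Finset.prod_congr rfl (g := fun _ => (2 : ℝ)) fun a _ => by
      rw [(h a).neg_one_pow]; norm_num]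
    simp
  · push Not at h
    obtain ⟨a, ha⟩ := h
    rw [Finset.prod_eq_zero (mem_univ a), smul_zero]
    rw [(Nat.not_even_iff_odd.1 ha).neg_one_pow]
    norm_num

variable {A : Type*} [NormedRing A] [NormedAlgebra ℝ A]
  {η : α → α → ℝ} {g : α → A} {S : Finset α}

/-- The signed number of even words in letters of `S`. -/
theorem sum_powerset_wordCoeff (e : α → ℕ) (S : Finset α) (k : ℕ) :
    ∑ R ∈ S.powerset, wordCoeff η e R k =
      ∑ f ∈ (Fintype.piFinset fun _ : Fin k => S) with
        ∀ a, Even #(univ.filter fun i => f i = a), wordSign η e (List.ofFn f) := by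
  simp only [wordCoeff]
  rw [← Finset.sum_fiberwise_of_maps_to (t := S.powerset) (g := fun f : Fin k → α => univ.image f)]
  · refine Finset.sum_congr rfl fun R hR => Finset.sum_congr ?_ fun _ _ => rfl
    ext f
    simp only [mem_evenWords, Finset.mem_filter, Fintype.mem_piFinset]
    constructor
    · rintro ⟨rfl, h⟩
      exact ⟨⟨fun i => Finset.mem_powerset.1 hR (Finset.mem_image_of_mem f (mem_univ i)), h⟩, rfl⟩
    · rintro ⟨⟨_, h⟩, h'⟩
      exact ⟨h', h⟩
  · intro f hf
    rw [Finset.mem_powerset]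
    intro a ha
    obtain ⟨i, _, rfl⟩ := Finset.mem_image.1 ha
    exact Fintype.mem_piFinset.1 (Finset.mem_filter.1 hf).1 i

/-- Expand the power into words. The average keeps the even words, and by `IsInvolutive.prod_eq`
these are signs. -/
theorem signAverage_pow (h : IsInvolutive η g S) {e : α → ℕ} (he : Function.Injective e) (k : ℕ) :
    signAverage (fun τ => (∑ a ∈ S, boolSign (τ a) • g a) ^ k) =
      (∑ R ∈ S.powerset, wordCoeff η e R k) • (1 : A) := by
  have h1 : ∀ τ : α → Bool, (∑ a ∈ S, boolSign (τ a) • g a) ^ k =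
      ∑ f ∈ Fintype.piFinset fun _ : Fin k => S,
        (∏ i, boolSign (τ (f i))) • (List.ofFn fun i => g (f i)).prod := fun τ => by
    have := (MultilinearMap.mkPiAlgebraFin ℝ k A).map_sum_finset
      (fun (_ : Fin k) a => boolSign (τ a) • g a) fun _ => S
    simp only [MultilinearMap.map_smul_univ, MultilinearMap.mkPiAlgebraFin_apply,
      List.ofFn_const, List.prod_replicate] at this
    exact this
  simp only [signAverage, h1]
  rw [Finset.sum_comm, Finset.smul_sum, sum_powerset_wordCoeff, Finset.sum_smul,
    Finset.sum_filter]
  refine Finset.sum_congr rfl fun f hf => ?_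
  rw [← Finset.sum_smul, smul_smul, ← smul_eq_mul]
  have h2 := signAverage_prod f
  rw [signAverage] at h2
  rw [h2]
  split_ifs with hev
  · rw [one_smul, ← h.prod_eq he (List.ofFn f), List.map_ofFn]
    · rfl
    · intro b hb
      obtain ⟨i, rfl⟩ := (List.mem_ofFn' f b).1 hb
      exact Fintype.mem_piFinset.1 hf i
    · intro a
      rw [count_ofFn]
      exact hev a
  · rw [zero_smul]

/-- The average of `exp (s ∑ ± g a)` is a scalar. -/
theorem signAverage_exp [CompleteSpace A] (hη : ∀ a b, |η a b| = 1) (h : IsInvolutive η g S)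
    {e : α → ℕ} (he : Function.Injective e) (s : ℝ) :
    signAverage (fun τ => NormedSpace.exp (s • ∑ a ∈ S, boolSign (τ a) • g a)) =
      (∑ R ∈ S.powerset, wordSum η e R s) • (1 : A) := by
  have h1 : HasSum (fun k : ℕ => ((k ! : ℝ)⁻¹ * s ^ k) •
        signAverage (fun τ => (∑ a ∈ S, boolSign (τ a) • g a) ^ k))
      (signAverage (fun τ => NormedSpace.exp (s • ∑ a ∈ S, boolSign (τ a) • g a))) := by
    have := (hasSum_sum (s := (univ : Finset (α → Bool))) fun τ _ =>
      NormedSpace.exp_series_hasSum_exp' (𝕂 := ℝ) (s • ∑ a ∈ S, boolSign (τ a) • g a)).const_smul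
        ((2 : ℝ) ^ Fintype.card α)⁻¹
    refine this.congr_fun fun k => ?_
    simp only [signAverage, smul_pow, smul_smul]
    rw [Finset.smul_sum, Finset.smul_sum]
    refine Finset.sum_congr rfl fun τ _ => ?_
    rw [smul_smul]
    congr 1
    ring
  have h2 : HasSum (fun k : ℕ => ((k ! : ℝ)⁻¹ * s ^ k) •
        signAverage (fun τ => (∑ a ∈ S, boolSign (τ a) • g a) ^ k))
      ((∑ R ∈ S.powerset, wordSum η e R s) • (1 : A)) := by
    have := (hasSum_sum (s := S.powerset) fun R _ =>
      (summable_wordSum hη e R s).hasSum).smul_const (1 : A)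
    refine this.congr_fun fun k => ?_
    rw [signAverage_pow h he, smul_smul, ← Finset.mul_sum]
    congr 1
    ring
  exact h1.unique h2

/-- Averages over disjoint sets of signs are independent. -/
theorem signAverage_mul (S : Finset α) {F G : (α → Bool) → A}
    (hF : ∀ τ τ', (∀ a ∈ S, τ a = τ' a) → F τ = F τ')
    (hG : ∀ τ τ', (∀ a ∉ S, τ a = τ' a) → G τ = G τ') :
    signAverage (fun τ => F τ * G τ) = signAverage F * signAverage G := by
  have h1 : (∑ τ, F τ) * ∑ τ, G τ = (2 : ℝ) ^ Fintype.card α • ∑ τ, F τ * G τ := by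
    -- Two independent copies exchange their coordinates outside `S`. This involution turns `F p.1 *
    -- G p.2` into `F p.1 * G p.1`.
    let sw : (α → Bool) × (α → Bool) → (α → Bool) × (α → Bool) := fun p =>
      (fun a => if a ∈ S then p.1 a else p.2 a, fun a => if a ∈ S then p.2 a else p.1 a)
    have hsw : Function.Involutive sw := fun p => by
      ext a <;> simp only [sw] <;> split_ifs <;> rfl
    rw [Finset.sum_mul_sum, ← Finset.sum_product']
    have : ∀ p, F (sw p).1 * G (sw p).2 = F p.1 * G p.1 := fun p => by
      rw [hF (sw p).1 p.1 fun a ha => by simp [sw, ha],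
        hG (sw p).2 p.1 fun a ha => by simp [sw, ha]]
    have h2 : ∑ p, F ((Function.Involutive.toPerm sw hsw) p).1 * G ((Function.Involutive.toPerm sw hsw) p).2 =
        ∑ p : (α → Bool) × (α → Bool), F p.1 * G p.1 :=
      Finset.sum_congr rfl fun p (_ : p ∈ univ) => this p
    rw [Finset.univ_product_univ,
      ← Equiv.sum_comp (Function.Involutive.toPerm sw hsw) (fun p : (α → Bool) × (α → Bool) => F p.1 * G p.2), h2,
      Fintype.sum_prod_type]
    simp only [Finset.sum_const, Finset.card_univ, Fintype.card_fun, Fintype.card_bool]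
    rw [Finset.smul_sum]
    refine Finset.sum_congr rfl fun τ _ => ?_
    rw [← Nat.cast_smul_eq_nsmul ℝ]
    norm_num
  simp only [signAverage]
  rw [smul_mul_smul_comm, h1, smul_smul]
  congr 1
  have : (2 : ℝ) ^ Fintype.card α ≠ 0 := by positivity
  field_simp

/-- A function on finite sets is determined by its sums over subsets. -/
theorem eq_zero_of_sum_powerset {M : Type*} [AddCommGroup M] (f : Finset α → M) {U : Finset α}
    (h : ∀ S ⊆ U, ∑ R ∈ S.powerset, f R = 0) : f U = 0 := by
  induction U using Finset.strongInduction with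
  | H U ih =>
    have h1 := h U subset_rfl
    rw [← Finset.insert_erase (Finset.mem_powerset_self U), Finset.sum_insert (by simp)] at h1
    rw [Finset.sum_eq_zero fun R hR => ?_, add_zero] at h1
    · exact h1
    · obtain ⟨hne, hR⟩ := Finset.mem_erase.1 hR
      have hR := Finset.mem_powerset.1 hR
      exact ih R (hR.ssubset_of_ne hne) fun S hS => h S (hS.trans hR)

theorem sum_powerset_union {M : Type*} [AddCommMonoid M] (F : Finset α → M) {S T : Finset α}
    (hST : Disjoint S T) :
    ∑ R ∈ (S ∪ T).powerset, F R = ∑ R ∈ S.powerset, ∑ R' ∈ T.powerset, F (R ∪ R') := by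
  induction S using Finset.induction generalizing F with
  | empty => simp
  | insert a S ha ih =>
    rw [Finset.disjoint_insert_left] at hST
    rw [Finset.insert_union, Finset.sum_powerset_insert (by simp [ha, hST.1]),
      Finset.sum_powerset_insert ha, ih _ hST.2, ih _ hST.2]
    simp [Finset.insert_union]

/-- `wordSum` factorizes over commuting sets of letters. -/
theorem wordSum_union [CompleteSpace A] [Nontrivial A] (hη : ∀ a b, |η a b| = 1)
    {S T : Finset α} (h : IsInvolutive η g (S ∪ T)) {e : α → ℕ} (he : Function.Injective e)
    (hST : Disjoint S T) (hcomm : ∀ a ∈ S, ∀ b ∈ T, η a b = 1) (s : ℝ) :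
    wordSum η e (S ∪ T) s = wordSum η e S s * wordSum η e T s := by
  -- Since the two sums of letters commute, the exponential of their sum is a product, and its
  -- average factorizes. By `signAverage_exp` this is the claim summed over all subsets of `S'` and
  -- `T'`; inversion over subsets in either variable then isolates `S` and `T`.
  have key : ∀ S' ⊆ S, ∀ T' ⊆ T, ∑ R ∈ S'.powerset, ∑ R' ∈ T'.powerset,
      (wordSum η e (R ∪ R') s - wordSum η e R s * wordSum η e R' s) = 0 := by
    intro S' hS' T' hT'
    have hd : Disjoint S' T' := Finset.disjoint_of_subset_left hS'
      (Finset.disjoint_of_subset_right hT' hST)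
    have hsub : ∀ {U}, U ⊆ S ∪ T → IsInvolutive η g U := fun hU =>
      ⟨fun a ha => h.sq a (hU ha), fun a ha b hb => h.comm a (hU ha) b (hU hb)⟩
    have h1 := signAverage_exp hη (hsub (Finset.union_subset_union hS' hT')) he s
    have h2 := signAverage_exp hη (hsub (hS'.trans Finset.subset_union_left)) he s
    have h3 := signAverage_exp hη (hsub (hT'.trans Finset.subset_union_right)) he s
    let _ : NormedAlgebra ℚ A := NormedAlgebra.restrictScalars ℚ ℝ A
    have h4 : (fun τ : α → Bool =>
        NormedSpace.exp (s • ∑ a ∈ S' ∪ T', boolSign (τ a) • g a)) = fun τ =>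
        NormedSpace.exp (s • ∑ a ∈ S', boolSign (τ a) • g a) *
          NormedSpace.exp (s • ∑ a ∈ T', boolSign (τ a) • g a) := by
      funext τ
      rw [Finset.sum_union hd, smul_add, NormedSpace.exp_add_of_commute]
      refine Commute.smul_left (Commute.smul_right ?_ _) _
      refine Commute.sum_left _ _ _ fun a ha => Commute.sum_right _ _ _ fun b hb => ?_
      refine Commute.smul_left (Commute.smul_right ?_ _) _
      have := h.comm a (Finset.mem_union_left _ (hS' ha)) b (Finset.mem_union_right _ (hT' hb))
      rwa [hcomm a (hS' ha) b (hT' hb), one_smul] at this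
    rw [h4, signAverage_mul S', h2, h3, smul_mul_smul_comm, one_mul] at h1
    · have h5 := smul_left_injective ℝ (one_ne_zero (α := A)) h1
      rw [sum_powerset_union _ hd] at h5
      simp only [Finset.sum_sub_distrib]
      rw [← h5, Finset.sum_mul_sum, sub_self]
    · intro τ τ' hτ
      rw [Finset.sum_congr rfl fun a ha => by rw [hτ a ha]]
    · intro τ τ' hτ
      rw [Finset.sum_congr rfl fun a ha => by
        rw [hτ a (fun ha' => Finset.disjoint_left.1 hd ha' ha)]]
  have h1 : ∀ T' ⊆ T, ∑ R' ∈ T'.powerset,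
      (wordSum η e (S ∪ R') s - wordSum η e S s * wordSum η e R' s) = 0 := fun T' hT' =>
    eq_zero_of_sum_powerset (fun R => ∑ R' ∈ T'.powerset,
      (wordSum η e (R ∪ R') s - wordSum η e R s * wordSum η e R' s)) fun S' hS' =>
        key S' hS' T' hT'
  exact sub_eq_zero.1 (eq_zero_of_sum_powerset (fun R' =>
    wordSum η e (S ∪ R') s - wordSum η e S s * wordSum η e R' s) h1)

/-- With commuting letters the averaged exponential is `cosh s ^ #S'`, which is the sum of `(cosh s
- 1) ^ #R` over `R ⊆ S'`; `eq_zero_of_sum_powerset` compares the summands. -/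
theorem wordSum_one (e : α → ℕ) (he : Function.Injective e) (S : Finset α) (s : ℝ) :
    wordSum (fun _ _ => 1) e S s = (Real.cosh s - 1) ^ #S := by
  refine sub_eq_zero.1 (eq_zero_of_sum_powerset (fun R =>
    wordSum (fun _ _ => 1) e R s - (Real.cosh s - 1) ^ #R) fun S' _ => ?_)
  have hinv : IsInvolutive (fun _ _ => 1) (fun _ : α => (1 : ℝ)) S' :=
    ⟨by simp, by simp⟩
  have h1 := signAverage_exp (fun _ _ => by simp) hinv he s
  have h2 := Finset.sum_pow_mul_eq_add_pow (Real.cosh s - 1) 1 S'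
  simp only [one_pow, mul_one, sub_add_cancel] at h2
  rw [Finset.sum_sub_distrib, h2]
  simp only [smul_eq_mul, mul_one] at h1
  rw [← h1, sub_eq_zero, signAverage]
  have h3 : ∀ τ : α → Bool, NormedSpace.exp (s * ∑ a ∈ S', boolSign (τ a)) =
      ∏ a, if a ∈ S' then Real.exp (s * boolSign (τ a)) else 1 := fun τ => by
    rw [← Real.exp_eq_exp_ℝ, Finset.mul_sum, Real.exp_sum, Finset.prod_ite_mem,
      Finset.univ_inter]
  have h4 := (Finset.prod_univ_sum (fun _ : α => (univ : Finset Bool))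
    (fun a b => if a ∈ S' then Real.exp (s * boolSign b) else 1)).symm
  rw [Fintype.piFinset_univ] at h4
  simp only [h3, h4]
  have h5 : ∀ a : α, ∑ b, (if a ∈ S' then Real.exp (s * boolSign b) else 1) =
      2 * if a ∈ S' then Real.cosh s else 1 := fun a => by
    split_ifs
    · simp [boolSign, Real.cosh_eq]
      ring
    · norm_num
  simp only [h5, Finset.prod_mul_distrib, Finset.prod_ite_mem, Finset.univ_inter,
    Finset.prod_const, Finset.card_univ]
  have : (2 : ℝ) ^ Fintype.card α ≠ 0 := by positivity
  rw [smul_eq_mul]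
  field_simp

/-- Dropping the signs leaves the number of even words, so the commuting case is a majorant. -/
theorem abs_wordSum_le (hη : ∀ a b, |η a b| = 1) {e : α → ℕ} (he : Function.Injective e)
    (S : Finset α) (s : ℝ) : |wordSum η e S s| ≤ (Real.cosh s - 1) ^ #S := by
  rw [← Real.cosh_abs, ← wordSum_one e he S |s|, ← Real.norm_eq_abs]
  refine tsum_of_norm_bounded (summable_wordSum (fun _ _ => by simp) e S |s|).hasSum fun k => ?_
  rw [wordCoeff_one, norm_mul, norm_div, norm_pow, Real.norm_eq_abs, Real.norm_eq_abs,
    Real.norm_eq_abs, Nat.abs_cast]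
  gcongr
  exact abs_wordCoeff_le_card hη e S k

end Average

/-! ### Products of Majorana operators -/

section Majorana

variable {V : Type*} [DecidableEq V] {A : Type*} [Ring A] [Algebra ℂ A]

/-- The commutation sign of two hyperedges. -/
def edgeSign (I J : Finset V) : ℝ := (-1) ^ #(I ∩ J)

theorem abs_edgeSign (I J : Finset V) : |edgeSign I J| = 1 := by
  simp [edgeSign, abs_pow]

theorem edgeSign_of_disjoint {I J : Finset V} (h : Disjoint I J) : edgeSign I J = 1 := by
  simp [edgeSign, Finset.disjoint_iff_inter_eq_empty.1 h]

/-- Every letter of `l` other than `a` contributes a sign. The exponent has the parity of the number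
of such letters, written without subtraction. -/
theorem anticomm_mul_prod {x : V → A}
    (hx : ∀ i j, x i * x j + x j * x i = if i = j then 1 else 0) (a : V) (l : List V)
    (hl : l.Nodup) :
    x a * (l.map x).prod = (-1 : ℂ) ^ (l.length + if a ∈ l then 1 else 0) •
      ((l.map x).prod * x a) := by
  induction l with
  | nil => simp
  | cons b l ih =>
    obtain ⟨hb, hl'⟩ := List.nodup_cons.1 hl
    simp only [List.map_cons, List.prod_cons, List.length_cons]
    rcases eq_or_ne a b with rfl | hab
    · rw [mul_assoc, ih hl', if_neg hb, if_pos (by simp), mul_smul_comm]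
      congr 1
      rw [add_zero, pow_add, pow_add]
      norm_num
    · have h1 : x a * x b = -(x b * x a) := by
        have := hx a b
        rw [if_neg hab] at this
        exact eq_neg_of_add_eq_zero_left this
      rw [← mul_assoc, h1, neg_mul, mul_assoc, ih hl', mul_smul_comm, ← neg_one_smul ℂ, smul_smul,
        mul_assoc]
      congr 1
      simp only [List.mem_cons, hab, false_or]
      ring

theorem anticomm_prod_mul_prod {x : V → A}
    (hx : ∀ i j, x i * x j + x j * x i = if i = j then 1 else 0) (l l' : List V)
    (hl : l.Nodup) (hl' : l'.Nodup) :
    (l.map x).prod * (l'.map x).prod =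
      (-1 : ℂ) ^ (l.length * l'.length + #(l.toFinset ∩ l'.toFinset)) •
        ((l'.map x).prod * (l.map x).prod) := by
  induction l with
  | nil => simp
  | cons a l ih =>
    obtain ⟨ha, hl⟩ := List.nodup_cons.1 hl
    simp only [List.map_cons, List.prod_cons, List.length_cons]
    have hcard : #((a :: l).toFinset ∩ l'.toFinset) =
        #(l.toFinset ∩ l'.toFinset) + if a ∈ l' then 1 else 0 := by
      rw [List.toFinset_cons]
      split_ifs with h
      · rw [Finset.insert_inter_of_mem (by simpa using h), Finset.card_insert_of_notMem (by
          simp [ha])]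
      · rw [Finset.insert_inter_of_notMem (by simpa using h), add_zero]
    rw [mul_assoc, ih hl, mul_smul_comm, ← mul_assoc, anticomm_mul_prod hx a l' hl',
      smul_mul_assoc, smul_smul, mul_assoc, hcard]
    congr 1
    rw [← pow_add]
    congr 1
    ring

/-- Bringing the second `x a` next to the first costs `(-1) ^ l.length`; over the whole list these
exponents add up to the binomial coefficient. Each square `x a * x a` is `1 / 2`. -/
theorem anticomm_prod_sq {x : V → A}
    (hx : ∀ i j, x i * x j + x j * x i = if i = j then 1 else 0) (l : List V) (hl : l.Nodup) :
    (l.map x).prod * (l.map x).prod =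
      ((-1 : ℂ) ^ (l.length.choose 2) * (1 / 2) ^ l.length) • 1 := by
  induction l with
  | nil => simp
  | cons a l ih =>
    obtain ⟨ha, hl⟩ := List.nodup_cons.1 hl
    simp only [List.map_cons, List.prod_cons, List.length_cons]
    have h1 : x a * x a = (1 / 2 : ℂ) • (1 : A) := by
      have := hx a a
      rw [if_pos rfl, ← two_smul ℂ] at this
      rw [← this, smul_smul]
      norm_num
    have h2 := anticomm_mul_prod hx a l hl
    rw [if_neg ha, add_zero] at h2
    have h3 : (l.map x).prod * x a = (-1 : ℂ) ^ l.length • (x a * (l.map x).prod) := by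
      rw [h2, smul_smul, ← pow_add, Even.neg_one_pow ⟨_, rfl⟩, one_smul]
    rw [mul_assoc, ← mul_assoc _ (x a), h3, smul_mul_assoc, mul_smul_comm, mul_assoc (x a),
      ← mul_assoc (x a) (x a), h1, ih hl, smul_mul_assoc, one_mul, smul_smul, smul_smul,
      Nat.choose_succ_succ' l.length 1, Nat.choose_one_right]
    congr 1
    ring

end Majorana

/-! ### The averaged SYK partition function as a sum over hypergraphs. -/

section SYK

variable {ι : Type*} [Fintype ι] [DecidableEq ι] {n : ℕ} {ψ : Fin n → Matrix ι ι ℂ}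

/-- The monomials `ψ_I`, normalized to be involutions. -/
def majoranaInvolution (q : ℕ) (ψ : Fin n → Matrix ι ι ℂ) (I : Finset (Fin n)) : Matrix ι ι ℂ :=
  (2 : ℝ) ^ (q / 2) • majoranaMonomial ψ I

/-- With `q = 2 p` the square carries the sign `(-1) ^ (p + p (2 p - 1))`, and this exponent is `2
p²`; the normalization cancels `(1 / 2) ^ q`. In the commutation relation `q * q` is even, so only
the sign of the intersection remains. -/
theorem isInvolutive_majoranaInvolution {q : ℕ} (hq : Even q) (hψ : IsMajorana ψ) :
    IsInvolutive edgeSign (majoranaInvolution q ψ) ((univ : Finset (Fin n)).powersetCard q) := by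
  obtain ⟨p, rfl⟩ := hq
  have hp : (p + p) / 2 = p := by omega
  have hsmul : ∀ (r : ℝ) (M : Matrix ι ι ℂ), r • M = (r : ℂ) • M := fun r M =>
    (Complex.coe_smul r M).symm
  constructor
  · intro I hI
    have hI := (Finset.mem_powersetCard.1 hI).2
    have h := anticomm_prod_sq hψ.anticomm (I.sort (· ≤ ·)) (I.sort_nodup (· ≤ ·))
    rw [Finset.length_sort, hI] at h
    simp only [majoranaInvolution, majoranaMonomial, hI, hsmul, smul_mul_smul_comm, h, smul_smul,
      hp]
    have hc : (p + p).choose 2 = p * (2 * p - 1) := by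
      rw [Nat.choose_two_right, ← two_mul, mul_assoc, Nat.mul_div_cancel_left _ (by norm_num)]
    have h1 : Complex.I ^ p * Complex.I ^ p = (-1) ^ p := by
      rw [← mul_pow, Complex.I_mul_I]
    have h2 : (-1 : ℂ) ^ p * (-1) ^ ((p + p).choose 2) = 1 := by
      rw [← pow_add, hc]
      refine Even.neg_one_pow ?_
      rcases Nat.eq_zero_or_pos p with rfl | hp0
      · simp
      · have : p + p * (2 * p - 1) = 2 * (p * p) := by
          obtain ⟨k, rfl⟩ : ∃ k, p = k + 1 := ⟨p - 1, by omega⟩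
          have : 2 * (k + 1) - 1 = 2 * k + 1 := by omega
          rw [this]
          ring
        rw [this]
        exact even_two_mul _
    have h3 : ((((2 : ℝ) ^ p : ℝ) : ℂ) * ((2 : ℝ) ^ p : ℝ)) * (1 / 2) ^ (p + p) = 1 := by
      push_cast
      rw [← pow_add, ← mul_pow]
      norm_num
    have h4 : (((2 : ℝ) ^ p : ℝ) : ℂ) * Complex.I ^ p * ((((2 : ℝ) ^ p : ℝ) : ℂ) * Complex.I ^ p) *
        ((-1 : ℂ) ^ ((p + p).choose 2) * (1 / 2) ^ (p + p)) = 1 := by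
      calc _ = (((Complex.I ^ p * Complex.I ^ p) * (-1) ^ ((p + p).choose 2)) *
          (((((2 : ℝ) ^ p : ℝ) : ℂ) * ((2 : ℝ) ^ p : ℝ)) * (1 / 2) ^ (p + p))) := by ring
        _ = ((-1 : ℂ) ^ p * (-1) ^ ((p + p).choose 2)) *
          (((((2 : ℝ) ^ p : ℝ) : ℂ) * ((2 : ℝ) ^ p : ℝ)) * (1 / 2) ^ (p + p)) := by rw [h1]
        _ = 1 := by rw [h2, h3, one_mul]
    rw [h4, one_smul]
  · intro I hI J hJ
    have hI := (Finset.mem_powersetCard.1 hI).2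
    have hJ := (Finset.mem_powersetCard.1 hJ).2
    have h := anticomm_prod_mul_prod hψ.anticomm (I.sort (· ≤ ·)) (J.sort (· ≤ ·))
      (I.sort_nodup (· ≤ ·)) (J.sort_nodup (· ≤ ·))
    rw [Finset.length_sort, Finset.length_sort, hI, hJ, Finset.sort_toFinset,
      Finset.sort_toFinset, pow_add, Even.neg_one_pow ⟨p * (p + p), by ring⟩, one_mul] at h
    simp only [majoranaInvolution, majoranaMonomial, hI, hJ, hsmul, smul_mul_smul_comm, h,
      smul_smul, edgeSign]
    congr 1
    push_cast
    ring

/-- The Rademacher product law is the image of the uniform law on a finite space under a measurable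
embedding, so the formula needs no measurability of `F`. -/
theorem integral_pi_rademacher {κ : Type*} [Fintype κ] [DecidableEq κ] (F : (κ → ℝ) → ℝ) :
    ∫ ε, F ε ∂(Measure.pi fun _ : κ => rademacher) =
      signAverage fun τ : κ → Bool => F fun i => boolSign (τ i) := by
  let μ : Measure Bool := (2⁻¹ : ENNReal) • Measure.dirac true + (2⁻¹ : ENNReal) • Measure.dirac false
  have : IsProbabilityMeasure μ := ⟨by simp [μ, ENNReal.inv_two_add_inv_two]⟩
  have hmap : rademacher = μ.map boolSign := by
    have hm : Measurable boolSign := Measurable.of_discrete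
    rw [Measure.map_add _ _ hm, Measure.map_smul, Measure.map_smul,
      Measure.map_dirac' hm, Measure.map_dirac' hm]
    simp [rademacher, boolSign]
  have hpi : (Measure.pi fun _ : κ => rademacher) =
      (Measure.pi fun _ : κ => μ).map fun τ i => boolSign (τ i) := by
    have h := Measure.pi_map_pi (μ := fun _ : κ => μ) (f := fun _ => boolSign)
      (fun _ => Measurable.of_discrete.aemeasurable)
    rw [h]
    simp only [hmap]
  have hemb : MeasurableEmbedding fun (τ : κ → Bool) i => boolSign (τ i) := by
    refine ⟨fun τ τ' h => ?_, by fun_prop, fun {s} _ => (Set.toFinite _).measurableSet⟩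
    funext i
    have := congrFun h i
    simp only [boolSign] at this
    cases h1 : τ i <;> cases h2 : τ' i <;> simp [h1, h2] at this ⊢ <;> norm_num at this
  rw [hpi, hemb.integral_map, integral_fintype (Integrable.of_finite), signAverage,
    Finset.smul_sum]
  refine Finset.sum_congr rfl fun τ _ => ?_
  congr 1
  rw [Measure.real, Measure.pi_singleton]
  have : ∀ b, μ {b} = 2⁻¹ := fun b => by cases b <;> simp [μ]
  simp [this]

/-- An injective numbering of the hyperedges. -/
def edgeKey {V : Type*} [Fintype V] [DecidableEq V] (I : Finset V) : ℕ :=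
  Fintype.equivFin (Finset V) I

theorem edgeKey_injective {V : Type*} [Fintype V] [DecidableEq V] :
    Function.Injective (edgeKey : Finset V → ℕ) := fun _ _ h =>
  (Fintype.equivFin _).injective (Fin.ext h)

/-- The parameter of the even words in the SYK model. -/
def sykParam (n q : ℕ) (β : ℝ) : ℝ := β * couplingScale n q / 2 ^ (q / 2)

/-- The averaged exponential is a scalar matrix, and the normalized trace reads off the scalar. The
result depends on the commutation signs only, not on the chosen Majorana operators. -/
theorem integral_sykPartition [Nonempty ι] {q : ℕ} (hq : Even q) (hψ : IsMajorana ψ) (β : ℝ) :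
    ∫ ε, sykPartition q β ψ ε ∂(Measure.pi fun _ : Interactions n q => rademacher) =
      ∑ G ∈ ((univ : Finset (Fin n)).powersetCard q).powerset,
        wordSum edgeSign edgeKey G (sykParam n q β) := by
  have hinv := isInvolutive_majoranaInvolution hq hψ
  let u : Interactions n q ↪ Finset (Fin n) := Function.Embedding.subtype _
  have hu : (univ : Finset (Interactions n q)).map u = (univ : Finset (Fin n)).powersetCard q := by
    ext I
    simp [u, Finset.mem_powersetCard]
  have hinv' : IsInvolutive (fun I J : Interactions n q => edgeSign I.1 J.1)
      (fun I => majoranaInvolution q ψ I.1) univ :=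
    ⟨fun I _ => hinv.sq I.1 (by simp [Finset.mem_powersetCard, I.2]), fun I _ J _ =>
      hinv.comm I.1 (by simp [Finset.mem_powersetCard, I.2]) J.1
        (by simp [Finset.mem_powersetCard, J.2])⟩
  have hkey : Function.Injective fun I : Interactions n q => edgeKey I.1 := fun I J h =>
    Subtype.ext (edgeKey_injective h)
  have h1 : signAverage (fun τ : Interactions n q → Bool =>
      NormedSpace.exp (sykParam n q β • ∑ I, boolSign (τ I) • majoranaInvolution q ψ I.1)) =
        (∑ R ∈ univ.powerset, wordSum (fun I J : Interactions n q => edgeSign I.1 J.1)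
          (fun I => edgeKey I.1) R (sykParam n q β)) • (1 : Matrix ι ι ℂ) := by
    let _ : NormedRing (Matrix ι ι ℂ) := Matrix.linftyOpNormedRing
    let _ : NormedAlgebra ℝ (Matrix ι ι ℂ) := Matrix.linftyOpNormedAlgebra
    exact signAverage_exp (fun _ _ => abs_edgeSign _ _) hinv' hkey (sykParam n q β)
  have h2 : ∀ τ : Interactions n q → Bool,
      (β : ℂ) • sykHamiltonian q ψ (fun I => boolSign (τ I)) =
        sykParam n q β • ∑ I, boolSign (τ I) • majoranaInvolution q ψ I.1 := fun τ => by
    rw [sykHamiltonian, Finset.smul_sum, Finset.smul_sum]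
    refine Finset.sum_congr rfl fun I _ => ?_
    rw [majoranaInvolution, smul_smul, smul_smul, smul_smul,
      ← Complex.coe_smul (sykParam n q β * boolSign (τ I) * 2 ^ (q / 2))]
    congr 1
    rw [sykParam]
    push_cast
    field_simp
  have h3 : signAverage (fun τ : Interactions n q → Bool =>
      sykPartition q β ψ fun I => boolSign (τ I)) =
      (Matrix.trace (signAverage fun τ : Interactions n q → Bool =>
        NormedSpace.exp (sykParam n q β • ∑ I, boolSign (τ I) • majoranaInvolution q ψ I.1))).re /
          Fintype.card ι := by
    simp only [signAverage, sykPartition, h2, Matrix.trace_smul, Matrix.trace_sum, Complex.smul_re,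
      Complex.re_sum, smul_eq_mul]
    rw [← Finset.sum_div, mul_div_assoc]
  rw [integral_pi_rademacher, h3, h1, Matrix.trace_smul, Matrix.trace_one, Complex.smul_re,
    Complex.natCast_re, smul_eq_mul, mul_div_cancel_right₀ _ (by
      exact_mod_cast Fintype.card_ne_zero)]
  rw [← hu]
  symm
  refine Finset.sum_bij' (fun G _ => univ.filter fun I => u I ∈ G) (fun G _ => G.map u)
    ?_ ?_ ?_ ?_ ?_
  · simp
  · intro G _
    exact Finset.mem_powerset.2 (Finset.map_subset_map.2 (Finset.subset_univ _))
  · intro G hG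
    obtain ⟨G', _, rfl⟩ := Finset.subset_map_iff.1 (Finset.mem_powerset.1 hG)
    simp
  · intro G _
    simp
  · intro G hG
    obtain ⟨G', _, rfl⟩ := Finset.subset_map_iff.1 (Finset.mem_powerset.1 hG)
    have hsub : G'.map u ⊆ (univ : Finset (Fin n)).powersetCard q :=
      hu ▸ Finset.map_subset_map.2 (Finset.subset_univ _)
    rw [wordSum_map (A := Matrix ι ι ℂ) u (fun _ _ _ _ => rfl)
      ⟨fun a ha => hinv.sq a (hsub ha), fun a ha b hb => hinv.comm a (hsub ha) b (hsub hb)⟩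
      edgeKey_injective hkey]
    simp
    rfl

end SYK

/-! ### The cluster expansion -/

section Cluster

/-- The weight of connected clusters on `v` nodes. -/
def clusterWeight (q : ℕ) (s : ℝ) (v : ℕ) : ℝ :=
  ∑ G ∈ connectedOn q (univ : Finset (Fin v)), wordSum edgeSign edgeKey G s

/-- The sum over all hypergraphs with node set `B`. -/
def clusterPartition {n : ℕ} (q : ℕ) (s : ℝ) (B : Finset (Fin n)) : ℝ :=
  ∑ G ∈ (B.powersetCard q).powerset, wordSum edgeSign edgeKey G s

variable {n q : ℕ} {A : Type*} [NormedRing A] [NormedAlgebra ℝ A]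
  {g : Finset (Fin n) → A}

theorem IsInvolutive.mono {α : Type*} {η : α → α → ℝ} {g : α → A} {S T : Finset α}
    (h : IsInvolutive η g T) (hST : S ⊆ T) : IsInvolutive η g S :=
  ⟨fun a ha => h.sq a (hST ha), fun a ha b hb => h.comm a (hST ha) b (hST hb)⟩

/-- Relabeling the nodes may change the order of the keys but not the sizes of intersections, so
`wordSum_map` applies and only the number of nodes matters. -/
theorem sum_connectedOn_wordSum [Nontrivial A]
    (h : IsInvolutive edgeSign g ((univ : Finset (Fin n)).powersetCard q)) (s : ℝ)
    (B : Finset (Fin n)) :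
    ∑ G ∈ connectedOn q B, wordSum edgeSign edgeKey G s = clusterWeight q s #B := by
  obtain ⟨u, hu⟩ := exists_map_univ_eq B
  conv_lhs => rw [← hu, sum_connectedOn_map]
  refine Finset.sum_congr rfl fun G hG => ?_
  refine wordSum_map (A := A) (g := g) (edgeMap u) (fun a _ b _ => ?_) (h.mono ?_)
    edgeKey_injective edgeKey_injective s
  · simp [edgeSign, ← Finset.map_inter]
  · intro e he
    obtain ⟨f, hf, rfl⟩ := Finset.mem_map.1 he
    simp [Finset.mem_powersetCard, ((mem_connectedOn.1 hG).1 f hf).2]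

/-- Split off the component of `a`: edges in different components are disjoint, hence commute, and
`wordSum` factorizes. The component is `C` together with `a`, whence `#C + 1`. -/
theorem clusterPartition_eq [CompleteSpace A] [Nontrivial A] (hq : 0 < q)
    (h : IsInvolutive edgeSign g ((univ : Finset (Fin n)).powersetCard q)) (s : ℝ)
    {B : Finset (Fin n)} {a : Fin n} (ha : a ∈ B) :
    clusterPartition q s B = ∑ C ∈ (B.erase a).powerset,
      clusterWeight q s (#C + 1) * clusterPartition q s (B.erase a \ C) := by
  rw [clusterPartition, sum_powerset_powersetCard_eq hq _ ha]
  have h1 : ∀ C ∈ B.powerset, ∑ G₁ ∈ connectedOn q C, ∑ G₂ ∈ ((B \ C).powersetCard q).powerset,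
      wordSum edgeSign edgeKey (G₁ ∪ G₂) s =
        clusterWeight q s #C * clusterPartition q s (B \ C) := by
    intro C hC
    rw [← sum_connectedOn_wordSum h, clusterPartition, Finset.sum_mul_sum]
    refine Finset.sum_congr rfl fun G₁ h₁ => Finset.sum_congr rfl fun G₂ h₂ => ?_
    have h1 := (mem_connectedOn.1 h₁).1
    have h2 : ∀ e ∈ G₂, e ⊆ B \ C ∧ #e = q := fun e he =>
      Finset.mem_powersetCard.1 (Finset.mem_powerset.1 h₂ he)
    have hd : ∀ e ∈ G₁, ∀ f ∈ G₂, Disjoint e f := fun e he f hf =>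
      Finset.disjoint_of_subset_left (h1 e he).1
        (Finset.disjoint_of_subset_right (h2 f hf).1 Finset.disjoint_sdiff)
    refine wordSum_union (A := A) (fun _ _ => abs_edgeSign _ _) (h.mono ?_) edgeKey_injective ?_
      (fun e he f hf => edgeSign_of_disjoint (hd e he f hf)) s
    · intro e he
      rw [Finset.mem_powersetCard]
      exact ⟨Finset.subset_univ _, (Finset.mem_union.1 he).elim (fun he => (h1 e he).2)
        fun he => (h2 e he).2⟩
    · rw [Finset.disjoint_left]
      intro e he he'
      have := hd e he e he'
      rw [disjoint_self, Finset.bot_eq_empty] at this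
      have h3 := (h1 e he).2
      rw [this, Finset.card_empty] at h3
      omega
  rw [Finset.sum_congr rfl fun C hC => h1 C (Finset.mem_filter.1 hC).1, Finset.sum_filter]
  conv_lhs => rw [← Finset.insert_erase ha]
  rw [Finset.sum_powerset_insert (Finset.notMem_erase a B), Finset.sum_eq_zero, zero_add]
  · refine Finset.sum_congr rfl fun C hC => ?_
    have haC : a ∉ C := fun h => Finset.notMem_erase a B (Finset.mem_powerset.1 hC h)
    rw [if_pos (Finset.mem_insert_self _ _), Finset.card_insert_of_notMem haC,
      Finset.insert_sdiff_insert]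
    congr 2
    ext x
    simp only [Finset.mem_sdiff, Finset.mem_erase]
    constructor
    · rintro ⟨⟨h1, h2⟩, h3⟩
      exact ⟨⟨h1, h2⟩, fun h => h3 (by simp [h])⟩
    · rintro ⟨⟨h1, h2⟩, h3⟩
      exact ⟨⟨h1, h2⟩, fun h => h3 (by simpa [h1] using h)⟩
  · intro C hC
    rw [if_neg fun h => Finset.notMem_erase a B (Finset.mem_powerset.1 hC h)]

theorem wordSum_empty {α : Type*} [DecidableEq α] [Fintype α] (η : α → α → ℝ) (e : α → ℕ) (s : ℝ) :
    wordSum η e ∅ s = 1 := by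
  rw [wordSum, tsum_eq_single 0]
  · have : evenWords (∅ : Finset α) 0 = univ := by
      ext f
      simp [mem_evenWords]
      exact Subsingleton.elim _ _
    simp [wordCoeff, this, wordSign]
  · intro k hk
    have : evenWords (∅ : Finset α) k = ∅ := by
      refine Finset.eq_empty_of_forall_notMem fun f hf => ?_
      have := (mem_evenWords.1 hf).1
      have h1 : f ⟨0, Nat.pos_of_ne_zero hk⟩ ∈ (∅ : Finset α) :=
        this ▸ Finset.mem_image_of_mem f (mem_univ _)
      simp at h1
    simp [wordCoeff, this]

/-- The derivatives of the exponential of an entire function. -/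
theorem iteratedDeriv_cexp_comp {P : ℂ → ℂ} (hP : Differentiable ℂ P) (N : ℕ) (z : ℂ) :
    iteratedDeriv (N + 1) (fun z => Complex.exp (P z)) z =
      ∑ j ∈ range (N + 1), N.choose j * iteratedDeriv (j + 1) P z *
        iteratedDeriv (N - j) (fun z => Complex.exp (P z)) z := by
  have h1 : deriv (fun z => Complex.exp (P z)) = fun z => deriv P z * Complex.exp (P z) := by
    funext z
    rw [deriv_cexp (hP z), mul_comm]
  have h2 : ContDiff ℂ N (deriv P) := hP.deriv.contDiff
  have h3 : ContDiff ℂ N fun z => Complex.exp (P z) := hP.contDiff.cexp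
  rw [iteratedDeriv_succ', h1, iteratedDeriv_fun_mul h2.contDiffAt h3.contDiffAt]
  simp only [iteratedDeriv_succ']

/-- The polynomial `∑_{1 ≤ v ≤ n} μ_v z^v`. -/
def truncPhi (μ : ℕ → ℝ) (n : ℕ) (z : ℂ) : ℂ := ∑ v ∈ Icc 1 n, (μ v : ℂ) * z ^ v

theorem differentiable_truncPhi (μ : ℕ → ℝ) (n : ℕ) : Differentiable ℂ (truncPhi μ n) := by
  unfold truncPhi
  fun_prop

theorem iteratedDeriv_truncPhi (μ : ℕ → ℝ) {n j : ℕ} (hj : j + 1 ≤ n) (c : ℂ) :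
    iteratedDeriv (j + 1) (fun z => c * truncPhi μ n z) 0 = c * ((j + 1)! * μ (j + 1)) := by
  rw [iteratedDeriv_const_mul _ (differentiable_truncPhi μ n).contDiff.contDiffAt]
  congr 1
  unfold truncPhi
  rw [iteratedDeriv_fun_sum fun i _ => by fun_prop, Finset.sum_eq_single (j + 1)]
  · rw [iteratedDeriv_const_mul _ (by fun_prop), iteratedDeriv_fun_pow_zero, if_pos rfl, mul_comm]
  · intro i _ hi
    rw [iteratedDeriv_const_mul _ (by fun_prop), iteratedDeriv_fun_pow_zero, if_neg hi.symm,
      Nat.cast_zero, mul_zero]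
  · intro h
    exact absurd (Finset.mem_Icc.2 ⟨by omega, hj⟩) h

/-- The rescaled cluster weights. -/
def clusterCoeff (q n : ℕ) (s : ℝ) (v : ℕ) : ℝ :=
  clusterWeight q s v * (n : ℝ) ^ (v - 1) / (v ! : ℝ)

/-- The partition function is a Taylor coefficient. -/
theorem clusterPartition_eq_iteratedDeriv [CompleteSpace A] [Nontrivial A] (hq : 0 < q)
    (h : IsInvolutive edgeSign g ((univ : Finset (Fin n)).powersetCard q)) (s : ℝ)
    (B : Finset (Fin n)) :
    ((clusterPartition q s B * (n : ℝ) ^ #B : ℝ) : ℂ) =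
      iteratedDeriv #B (fun z => Complex.exp (n * truncPhi (clusterCoeff q n s) n z)) 0 := by
  induction B using Finset.strongInduction with
  | H B ih =>
    rcases B.eq_empty_or_nonempty with rfl | ⟨a, ha⟩
    · have : ((∅ : Finset (Fin n)).powersetCard q) = ∅ :=
        Finset.powersetCard_eq_empty.2 (by simpa using hq)
      simp only [clusterPartition, this, Finset.powerset_empty, Finset.sum_singleton,
        wordSum_empty, Finset.card_empty, pow_zero, iteratedDeriv_zero]
      simp [truncPhi]
      rw [Finset.sum_eq_zero]
      · simp
      · intro v hv
        rw [zero_pow (by have := (Finset.mem_Icc.1 hv).1; omega), mul_zero]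
    · have hcard : #B = #(B.erase a) + 1 := (Finset.card_erase_add_one ha).symm
      have hn : #(B.erase a) + 1 ≤ n := by
        rw [← hcard]
        simpa using Finset.card_le_univ B
      -- Grouped by `#C`, the recursion for the partition function is the Leibniz rule for the
      -- derivatives of `exp (n Φ_n)`. Truncating `Φ_n` at degree `n` is harmless because `#B ≤ n`.
      rw [clusterPartition_eq hq h s ha, hcard,
        iteratedDeriv_cexp_comp ((differentiable_truncPhi _ n).const_mul _)]
      set f := fun z => Complex.exp (n * truncPhi (clusterCoeff q n s) n z)
      have h1 : ∀ C ∈ (B.erase a).powerset,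
          ((clusterWeight q s (#C + 1) * clusterPartition q s (B.erase a \ C) *
            (n : ℝ) ^ (#(B.erase a) + 1) : ℝ) : ℂ) =
          (clusterWeight q s (#C + 1) * (n : ℝ) ^ (#C + 1) : ℝ) *
            iteratedDeriv (#(B.erase a) - #C) f 0 := by
        intro C hC
        have hC := Finset.mem_powerset.1 hC
        have h2 := ih (B.erase a \ C) (Finset.sdiff_subset.trans_ssubset (Finset.erase_ssubset ha))
        rw [Finset.card_sdiff_of_subset hC] at h2
        rw [← h2, ← Complex.ofReal_mul]
        congr 1
        have := Finset.card_le_card hC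
        have : (n : ℝ) ^ (#(B.erase a) + 1) =
            (n : ℝ) ^ (#C + 1) * (n : ℝ) ^ (#(B.erase a) - #C) := by
          rw [← pow_add]
          congr 1
          omega
        rw [this]
        ring
      rw [Finset.sum_mul, Complex.ofReal_sum, Finset.sum_congr rfl h1,
        Finset.sum_powerset_apply_card (fun j => ((clusterWeight q s (j + 1) *
          (n : ℝ) ^ (j + 1) : ℝ) : ℂ) * iteratedDeriv (#(B.erase a) - j) f 0)]
      refine Finset.sum_congr rfl fun j hj => ?_
      have hj := Finset.mem_range.1 hj
      rw [iteratedDeriv_truncPhi _ (by omega), nsmul_eq_mul, mul_assoc]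
      congr 2
      rw [clusterCoeff, Nat.add_sub_cancel, pow_succ]
      push_cast
      have : ((j + 1)! : ℂ) ≠ 0 := by exact_mod_cast (Nat.factorial_pos _).ne'
      field_simp

end Cluster

/-! ### The saddle point method -/

section Saddle

theorem abs_sin_nat_mul_le (v : ℕ) (x : ℝ) : |Real.sin (v * x)| ≤ v * |Real.sin x| := by
  induction v with
  | zero => simp
  | succ v ih =>
    push_cast
    rw [add_mul, one_mul, Real.sin_add, add_mul, one_mul]
    refine (abs_add_le _ _).trans ?_
    rw [abs_mul, abs_mul]
    have h1 := Real.abs_cos_le_one x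
    have h2 := Real.abs_cos_le_one (v * x)
    have h3 := abs_nonneg (Real.sin x)
    have h4 := abs_nonneg (Real.sin (v * x))
    nlinarith

/-- Follows from `1 - cos 2y = 2 sin² y`. It compares the higher Fourier modes of the exponent with
the first one, uniformly in the angle. -/
theorem one_sub_cos_nat_mul_le (v : ℕ) (x : ℝ) :
    1 - Real.cos (v * x) ≤ v ^ 2 * (1 - Real.cos x) := by
  have h : ∀ y : ℝ, 1 - Real.cos (2 * y) = 2 * |Real.sin y| ^ 2 := fun y => by
    rw [sq_abs, Real.cos_two_mul, Real.cos_sq']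
    ring
  have h1 := h (v * (x / 2))
  have h2 := h (x / 2)
  rw [show 2 * (v * (x / 2)) = v * x by ring] at h1
  rw [show 2 * (x / 2) = x by ring] at h2
  rw [h1, h2]
  have h3 := pow_le_pow_left₀ (abs_nonneg _) (abs_sin_nat_mul_le v (x / 2)) 2
  rw [mul_pow] at h3
  linarith

theorem abs_sin_sub_self_le (x : ℝ) : |Real.sin x - x| ≤ |x| ^ 3 := by
  have key : ∀ y : ℝ, 0 < y → |Real.sin y - y| ≤ |y| ^ 3 := fun y hy => by
    have h1 := Real.sin_gt_sub_cube hy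
    have h2 := Real.sin_lt hy
    have h3 : 0 < y ^ 3 := by positivity
    rw [abs_of_pos hy, abs_le]
    constructor <;> linarith
  rcases lt_trichotomy x 0 with h | rfl | h
  · have := key (-x) (by linarith)
    rwa [Real.sin_neg, ← neg_add', abs_neg, abs_neg, ← sub_eq_add_neg] at this
  · simp
  · exact key x h

variable {μ : ℕ → ℝ} {n : ℕ}

theorem Icc_one_eq_insert (hn : 1 ≤ n) : Icc 1 n = insert 1 (Icc 2 n) := by
  ext k
  simp only [Finset.mem_Icc, Finset.mem_insert]
  omega

/-- The polynomial `∑_{1 ≤ v ≤ n} μ_v z^v` differs little from `z`. -/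
structure IsNearId (μ : ℕ → ℝ) (n : ℕ) : Prop where
  one_le : 1 ≤ n
  coeff_one : μ 1 = 1
  -- Radius `2` covers the possible saddles in `[1/2, 3/2]`, and `v ^ 3` pays for the cubic error in
  -- the angle; the small right-hand side lets the term `v = 1` prevail everywhere.
  sum_le : ∑ v ∈ Icc 2 n, (v : ℝ) ^ 3 * |μ v| * 2 ^ v ≤ 1 / 8

theorem IsNearId.sum_eq (h : IsNearId μ n) (F : ℕ → ℝ) :
    ∑ v ∈ Icc 1 n, μ v * F v = F 1 + ∑ v ∈ Icc 2 n, μ v * F v := by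
  rw [Icc_one_eq_insert h.one_le, Finset.sum_insert (by simp), h.coeff_one, one_mul]

/-- The higher terms are small. -/
theorem IsNearId.abs_sum_le (h : IsNearId μ n) {F : ℕ → ℝ} {C : ℝ} (hC : 0 ≤ C)
    (hF : ∀ v, 2 ≤ v → |F v| ≤ C * ((v : ℝ) ^ 3 * 2 ^ v)) :
    |∑ v ∈ Icc 2 n, μ v * F v| ≤ C / 8 := by
  calc |∑ v ∈ Icc 2 n, μ v * F v| ≤ ∑ v ∈ Icc 2 n, C * ((v : ℝ) ^ 3 * |μ v| * 2 ^ v) := by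
        refine (Finset.abs_sum_le_sum_abs _ _).trans (Finset.sum_le_sum fun v hv => ?_)
        rw [abs_mul]
        have := mul_le_mul_of_nonneg_left (hF v (Finset.mem_Icc.1 hv).1) (abs_nonneg (μ v))
        linarith
    _ ≤ C / 8 := by
        rw [← Finset.mul_sum]
        have := mul_le_mul_of_nonneg_left h.sum_le hC
        linarith

/-- `∑ v μ_v t^v`, i.e. `t` times the derivative. -/
def logDerivSum (μ : ℕ → ℝ) (n : ℕ) (t : ℝ) : ℝ := ∑ v ∈ Icc 1 n, μ v * (v * t ^ v)

/-- The polynomial on the real axis. -/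
def truncPhiReal (μ : ℕ → ℝ) (n : ℕ) (t : ℝ) : ℝ := ∑ v ∈ Icc 1 n, μ v * t ^ v

theorem abs_pow_sub_pow_le_two {x y : ℝ} (hx : x ∈ Set.Icc (0 : ℝ) 2) (hy : y ∈ Set.Icc (0 : ℝ) 2)
    (v : ℕ) : |x ^ v - y ^ v| ≤ |x - y| * (v * 2 ^ v) := by
  refine (abs_pow_sub_pow_le x y v).trans ?_
  rw [mul_assoc]
  refine mul_le_mul_of_nonneg_left ?_ (abs_nonneg _)
  refine mul_le_mul_of_nonneg_left ?_ (Nat.cast_nonneg v)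
  calc max |x| |y| ^ (v - 1) ≤ 2 ^ (v - 1) := by
        refine pow_le_pow_left₀ (le_max_of_le_left (abs_nonneg x)) ?_ _
        rw [abs_of_nonneg hx.1, abs_of_nonneg hy.1]
        exact max_le hx.2 hy.2
    _ ≤ 2 ^ v := pow_le_pow_right₀ (by norm_num) (Nat.sub_le v 1)

theorem cast_pow_le_cube {v k : ℕ} (hv : 2 ≤ v) (hk : k ≤ 3) : (v : ℝ) ^ k ≤ (v : ℝ) ^ 3 :=
  pow_le_pow_right₀ (by exact_mod_cast (by omega : 1 ≤ v)) hk

/-- The map `t ↦ t Φ'(t)` is the identity up to an error with Lipschitz constant `1 / 8`. This makes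
the saddle unique and stable under perturbation of the coefficients. -/
theorem IsNearId.logDerivSum_sub (h : IsNearId μ n) {x y : ℝ} (hx : x ∈ Set.Icc (0 : ℝ) 2)
    (hy : y ∈ Set.Icc (0 : ℝ) 2) :
    |logDerivSum μ n x - logDerivSum μ n y - (x - y)| ≤ |x - y| / 8 := by
  have h1 : logDerivSum μ n x - logDerivSum μ n y - (x - y) =
      ∑ v ∈ Icc 2 n, μ v * (v * (x ^ v - y ^ v)) := by
    simp only [logDerivSum]
    rw [h.sum_eq, h.sum_eq]
    simp only [mul_sub, Finset.sum_sub_distrib]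
    simp
    ring
  rw [h1]
  refine h.abs_sum_le (abs_nonneg _) fun v hv => ?_
  rw [abs_mul, Nat.abs_cast]
  have h2 := abs_pow_sub_pow_le_two hx hy v
  have h3 := cast_pow_le_cube hv (by norm_num : 2 ≤ 3)
  have h4 : 0 ≤ |x - y| * 2 ^ v := by positivity
  calc (v : ℝ) * |x ^ v - y ^ v| ≤ v * (|x - y| * (v * 2 ^ v)) := by gcongr
    _ = (|x - y| * 2 ^ v) * (v : ℝ) ^ 2 := by ring
    _ ≤ (|x - y| * 2 ^ v) * (v : ℝ) ^ 3 := by gcongr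
    _ = _ := by ring

theorem IsNearId.truncPhiReal_sub (h : IsNearId μ n) {x y : ℝ} (hx : x ∈ Set.Icc (0 : ℝ) 2)
    (hy : y ∈ Set.Icc (0 : ℝ) 2) :
    |truncPhiReal μ n x - truncPhiReal μ n y| ≤ 2 * |x - y| := by
  have h1 : truncPhiReal μ n x - truncPhiReal μ n y =
      (x - y) + ∑ v ∈ Icc 2 n, μ v * (x ^ v - y ^ v) := by
    simp only [truncPhiReal]
    rw [h.sum_eq, h.sum_eq]
    simp only [mul_sub, Finset.sum_sub_distrib]
    simp
    ring
  have h5 : |∑ v ∈ Icc 2 n, μ v * (x ^ v - y ^ v)| ≤ |x - y| / 8 := by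
    refine h.abs_sum_le (abs_nonneg _) fun v hv => ?_
    have h3 := cast_pow_le_cube hv (by norm_num : 1 ≤ 3)
    refine (abs_pow_sub_pow_le_two hx hy v).trans ?_
    rw [pow_one] at h3
    gcongr
  rw [h1]
  refine (abs_add_le _ _).trans ?_
  have := abs_nonneg (x - y)
  linarith

theorem IsNearId.abs_logDerivSum_sub_le (h : IsNearId μ n) {t : ℝ} (ht : t ∈ Set.Icc (0 : ℝ) 2) :
    |logDerivSum μ n t - t| ≤ 1 / 8 := by
  have h1 : logDerivSum μ n t - t = ∑ v ∈ Icc 2 n, μ v * (v * t ^ v) := by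
    rw [logDerivSum, h.sum_eq]
    simp
  rw [h1]
  refine (h.abs_sum_le zero_le_one fun v hv => ?_).trans le_rfl
  have h3 := cast_pow_le_cube hv (by norm_num : 1 ≤ 3)
  rw [pow_one] at h3
  rw [one_mul, abs_of_nonneg (by have := ht.1; positivity)]
  have := ht.1
  have := ht.2
  gcongr

theorem continuous_logDerivSum (μ : ℕ → ℝ) (n : ℕ) : Continuous (logDerivSum μ n) := by
  unfold logDerivSum
  fun_prop

theorem IsNearId.exists_saddle (h : IsNearId μ n) :
    ∃ t ∈ Set.Icc (1 / 2 : ℝ) (3 / 2), logDerivSum μ n t = 1 := by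
  have h1 := abs_le.1 (h.abs_logDerivSum_sub_le (t := 1 / 2) ⟨by norm_num, by norm_num⟩)
  have h2 := abs_le.1 (h.abs_logDerivSum_sub_le (t := 3 / 2) ⟨by norm_num, by norm_num⟩)
  have := intermediate_value_Icc (by norm_num : (1 / 2 : ℝ) ≤ 3 / 2)
    (continuous_logDerivSum μ n).continuousOn
  exact this ⟨by linarith [h1.2], by linarith [h2.1]⟩

/-- The exponent on the circle of radius `t`. -/
def saddleExponent (μ : ℕ → ℝ) (n : ℕ) (t θ : ℝ) : ℂ :=
  truncPhi μ n (t * Complex.exp (θ * Complex.I)) - truncPhi μ n t - θ * Complex.I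

theorem saddleExponent_eq (μ : ℕ → ℝ) (n : ℕ) (t θ : ℝ) :
    saddleExponent μ n t θ = ((∑ v ∈ Icc 1 n, μ v * (t ^ v * (Real.cos (v * θ) - 1)) : ℝ) : ℂ) +
      ((∑ v ∈ Icc 1 n, μ v * (t ^ v * Real.sin (v * θ)) - θ : ℝ) : ℂ) * Complex.I := by
  have h : ∀ v : ℕ, (μ v : ℂ) * (t * Complex.exp (θ * Complex.I)) ^ v - μ v * (t : ℂ) ^ v =
      ((μ v * (t ^ v * (Real.cos (v * θ) - 1)) : ℝ) : ℂ) +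
      ((μ v * (t ^ v * Real.sin (v * θ)) : ℝ) : ℂ) * Complex.I := fun v => by
    rw [mul_pow, ← Complex.exp_nat_mul, ← mul_assoc (v : ℂ), Complex.exp_mul_I]
    push_cast
    ring
  rw [saddleExponent, truncPhi, truncPhi, ← Finset.sum_sub_distrib, Finset.sum_congr rfl fun v _ => h v,
    Finset.sum_add_distrib, ← Finset.sum_mul]
  push_cast
  ring

theorem re_ofReal_add_mul_I (a b : ℝ) : ((a : ℂ) + (b : ℂ) * Complex.I).re = a := by simp

theorem im_ofReal_add_mul_I (a b : ℝ) : ((a : ℂ) + (b : ℂ) * Complex.I).im = b := by simp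

theorem saddleExponent_re (μ : ℕ → ℝ) (n : ℕ) (t θ : ℝ) :
    (saddleExponent μ n t θ).re = ∑ v ∈ Icc 1 n, μ v * (t ^ v * (Real.cos (v * θ) - 1)) := by
  rw [saddleExponent_eq, re_ofReal_add_mul_I]

/-- The term `v = 1` is `-t (1 - cos θ)` with `t` between `1/2` and `3/2`, and the higher terms add
at most `(1 - cos θ) / 8`. -/
theorem IsNearId.saddleExponent_re_bound (h : IsNearId μ n) {t : ℝ}
    (ht : t ∈ Set.Icc (1 / 2 : ℝ) (3 / 2)) (θ : ℝ) :
    -(2 * (1 - Real.cos θ)) ≤ (saddleExponent μ n t θ).re ∧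
      (saddleExponent μ n t θ).re ≤ -((1 - Real.cos θ) / 4) := by
  have hc : 0 ≤ 1 - Real.cos θ := by linarith [Real.cos_le_one θ]
  have h1 : |∑ v ∈ Icc 2 n, μ v * (t ^ v * (Real.cos (v * θ) - 1))| ≤ (1 - Real.cos θ) / 8 := by
    refine h.abs_sum_le hc fun v hv => ?_
    have h2 := one_sub_cos_nat_mul_le v θ
    have h3 := cast_pow_le_cube hv (by norm_num : 2 ≤ 3)
    have h4 : 0 ≤ 1 - Real.cos (v * θ) := by linarith [Real.cos_le_one (v * θ)]
    have ht0 : 0 ≤ t := by linarith [ht.1]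
    have ht2 : t ≤ 2 := by linarith [ht.2]
    rw [abs_mul, abs_of_nonneg (by positivity), ← abs_neg, neg_sub, abs_of_nonneg h4]
    calc t ^ v * (1 - Real.cos (v * θ)) ≤ 2 ^ v * ((v : ℝ) ^ 3 * (1 - Real.cos θ)) := by
          refine mul_le_mul (pow_le_pow_left₀ ht0 ht2 v) (h2.trans ?_) h4 (by positivity)
          gcongr
      _ = _ := by ring
  rw [saddleExponent_re, h.sum_eq]
  have h5 := abs_le.1 h1
  simp only [Nat.cast_one, one_mul, pow_one]
  constructor
  · nlinarith [h5.1, ht.2]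
  · nlinarith [h5.2, ht.1]

/-- The saddle condition cancels the part linear in `θ`; what remains are differences `sin x - x`,
which are cubic. -/
theorem IsNearId.abs_saddleExponent_im_le (h : IsNearId μ n) {t : ℝ}
    (ht : t ∈ Set.Icc (1 / 2 : ℝ) (3 / 2)) (hs : logDerivSum μ n t = 1) (θ : ℝ) :
    |(saddleExponent μ n t θ).im| ≤ 2 * |θ| ^ 3 := by
  have h1 : (saddleExponent μ n t θ).im =
      ∑ v ∈ Icc 1 n, μ v * (t ^ v * (Real.sin (v * θ) - v * θ)) := by
    rw [saddleExponent_eq, im_ofReal_add_mul_I]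
    have : ∑ v ∈ Icc 1 n, μ v * (t ^ v * (v * θ)) = θ := by
      calc _ = logDerivSum μ n t * θ := by
            rw [logDerivSum, Finset.sum_mul]
            exact Finset.sum_congr rfl fun v _ => by ring
        _ = θ := by rw [hs, one_mul]
    simp only [mul_sub, Finset.sum_sub_distrib]
    rw [this]
  have ht0 : 0 ≤ t := by linarith [ht.1]
  have ht2 : t ≤ 2 := by linarith [ht.2]
  have h2 : |∑ v ∈ Icc 2 n, μ v * (t ^ v * (Real.sin (v * θ) - v * θ))| ≤ |θ| ^ 3 / 8 := by
    refine h.abs_sum_le (by positivity) fun v hv => ?_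
    rw [abs_mul, abs_of_nonneg (by positivity)]
    have := abs_sin_sub_self_le (v * θ)
    rw [abs_mul, Nat.abs_cast, mul_pow] at this
    calc t ^ v * |Real.sin (v * θ) - v * θ| ≤ 2 ^ v * ((v : ℝ) ^ 3 * |θ| ^ 3) := by gcongr
      _ = _ := by ring
  rw [h1, h.sum_eq]
  refine (abs_add_le _ _).trans ?_
  have h3 := abs_sin_sub_self_le θ
  simp only [Nat.cast_one, one_mul, pow_one]
  rw [abs_mul, abs_of_nonneg ht0]
  have h4 : t * |Real.sin θ - θ| ≤ 3 / 2 * |θ| ^ 3 :=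
    mul_le_mul ht.2 h3 (abs_nonneg _) (by norm_num)
  have : 0 ≤ |θ| ^ 3 := by positivity
  linarith

end Saddle

/-! ### The coefficient integral over the saddle circle. -/

section Saddle

/-- Cauchy's integral formula for the derivatives at `0`, in the angular variable. -/
theorem iteratedDeriv_eq_angular_integral {f : ℂ → ℂ} (hf : Differentiable ℂ f) (n : ℕ) {t : ℝ}
    (ht : 0 < t) : iteratedDeriv n f 0 = (n ! : ℂ) / (2 * Real.pi) *
      ∫ θ in (-Real.pi)..Real.pi,
        f (t * Complex.exp (θ * Complex.I)) / (t * Complex.exp (θ * Complex.I)) ^ n := by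
  have h := DifferentiableOn.circleIntegral_one_div_sub_center_pow_smul (c := 0) ht n
    hf.differentiableOn
  have hpi : (Real.pi : ℂ) ≠ 0 := by exact_mod_cast Real.pi_ne_zero
  have hper : Function.Periodic (fun θ : ℝ => f (circleMap 0 t θ) / circleMap 0 t θ ^ n)
      (2 * Real.pi) := fun θ => by simp only [periodic_circleMap 0 t θ]
  have h1 : (∮ z in C(0, t), (1 / (z - 0) ^ (n + 1)) • f z) =
      Complex.I * ∫ θ in (0 : ℝ)..2 * Real.pi, f (circleMap 0 t θ) / circleMap 0 t θ ^ n := by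
    rw [circleIntegral, ← intervalIntegral.integral_const_mul]
    refine intervalIntegral.integral_congr fun θ _ => ?_
    have h0 : circleMap 0 t θ ≠ 0 := circleMap_ne_center ht.ne'
    simp only [deriv_circleMap, sub_zero, smul_eq_mul]
    field_simp
    ring
  have h2 := hper.intervalIntegral_add_eq 0 (-Real.pi)
  rw [zero_add, show -Real.pi + 2 * Real.pi = Real.pi by ring] at h2
  rw [h1, h2] at h
  have hn : (n ! : ℂ) ≠ 0 := by exact_mod_cast n.factorial_ne_zero
  simp only [circleMap_zero, smul_eq_mul] at h
  have hI := Complex.I_ne_zero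
  field_simp at h ⊢
  rw [h]

/-- The real part of the angular integral. -/
def saddleIntegral (μ : ℕ → ℝ) (n : ℕ) (t : ℝ) : ℝ :=
  ∫ θ in (-Real.pi)..Real.pi, (Complex.exp (n * saddleExponent μ n t θ)).re

theorem truncPhi_ofReal (μ : ℕ → ℝ) (n : ℕ) (t : ℝ) :
    truncPhi μ n t = (truncPhiReal μ n t : ℂ) := by
  simp [truncPhi, truncPhiReal]

theorem continuous_saddleIntegrand (μ : ℕ → ℝ) (n : ℕ) (t : ℝ) :
    Continuous fun θ : ℝ => Complex.exp (n * saddleExponent μ n t θ) := by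
  unfold saddleExponent truncPhi
  fun_prop

/-- Cauchy's formula with the value at angle `0` factored out. As `Z` is real, the real part of the
remaining integral suffices. -/
theorem eq_saddleIntegral {μ : ℕ → ℝ} {n : ℕ} {Z : ℝ}
    (hZ : (Z : ℂ) = iteratedDeriv n (fun z => Complex.exp (n * truncPhi μ n z)) 0) {t : ℝ}
    (ht : 0 < t) : Z = n ! / (2 * Real.pi) *
      (Real.exp (n * truncPhiReal μ n t) / t ^ n * saddleIntegral μ n t) := by
  rw [iteratedDeriv_eq_angular_integral
    (((differentiable_truncPhi μ n).const_mul (n : ℂ)).cexp) n ht] at hZ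
  have ht' : (t : ℂ) ≠ 0 := by exact_mod_cast ht.ne'
  have h : ∀ θ : ℝ, Complex.exp (n * truncPhi μ n (t * Complex.exp (θ * Complex.I))) /
      (t * Complex.exp (θ * Complex.I)) ^ n =
      ((Real.exp (n * truncPhiReal μ n t) / t ^ n : ℝ) : ℂ) *
        Complex.exp (n * saddleExponent μ n t θ) := fun θ => by
    rw [saddleExponent, truncPhi_ofReal, mul_pow, ← Complex.exp_nat_mul]
    push_cast
    rw [mul_sub, mul_sub, Complex.exp_sub, Complex.exp_sub]
    have h1 := Complex.exp_ne_zero (n * (truncPhiReal μ n t : ℂ))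
    field_simp
  simp only [h] at hZ
  rw [intervalIntegral.integral_const_mul] at hZ
  have h3 := congrArg Complex.re hZ
  rw [Complex.ofReal_re, show (n ! : ℂ) / (2 * Real.pi) = ((n ! / (2 * Real.pi) : ℝ) : ℂ) by
    push_cast; rfl, Complex.re_ofReal_mul, Complex.re_ofReal_mul] at h3
  rw [h3, saddleIntegral]
  congr 2
  have := (Complex.reCLM.intervalIntegral_comp_comm
    ((continuous_saddleIntegrand μ n t).intervalIntegrable (μ := volume) (-Real.pi) Real.pi))
  simpa using this.symm

variable {μ : ℕ → ℝ} {n : ℕ} {t : ℝ}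

theorem IsNearId.re_nonpos (h : IsNearId μ n) (ht : t ∈ Set.Icc (1 / 2 : ℝ) (3 / 2)) (θ : ℝ) :
    (saddleExponent μ n t θ).re ≤ 0 := by
  have := (h.saddleExponent_re_bound ht θ).2
  linarith [Real.cos_le_one θ]

theorem re_natCast_mul (n : ℕ) (w : ℂ) : ((n : ℂ) * w).re = n * w.re := by simp

theorem im_natCast_mul (n : ℕ) (w : ℂ) : ((n : ℂ) * w).im = n * w.im := by simp

theorem intervalIntegrable_saddleIntegrand (μ : ℕ → ℝ) (n : ℕ) (t a b : ℝ) :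
    IntervalIntegrable (fun θ : ℝ => (Complex.exp (n * saddleExponent μ n t θ)).re) volume a b :=
  (Complex.continuous_re.comp (continuous_saddleIntegrand μ n t)).intervalIntegrable _ _

theorem norm_saddleIntegrand (μ : ℕ → ℝ) (n : ℕ) (t θ : ℝ) :
    ‖Complex.exp (n * saddleExponent μ n t θ)‖ = Real.exp (n * (saddleExponent μ n t θ).re) := by
  rw [Complex.norm_exp, re_natCast_mul]

theorem IsNearId.saddleIntegral_le (h : IsNearId μ n) (ht : t ∈ Set.Icc (1 / 2 : ℝ) (3 / 2)) :
    saddleIntegral μ n t ≤ 2 * Real.pi := by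
  have h1 : saddleIntegral μ n t ≤ ∫ θ in (-Real.pi)..Real.pi, (1 : ℝ) := by
    refine intervalIntegral.integral_mono_on (by linarith [Real.pi_pos])
      (intervalIntegrable_saddleIntegrand μ n t _ _)
      (by simp) fun θ _ => ?_
    refine (Complex.re_le_norm _).trans ?_
    rw [norm_saddleIntegrand, Real.exp_le_one_iff]
    exact mul_nonpos_of_nonneg_of_nonpos (Nat.cast_nonneg n) (h.re_nonpos ht θ)
  refine h1.trans (le_of_eq ?_)
  simp
  ring

theorem re_exp_ge {w : ℂ} {a : ℝ} (ha : a ≤ w.re) (h : |w.im| ≤ 1) :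
    Real.exp a / 2 ≤ (Complex.exp w).re := by
  rw [Complex.exp_re]
  have h1 : 1 / 2 ≤ Real.cos w.im := by
    have := Real.one_sub_sq_div_two_le_cos (x := w.im)
    have h2 : w.im ^ 2 ≤ 1 := by rw [← sq_abs]; exact pow_le_one₀ (abs_nonneg _) h
    linarith
  have h3 := Real.exp_le_exp.2 ha
  have h4 := Real.exp_pos a
  nlinarith

/-- The integrand is at least `1 / 4` close to `0` and nowhere very negative. -/
theorem IsNearId.saddleIntegral_ge (h : IsNearId μ n) (ht : t ∈ Set.Icc (1 / 2 : ℝ) (3 / 2))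
    (hs : logDerivSum μ n t = 1) {δ : ℝ} (hδ : 2 * n * δ ^ 3 ≤ 1) (hδ1 : 1 / (2 * n) ≤ δ) :
    1 / (4 * n) - 2 * Real.pi * Real.exp (-(n * δ ^ 2 / 20)) ≤ saddleIntegral μ n t := by
  have hn : (1 : ℝ) ≤ n := by exact_mod_cast h.one_le
  have hn0 : (0 : ℝ) < n := by linarith
  have hδ0 : 0 < δ := lt_of_lt_of_le (by positivity) hδ1
  set ε := Real.exp (-(n * δ ^ 2 / 20)) with hε
  have hε0 : 0 < ε := Real.exp_pos _
  have hpi := Real.pi_gt_three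
  -- For `|θ| ≤ δ` the phase is at most `1`, so the integrand is positive. Outside, its modulus is
  -- at most `ε`, because `(1 - cos θ) / 4 ≥ θ² / 20` on `[-π, π]`.
  have him : ∀ θ : ℝ, |θ| ≤ δ → |(n * saddleExponent μ n t θ : ℂ).im| ≤ 1 := fun θ hθ => by
    rw [im_natCast_mul, abs_mul, Nat.abs_cast]
    have h1 := h.abs_saddleExponent_im_le ht hs θ
    have h2 := pow_le_pow_left₀ (abs_nonneg θ) hθ 3
    calc (n : ℝ) * |(saddleExponent μ n t θ).im| ≤ n * (2 * δ ^ 3) := by gcongr; linarith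
      _ ≤ 1 := by linarith
  have hlow : ∀ θ ∈ Set.Icc (-Real.pi) Real.pi,
      -ε ≤ (Complex.exp (n * saddleExponent μ n t θ)).re := fun θ hθ => by
    rcases le_total |θ| δ with h1 | h1
    · have := re_exp_ge le_rfl (him θ h1)
      have h2 := Real.exp_pos (n * saddleExponent μ n t θ : ℂ).re
      linarith
    · refine (neg_le_neg ?_).trans (neg_le_of_abs_le (Complex.abs_re_le_norm _))
      rw [norm_saddleIntegrand, hε, Real.exp_le_exp]
      have h2 := (h.saddleExponent_re_bound ht θ).2
      have h3 := Real.cos_le_one_sub_mul_cos_sq (x := θ) (abs_le.2 hθ)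
      have h4 : 1 / 5 ≤ 2 / Real.pi ^ 2 := by
        rw [div_le_div_iff₀ (by norm_num) (by positivity)]
        nlinarith [Real.pi_lt_d2]
      have h5 : δ ^ 2 ≤ θ ^ 2 := by rw [← sq_abs θ]; gcongr
      have h6 : 1 / 5 * δ ^ 2 ≤ 2 / Real.pi ^ 2 * θ ^ 2 := by gcongr
      have h7 : (saddleExponent μ n t θ).re ≤ -(δ ^ 2 / 20) := by linarith
      nlinarith
  -- A crude window, narrower than the natural scale `n ^ (-1/2)`; a loss of any fixed power of `n`
  -- disappears in `log / n`.
  have hmid : ∀ θ ∈ Set.Icc (-(1 / (2 * n)) : ℝ) (1 / (2 * n)),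
      1 / 4 ≤ (Complex.exp (n * saddleExponent μ n t θ)).re := fun θ hθ => by
    have hθ' : |θ| ≤ 1 / (2 * n) := abs_le.2 hθ
    have h1 : (-(1 / 4) : ℝ) ≤ (n * saddleExponent μ n t θ : ℂ).re := by
      rw [re_natCast_mul]
      have h2 := (h.saddleExponent_re_bound ht θ).1
      have h3 := Real.one_sub_sq_div_two_le_cos (x := θ)
      have h4 : θ ^ 2 ≤ (1 / (2 * n)) ^ 2 := by rw [← sq_abs θ]; gcongr
      have h5 : n * (1 / (2 * n : ℝ)) ^ 2 ≤ 1 / 4 := by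
        have : n * (1 / (2 * n : ℝ)) ^ 2 = 1 / 4 * (1 / n) := by field_simp; norm_num
        rw [this]
        have : 1 / (n : ℝ) ≤ 1 := by rw [div_le_one hn0]; exact hn
        linarith
      have h6 : n * θ ^ 2 ≤ 1 / 4 := (mul_le_mul_of_nonneg_left h4 hn0.le).trans h5
      nlinarith
    have h7 := re_exp_ge h1 (him θ (hθ'.trans hδ1))
    have h8 := Real.add_one_le_exp (-(1 / 4) : ℝ)
    linarith
  have hint : ∀ a b : ℝ, IntervalIntegrable
      (fun θ : ℝ => (Complex.exp (n * saddleExponent μ n t θ)).re + ε) volume a b := fun a b =>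
    ((Complex.continuous_re.comp (continuous_saddleIntegrand μ n t)).add
      continuous_const).intervalIntegrable _ _
  have hsm : 1 / (2 * n : ℝ) ≤ Real.pi := by
    rw [div_le_iff₀ (by positivity)]
    nlinarith
  have hpos : 0 < 1 / (2 * n : ℝ) := by positivity
  have key : ∫ θ in (-(1 / (2 * n)) : ℝ)..(1 / (2 * n)), (1 / 4 : ℝ) ≤
      ∫ θ in (-Real.pi)..Real.pi, ((Complex.exp (n * saddleExponent μ n t θ)).re + ε) := by
    refine le_trans (intervalIntegral.integral_mono_on (by linarith) (by simp) (hint _ _)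
      fun θ hθ => by linarith [hmid θ hθ]) ?_
    refine intervalIntegral.integral_mono_interval (by linarith) (by linarith) hsm ?_ (hint _ _)
    refine (ae_restrict_iff' measurableSet_Ioc).2 (Eventually.of_forall fun θ hθ => ?_)
    have := hlow θ ⟨hθ.1.le, hθ.2⟩
    simp only [Pi.zero_apply]
    linarith
  rw [intervalIntegral.integral_add
    (intervalIntegrable_saddleIntegrand μ n t _ _)
    (by simp)] at key
  simp only [intervalIntegral.integral_const, smul_eq_mul] at key
  have h9 : (1 / (2 * n) - -(1 / (2 * n)) : ℝ) * (1 / 4) = 1 / (4 * n) := by field_simp; norm_num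
  rw [h9] at key
  rw [saddleIntegral]
  linarith

/-- Stirling's formula; this is the source of the `-1` in the limiting free energy. -/
theorem tendsto_log_factorial_div :
    Tendsto (fun n : ℕ => Real.log (n ! / (n : ℝ) ^ n) / n) atTop (𝓝 (-1)) := by
  have h1 : Tendsto (fun n : ℕ => Real.log (Stirling.stirlingSeq n) / n) atTop (𝓝 0) :=
    ((Real.continuousAt_log (by positivity)).tendsto.comp
      Stirling.tendsto_stirlingSeq_sqrt_pi).div_atTop tendsto_natCast_atTop_atTop
  have h2 : Tendsto (fun n : ℕ => Real.log n / (n : ℝ)) atTop (𝓝 0) :=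
    (Real.isLittleO_log_id_atTop.tendsto_div_nhds_zero).comp tendsto_natCast_atTop_atTop
  have h3 : Tendsto (fun n : ℕ => Real.log 2 / (n : ℝ)) atTop (𝓝 0) :=
    tendsto_const_nhds.div_atTop tendsto_natCast_atTop_atTop
  have h4 := ((h1.add (h2.const_mul (1 / 2))).add (h3.const_mul (1 / 2))).sub_const 1
  simp only [mul_zero, add_zero, zero_sub] at h4
  refine h4.congr' ?_
  filter_upwards [eventually_ge_atTop 1] with n hn
  have hn0 : (0 : ℝ) < n := by exact_mod_cast hn
  rw [Stirling.log_stirlingSeq_formula, Real.log_mul (by norm_num) hn0.ne',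
    Real.log_div hn0.ne' (Real.exp_pos 1).ne', Real.log_exp,
    Real.log_div (by positivity) (by positivity), Real.log_pow]
  field_simp
  ring

/-- The logarithmic asymptotics of the coefficients of `exp (n Φ_n)`. -/
theorem tendsto_log_coeff {μ : ℕ → ℕ → ℝ} {Z : ℕ → ℝ} {l : Filter ℕ} (hl : l ≤ atTop)
    (hμ : ∀ᶠ n in l, IsNearId (μ n) n)
    (hZ : ∀ᶠ n in l, ((Z n * (n : ℝ) ^ n : ℝ) : ℂ) =
      iteratedDeriv n (fun z => Complex.exp (n * truncPhi (μ n) n z)) 0)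
    {t P : ℝ} (ht : t ∈ Set.Icc (1 / 2 : ℝ) (3 / 2))
    (hD : Tendsto (fun n => logDerivSum (μ n) n t) l (𝓝 1))
    (hP : Tendsto (fun n => truncPhiReal (μ n) n t) l (𝓝 P)) :
    Tendsto (fun n => Real.log (Z n) / n) l (𝓝 (P - 1 - Real.log t)) := by
  classical
  -- The saddle of the `n`-th polynomial, which moves with `n`; the value `t` in the other case is a
  -- dummy. Stability of the saddle gives `u n → t`.
  let u : ℕ → ℝ := fun n =>
    if h : IsNearId (μ n) n then h.exists_saddle.choose else t
  have hu : ∀ᶠ n in l, u n ∈ Set.Icc (1 / 2 : ℝ) (3 / 2) ∧ logDerivSum (μ n) n (u n) = 1 := by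
    filter_upwards [hμ] with n hn
    simp only [u, dif_pos hn]
    exact hn.exists_saddle.choose_spec
  have hsub : Set.Icc (1 / 2 : ℝ) (3 / 2) ⊆ Set.Icc 0 2 :=
    Set.Icc_subset_Icc (by norm_num) (by norm_num)
  have hut : Tendsto u l (𝓝 t) := by
    rw [tendsto_iff_norm_sub_tendsto_zero]
    have h1 : Tendsto (fun n => 2 * |1 - logDerivSum (μ n) n t|) l (𝓝 0) := by
      have := ((tendsto_const_nhds (x := (1 : ℝ))).sub hD).abs.const_mul 2
      simpa using this
    refine squeeze_zero' (Eventually.of_forall fun _ => norm_nonneg _) ?_ h1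
    filter_upwards [hμ, hu] with n hn hun
    have h2 := hn.logDerivSum_sub (hsub hun.1) (hsub ht)
    rw [hun.2] at h2
    rw [Real.norm_eq_abs]
    have h3 := abs_sub_abs_le_abs_sub (u n - t) (1 - logDerivSum (μ n) n t)
    rw [abs_sub_comm] at h2
    linarith [abs_nonneg (u n - t)]
  have huP : Tendsto (fun n => truncPhiReal (μ n) n (u n)) l (𝓝 P) := by
    have h1 : Tendsto (fun n => truncPhiReal (μ n) n (u n) - truncPhiReal (μ n) n t) l (𝓝 0) := by
      rw [tendsto_zero_iff_abs_tendsto_zero]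
      have h2 : Tendsto (fun n => 2 * |u n - t|) l (𝓝 0) := by
        have := (hut.sub_const t).abs.const_mul 2
        simpa using this
      refine squeeze_zero' (Eventually.of_forall fun _ => abs_nonneg _) ?_ h2
      filter_upwards [hμ, hu] with n hn hun
      exact hn.truncPhiReal_sub (hsub hun.1) (hsub ht)
    simpa using h1.add hP
  have ht0 : t ≠ 0 := by linarith [ht.1]
  have hlogu := (Real.continuousAt_log ht0).tendsto.comp hut
  -- The choice `δ = (2 n) ^ (-1/3)` makes `2 n δ³ = 1`, while `n δ² / 20 = (2 n) ^ (1/3) / 40`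
  -- still tends to infinity, so the exponential error falls below `1 / (8 n)`.
  have hJ : ∀ᶠ n : ℕ in l, 1 / (8 * n : ℝ) ≤ saddleIntegral (μ n) n (u n) := by
    have h1 : ∀ᶠ n : ℕ in atTop, 2 * Real.pi *
        Real.exp (-(n * ((2 * n : ℝ) ^ (-(1 / 3) : ℝ)) ^ 2 / 20)) ≤ 1 / (8 * n : ℝ) := by
      have h2 : Tendsto (fun x : ℝ => x ^ 3 * Real.exp (-(1 / 40 * x))) atTop (𝓝 0) := by
        have h3 := (tendsto_rpow_mul_exp_neg_mul_atTop_nhds_zero 3 (1 / 40) (by norm_num))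
        refine h3.congr fun x => ?_
        rw [neg_mul]
        norm_cast
      have h4 : Tendsto (fun n : ℕ => (2 * n : ℝ) ^ (1 / 3 : ℝ)) atTop atTop :=
        (tendsto_rpow_atTop (by norm_num)).comp
          (tendsto_natCast_atTop_atTop.const_mul_atTop (by norm_num))
      have h5 := (h2.comp h4).const_mul (8 * Real.pi)
      rw [mul_zero] at h5
      filter_upwards [h5.eventually (gt_mem_nhds zero_lt_one), eventually_ge_atTop 1] with n h6 hn
      have hn0 : (0 : ℝ) < n := by exact_mod_cast hn
      have h7 : ((2 * n : ℝ) ^ (1 / 3 : ℝ)) ^ 3 = 2 * n := by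
        rw [← Real.rpow_natCast, ← Real.rpow_mul (by positivity)]
        norm_num
      have h8 : (n * ((2 * n : ℝ) ^ (-(1 / 3) : ℝ)) ^ 2 / 20) =
          1 / 40 * (2 * n : ℝ) ^ (1 / 3 : ℝ) := by
        rw [Real.rpow_neg (by positivity)]
        have h9 : 0 < (2 * n : ℝ) ^ (1 / 3 : ℝ) := by positivity
        set y := (2 * n : ℝ) ^ (1 / 3 : ℝ)
        have : (n : ℝ) = y ^ 3 / 2 := by linarith
        rw [this]
        field_simp
        norm_num
      simp only [Function.comp] at h6
      rw [h7] at h6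
      rw [h8, le_div_iff₀ (by positivity)]
      linarith
    filter_upwards [hμ, hu, hl h1] with n hn hun h2
    have hn1 : (1 : ℝ) ≤ n := by exact_mod_cast hn.one_le
    have h7 : ((2 * n : ℝ) ^ (-(1 / 3) : ℝ)) ^ 3 = (2 * n : ℝ)⁻¹ := by
      rw [← Real.rpow_natCast, ← Real.rpow_mul (by positivity), ← Real.rpow_neg_one]
      norm_num
    have h3 := hn.saddleIntegral_ge hun.1 hun.2 (δ := (2 * n : ℝ) ^ (-(1 / 3) : ℝ))
      (by rw [h7, mul_inv_cancel₀ (by positivity)])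
      (by
        rw [one_div, ← Real.rpow_neg_one]
        exact Real.rpow_le_rpow_of_exponent_le (by linarith) (by norm_num))
    have h4 : 1 / (4 * n : ℝ) = 1 / (8 * n) + 1 / (8 * n) := by field_simp; norm_num
    linarith
  have hlogJ : Tendsto (fun n : ℕ => Real.log (saddleIntegral (μ n) n (u n)) / n) l (𝓝 0) := by
    have h2 : Tendsto (fun n : ℕ => Real.log n / (n : ℝ)) atTop (𝓝 0) :=
      (Real.isLittleO_log_id_atTop.tendsto_div_nhds_zero).comp tendsto_natCast_atTop_atTop
    have h3 : ∀ c : ℝ, Tendsto (fun n : ℕ => c / (n : ℝ)) atTop (𝓝 0) := fun c =>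
      tendsto_const_nhds.div_atTop tendsto_natCast_atTop_atTop
    have hlow : Tendsto (fun n : ℕ => -(Real.log 8 / (n : ℝ)) - Real.log n / (n : ℝ)) l (𝓝 0) := by
      have := ((h3 (Real.log 8)).neg.sub h2).mono_left hl
      simpa using this
    refine tendsto_of_tendsto_of_tendsto_of_le_of_le' hlow
      ((h3 (Real.log (2 * Real.pi))).mono_left hl) ?_ ?_
    · filter_upwards [hμ, hJ] with n hn h1
      have hn0 : (0 : ℝ) < n := by exact_mod_cast hn.one_le
      have h4 := Real.log_le_log (by positivity) h1
      rw [one_div, Real.log_inv, Real.log_mul (by norm_num) hn0.ne'] at h4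
      rw [← neg_div, ← sub_div]
      gcongr
      linarith
    · filter_upwards [hμ, hu, hJ] with n hn hun h1
      have hn0 : (0 : ℝ) < n := by exact_mod_cast hn.one_le
      gcongr
      · exact lt_of_lt_of_le (by positivity) h1
      · exact hn.saddleIntegral_le hun.1
  have h2pi : Tendsto (fun n : ℕ => Real.log (2 * Real.pi) / (n : ℝ)) l (𝓝 0) :=
    (tendsto_const_nhds.div_atTop tendsto_natCast_atTop_atTop).mono_left hl
  have hmain := ((((tendsto_log_factorial_div.mono_left hl).sub h2pi).add huP).sub hlogu).add hlogJ
  have hval : -1 - 0 + P - Real.log t + 0 = P - 1 - Real.log t := by ring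
  rw [hval] at hmain
  refine hmain.congr' ?_
  filter_upwards [hμ, hu, hJ, hZ] with n hn hun h1 hz
  have hn0 : (0 : ℝ) < n := by exact_mod_cast hn.one_le
  have hu0 : 0 < u n := by linarith [hun.1.1]
  have hJ0 : 0 < saddleIntegral (μ n) n (u n) := lt_of_lt_of_le (by positivity) h1
  have h2 := eq_saddleIntegral hz hu0
  have h3 : Z n = n ! / (n : ℝ) ^ n / (2 * Real.pi) *
      (Real.exp (n * truncPhiReal (μ n) n (u n)) / u n ^ n * saddleIntegral (μ n) n (u n)) := by
    rw [eq_comm, div_right_comm, div_mul_eq_mul_div, ← h2]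
    field_simp
  have hf : (0 : ℝ) < n ! / (n : ℝ) ^ n := by positivity
  have hc : 0 < 2 * Real.pi := by positivity
  generalize 2 * Real.pi = c at h3 hc ⊢
  rw [h3, Real.log_mul (by positivity) (by positivity), Real.log_div hf.ne' (by positivity),
    Real.log_mul (by positivity) hJ0.ne', Real.log_div (Real.exp_ne_zero _) (pow_pos hu0 n).ne',
    Real.log_exp, Real.log_pow (x := u n)]
  simp only [Function.comp]
  field_simp
  ring

end Saddle

/-! ### Chords -/

section Chords

theorem measurable_chordSign : Measurable fun p : Chord × Chord => chordSign p.1 p.2 := by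
  unfold chordSign
  refine Measurable.ite ?_ measurable_const measurable_const
  have h : ∀ f g : Chord × Chord → unitInterval, Measurable f → Measurable g →
      MeasurableSet {p | f p < g p} := fun f g hf hg => measurableSet_lt hf hg
  refine MeasurableSet.union ?_ ?_
  · exact (h _ _ (by fun_prop) (by fun_prop)).inter
      ((h _ _ (by fun_prop) (by fun_prop)).inter (h _ _ (by fun_prop) (by fun_prop)))
  · exact (h _ _ (by fun_prop) (by fun_prop)).inter
      ((h _ _ (by fun_prop) (by fun_prop)).inter (h _ _ (by fun_prop) (by fun_prop)))

theorem Measurable.chordSign {α : Type*} [MeasurableSpace α] {f g : α → Chord}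
    (hf : Measurable f) (hg : Measurable g) : Measurable fun a => chordSign (f a) (g a) :=
  measurable_chordSign.comp (hf.prodMk hg)

theorem abs_chordSign (x y : Chord) : |chordSign x y| = 1 := by
  unfold chordSign
  split_ifs <;> simp

theorem abs_chordPairSign {d : ℕ} (y : Fin d → Chord) : |chordPairSign y| = 1 := by
  simp only [chordPairSign, Finset.abs_prod, abs_chordSign, Finset.prod_const_one]

theorem measurable_chordPairSign (d : ℕ) :
    Measurable (chordPairSign : (Fin d → Chord) → ℝ) := by
  unfold chordPairSign
  refine Finset.measurable_prod _ fun i _ => Finset.measurable_prod _ fun j _ => ?_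
  exact (measurable_pi_apply i).chordSign (measurable_pi_apply j)

theorem volume_unitInterval_singleton (a : unitInterval) :
    (volume : Measure unitInterval) {a} = 0 := by
  rw [unitInterval.volume_apply, Set.image_singleton, Real.volume_singleton]

theorem ae_chordLaw_ne (a : unitInterval) : ∀ᵐ y ∂chordLaw, y.1 ≠ a ∧ y.2 ≠ a := by
  have h1 : ∀ᵐ u : unitInterval × unitInterval ∂(volume.prod volume), u.1 ≠ a := by
    have : ∀ᵐ u : unitInterval, u ≠ a := by
      rw [ae_iff]
      simp
    exact Measure.quasiMeasurePreserving_fst.ae this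
  have h2 : ∀ᵐ u : unitInterval × unitInterval ∂(volume.prod volume), u.2 ≠ a := by
    have : ∀ᵐ u : unitInterval, u ≠ a := by
      rw [ae_iff]
      simp
    exact Measure.quasiMeasurePreserving_snd.ae this
  rw [chordLaw, ae_map_iff (by fun_prop)]
  · filter_upwards [h1, h2] with u hu1 hu2
    constructor
    · rcases min_choice u.1 u.2 with h | h <;> rw [h] <;> assumption
    · rcases max_choice u.1 u.2 with h | h <;> rw [h] <;> assumption
  · exact ((measurableSet_singleton a).compl.preimage measurable_fst).inter
      ((measurableSet_singleton a).compl.preimage measurable_snd)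

theorem eventually_lt_iff {α : Type*} [TopologicalSpace α] {f : α → unitInterval} {a : α}
    {c : unitInterval} (hf : ContinuousAt f a) (h : f a ≠ c) :
    ∀ᶠ b in 𝓝 a, (f b < c ↔ f a < c) ∧ (c < f b ↔ c < f a) := by
  rcases lt_or_gt_of_ne h with h | h
  · filter_upwards [hf.eventually (gt_mem_nhds h)] with b hb
    exact ⟨iff_of_true hb h, iff_of_false hb.not_gt h.not_gt⟩
  · filter_upwards [hf.eventually (lt_mem_nhds h)] with b hb
    exact ⟨iff_of_false hb.not_gt h.not_gt, iff_of_true hb h⟩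

/-- In `x` the sign can jump only where an endpoint of `x` meets an endpoint of `y`, a null event in
`y`. Hence integrating over `y` produces functions continuous in `x`. -/
theorem ae_continuousAt_chordSign (x : Chord) :
    ∀ᵐ y ∂chordLaw, ContinuousAt (fun x' => chordSign x' y) x := by
  filter_upwards [ae_chordLaw_ne x.1, ae_chordLaw_ne x.2] with y h1 h2
  have key : ∀ᶠ x' in 𝓝 x, chordSign x' y = chordSign x y := by
    filter_upwards [eventually_lt_iff (continuous_fst.continuousAt (x := x)) h1.1.symm,
      eventually_lt_iff (continuous_fst.continuousAt (x := x)) h1.2.symm,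
      eventually_lt_iff (continuous_snd.continuousAt (x := x)) h2.1.symm,
      eventually_lt_iff (continuous_snd.continuousAt (x := x)) h2.2.symm] with x' k1 k2 k3 k4
    simp only [chordSign, k1, k2, k3, k4]
  exact (continuousAt_const (y := chordSign x y)).congr (key.mono fun _ h => h.symm)

end Chords

/-! ### The Chord-Cavity-Generator equation -/

section Cavity

theorem norm_prod_sub_prod_le' {ι : Type*} (s : Finset ι) (a b : ι → ℂ) {δ : ℝ}
    (ha : ∀ i ∈ s, ‖a i‖ ≤ 1) (hb : ∀ i ∈ s, ‖b i‖ ≤ 1) (hab : ∀ i ∈ s, ‖a i - b i‖ ≤ δ) :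
    ‖∏ i ∈ s, a i - ∏ i ∈ s, b i‖ ≤ #s * δ := by
  classical
  induction s using Finset.induction_on with
  | empty => simp
  | insert i s hi ih =>
    rw [Finset.prod_insert hi, Finset.prod_insert hi, Finset.card_insert_of_notMem hi]
    have h1 := ih (fun j hj => ha j (Finset.mem_insert_of_mem hj))
      (fun j hj => hb j (Finset.mem_insert_of_mem hj))
      (fun j hj => hab j (Finset.mem_insert_of_mem hj))
    have h2 : ‖∏ j ∈ s, b j‖ ≤ 1 := by
      rw [norm_prod]
      exact Finset.prod_le_one (fun _ _ => norm_nonneg _)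
        fun j hj => hb j (Finset.mem_insert_of_mem hj)
    have h3 := ha i (Finset.mem_insert_self i s)
    have h4 := hab i (Finset.mem_insert_self i s)
    have h5 : a i * ∏ j ∈ s, a j - b i * ∏ j ∈ s, b j =
        a i * (∏ j ∈ s, a j - ∏ j ∈ s, b j) + (a i - b i) * ∏ j ∈ s, b j := by ring
    rw [h5]
    refine (norm_add_le _ _).trans ?_
    rw [norm_mul, norm_mul]
    push_cast
    have h6 := norm_nonneg (a i - b i)
    have h7 := norm_nonneg (∏ j ∈ s, a j - ∏ j ∈ s, b j)
    nlinarith [norm_nonneg (∏ j ∈ s, b j), norm_nonneg (a i)]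

/-- `h ^ (q-1) / (q-1)!`. -/
def cavityFactor (q : ℕ) (w : ℂ) : ℂ := w ^ (q - 1) / ((q - 1)! : ℂ)

theorem norm_cavityFactor_le (q : ℕ) {w : ℂ} (hw : ‖w‖ ≤ 1) : ‖cavityFactor q w‖ ≤ 1 := by
  rw [cavityFactor, norm_div, norm_pow, Complex.norm_natCast]
  have h1 : (1 : ℝ) ≤ (q - 1)! := by exact_mod_cast (q - 1).factorial_pos
  exact (div_le_one (by linarith)).2 ((pow_le_one₀ (norm_nonneg w) hw).trans h1)

/-- The power has Lipschitz constant `q - 1` on the unit disc, and `q - 1 ≤ (q - 1)!`. -/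
theorem norm_cavityFactor_sub_le (q : ℕ) {w w' : ℂ} (hw : ‖w‖ ≤ 1) (hw' : ‖w'‖ ≤ 1) :
    ‖cavityFactor q w - cavityFactor q w'‖ ≤ ‖w - w'‖ := by
  rw [cavityFactor, cavityFactor, ← sub_div, norm_div, Complex.norm_natCast]
  have h1 : (0 : ℝ) < (q - 1)! := by exact_mod_cast (q - 1).factorial_pos
  have h2 : ((q - 1 : ℕ) : ℝ) ≤ (q - 1)! := by exact_mod_cast (q - 1).self_le_factorial
  have h3 := norm_prod_sub_prod_le' (Finset.range (q - 1)) (fun _ => w) (fun _ => w')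
    (fun _ _ => hw) (fun _ _ => hw') fun _ _ => le_rfl
  simp only [Finset.prod_const, Finset.card_range] at h3
  rw [div_le_iff₀ h1, mul_comm]
  exact h3.trans (mul_le_mul_of_nonneg_right h2 (norm_nonneg _))

/-- The law of `d` independent chords. -/
abbrev chordsLaw (ι : Type*) [Fintype ι] : Measure (ι → Chord) := Measure.pi fun _ => chordLaw

/-- The contribution of `d` neighbours to the cavity equation, with weight `k`. -/
def cavityTerm (q d : ℕ) (k : Chord → ℝ) (h : Chord → ℂ) : ℂ :=
  ∫ y : Fin d → Chord, (∏ i, (k (y i) : ℂ) * cavityFactor q (h (y i))) *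
    (chordPairSign y : ℂ) ∂chordsLaw (Fin d)

/-- The sum over the number of neighbours. -/
def cavitySum (q : ℕ) (k : Chord → ℝ) (h : Chord → ℂ) : ℂ :=
  ∑' d : ℕ, 1 / ((d + 1)! : ℂ) * cavityTerm q (d + 1) k h

variable {q d : ℕ} {k : Chord → ℝ} {h h' : Chord → ℂ}

theorem norm_cavityProd_le (hk : ∀ x, |k x| ≤ 1) (hh : ∀ x, ‖h x‖ ≤ 1) (y : Fin d → Chord) :
    ‖(∏ i, (k (y i) : ℂ) * cavityFactor q (h (y i))) * (chordPairSign y : ℂ)‖ ≤ 1 := by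
  rw [norm_mul, Complex.norm_real, Real.norm_eq_abs, abs_chordPairSign, mul_one, norm_prod]
  refine Finset.prod_le_one (fun _ _ => norm_nonneg _) fun i _ => ?_
  rw [norm_mul, Complex.norm_real]
  exact mul_le_one₀ (hk _) (norm_nonneg _) (norm_cavityFactor_le q (hh _))

theorem measurable_cavityProd (hk : Measurable k) (hh : Measurable h) :
    Measurable fun y : Fin d → Chord =>
      (∏ i, (k (y i) : ℂ) * cavityFactor q (h (y i))) * (chordPairSign y : ℂ) := by
  unfold cavityFactor
  have := measurable_chordPairSign d
  fun_prop

theorem integrable_cavityProd (hk : Measurable k) (hh : Measurable h) (hk1 : ∀ x, |k x| ≤ 1)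
    (hh1 : ∀ x, ‖h x‖ ≤ 1) : Integrable (fun y : Fin d → Chord =>
      (∏ i, (k (y i) : ℂ) * cavityFactor q (h (y i))) * (chordPairSign y : ℂ))
      (chordsLaw (Fin d)) :=
  Integrable.of_bound (measurable_cavityProd hk hh).aestronglyMeasurable 1
    (Eventually.of_forall (norm_cavityProd_le hk1 hh1))

theorem norm_cavityTerm_le (hk1 : ∀ x, |k x| ≤ 1) (hh1 : ∀ x, ‖h x‖ ≤ 1) :
    ‖cavityTerm q d k h‖ ≤ 1 := by
  refine (norm_integral_le_of_norm_le_const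
    (Eventually.of_forall (norm_cavityProd_le hk1 hh1))).trans ?_
  simp

theorem norm_cavityTerm_sub_le (hk : Measurable k) (hk1 : ∀ x, |k x| ≤ 1) (hh : Measurable h)
    (hh1 : ∀ x, ‖h x‖ ≤ 1) (hh' : Measurable h') (hh1' : ∀ x, ‖h' x‖ ≤ 1) {δ : ℝ}
    (hδ : ∀ x, ‖h x - h' x‖ ≤ δ) : ‖cavityTerm q d k h - cavityTerm q d k h'‖ ≤ d * δ := by
  rw [cavityTerm, cavityTerm, ← integral_sub (integrable_cavityProd hk hh hk1 hh1)
    (integrable_cavityProd hk hh' hk1 hh1')]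
  refine (norm_integral_le_of_norm_le_const (C := d * δ) (Eventually.of_forall fun y => ?_)).trans
    (by simp)
  rw [← sub_mul, norm_mul, Complex.norm_real, Real.norm_eq_abs, abs_chordPairSign, mul_one]
  have hb : ∀ {h : Chord → ℂ}, (∀ x, ‖h x‖ ≤ 1) → ∀ i ∈ (univ : Finset (Fin d)),
      ‖(k (y i) : ℂ) * cavityFactor q (h (y i))‖ ≤ 1 := fun hh i _ => by
    rw [norm_mul, Complex.norm_real]
    exact mul_le_one₀ (hk1 _) (norm_nonneg _) (norm_cavityFactor_le q (hh _))
  refine (norm_prod_sub_prod_le' univ _ _ (hb hh1) (hb hh1') (δ := δ) fun i _ => ?_).trans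
    (by simp)
  rw [← mul_sub, norm_mul, Complex.norm_real]
  have h1 := (norm_cavityFactor_sub_le q (hh1 (y i)) (hh1' (y i))).trans (hδ (y i))
  have h2 := mul_le_mul (hk1 (y i)) h1 (norm_nonneg _) zero_le_one
  rwa [one_mul] at h2

theorem hasSum_one_div_factorial : HasSum (fun d : ℕ => 1 / (d ! : ℝ)) (Real.exp 1) := by
  have := NormedSpace.expSeries_div_hasSum_exp (1 : ℝ)
  rw [← Real.exp_eq_exp_ℝ] at this
  simpa using this

theorem hasSum_one_div_factorial_succ :
    HasSum (fun d : ℕ => 1 / ((d + 1)! : ℝ)) (Real.exp 1 - 1) := by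
  have := (hasSum_nat_add_iff' 1).2 hasSum_one_div_factorial
  simpa using this

theorem norm_one_div_factorial (d : ℕ) : ‖(1 / (d ! : ℂ))‖ = 1 / (d ! : ℝ) := by
  rw [norm_div, norm_one, Complex.norm_natCast]

theorem norm_cavitySummand_le (hk1 : ∀ x, |k x| ≤ 1) (hh1 : ∀ x, ‖h x‖ ≤ 1) (d : ℕ) :
    ‖1 / ((d + 1)! : ℂ) * cavityTerm q (d + 1) k h‖ ≤ 1 / ((d + 1)! : ℝ) := by
  rw [norm_mul, norm_one_div_factorial]
  exact mul_le_of_le_one_right (by positivity) (norm_cavityTerm_le hk1 hh1)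

theorem summable_cavitySum (hk1 : ∀ x, |k x| ≤ 1) (hh1 : ∀ x, ‖h x‖ ≤ 1) :
    Summable fun d : ℕ => 1 / ((d + 1)! : ℂ) * cavityTerm q (d + 1) k h :=
  Summable.of_norm_bounded hasSum_one_div_factorial_succ.summable (norm_cavitySummand_le hk1 hh1)

theorem norm_cavitySum_le (hk1 : ∀ x, |k x| ≤ 1) (hh1 : ∀ x, ‖h x‖ ≤ 1) :
    ‖cavitySum q k h‖ ≤ Real.exp 1 - 1 :=
  tsum_of_norm_bounded hasSum_one_div_factorial_succ (norm_cavitySummand_le hk1 hh1)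

/-- The term with `d + 1` neighbours has Lipschitz constant `d + 1`, and `(d + 1) / (d + 1)! = 1 /
d!` sums to `e`. -/
theorem norm_cavitySum_sub_le (hk : Measurable k) (hk1 : ∀ x, |k x| ≤ 1) (hh : Measurable h)
    (hh1 : ∀ x, ‖h x‖ ≤ 1) (hh' : Measurable h') (hh1' : ∀ x, ‖h' x‖ ≤ 1) {δ : ℝ}
    (hδ : ∀ x, ‖h x - h' x‖ ≤ δ) : ‖cavitySum q k h - cavitySum q k h'‖ ≤ Real.exp 1 * δ := by
  rw [cavitySum, cavitySum, ← (summable_cavitySum hk1 hh1).tsum_sub (summable_cavitySum hk1 hh1')]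
  refine tsum_of_norm_bounded (hasSum_one_div_factorial.mul_right δ) fun d => ?_
  rw [← mul_sub, norm_mul, norm_one_div_factorial]
  refine (mul_le_mul_of_nonneg_left (norm_cavityTerm_sub_le hk hk1 hh hh1 hh' hh1' hδ)
    (by positivity)).trans (le_of_eq ?_)
  rw [Nat.factorial_succ]
  push_cast
  field_simp

/-- The reason for the radius `e⁻²`: multiplied by the Lipschitz constant `e` of `cavitySum` it
leaves the contraction factor `1 / e`. -/
theorem norm_disc_mul_exp_le (z : CCGDisc) : ‖(z : ℂ)‖ * Real.exp 1 ≤ 1 / Real.exp 1 := by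
  have h := mem_closedBall_zero_iff.1 z.2
  have he := Real.exp_pos 1
  calc ‖(z : ℂ)‖ * Real.exp 1 ≤ 1 / Real.exp 1 ^ 2 * Real.exp 1 := by gcongr
    _ = _ := by field_simp

theorem one_div_exp_one_lt : 1 / Real.exp 1 < 1 := by
  rw [div_lt_one (Real.exp_pos 1)]
  exact Real.one_lt_exp_iff.2 one_pos

/-- `h` solves the cavity equation at `z`. -/
structure IsCavitySolution (q : ℕ) (z : ℂ) (h : Chord → ℂ) : Prop where
  measurable : Measurable h
  norm_le : ∀ x, ‖h x‖ ≤ 1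
  fixedPoint : ∀ x, h x = z + z * cavitySum q (chordSign x) h

theorem measurable_chordSign_right (x : Chord) : Measurable (chordSign x) :=
  (measurable_const (a := x)).chordSign measurable_id

/-- Iterating the contraction at one fixed `z`, for solutions that are merely measurable in `x`. In
this form it applies to the tree series, which is considered only at single points `z` and without
continuity. -/
theorem IsCavitySolution.unique {z : CCGDisc} (hh : IsCavitySolution q z h)
    (hh' : IsCavitySolution q z h') : h = h' := by
  have key : ∀ n : ℕ, ∀ x, ‖h x - h' x‖ ≤ (1 / Real.exp 1) ^ n * 2 := fun n => by
    induction n with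
    | zero =>
      intro x
      refine (norm_sub_le _ _).trans ?_
      linarith [hh.norm_le x, hh'.norm_le x]
    | succ n ih =>
      intro x
      rw [hh.fixedPoint x, hh'.fixedPoint x, add_sub_add_left_eq_sub, ← mul_sub, norm_mul]
      have h1 := norm_cavitySum_sub_le (q := q) (measurable_chordSign_right x)
        (fun y => (abs_chordSign x y).le) hh.measurable hh.norm_le hh'.measurable hh'.norm_le ih
      have h2 := mul_le_mul_of_nonneg_left h1 (norm_nonneg (z : ℂ))
      refine h2.trans ?_
      rw [← mul_assoc]
      exact (mul_le_mul_of_nonneg_right (norm_disc_mul_exp_le z) (by positivity)).trans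
        (le_of_eq (by ring))
  funext x
  have h1 : Tendsto (fun n : ℕ => (1 / Real.exp 1) ^ n * 2) atTop (𝓝 0) := by
    have := (tendsto_pow_atTop_nhds_zero_of_lt_one (by positivity) one_div_exp_one_lt).mul_const 2
    simpa using this
  have h2 := ge_of_tendsto' h1 fun n => key n x
  exact sub_eq_zero.1 (norm_le_zero_iff.1 h2)

theorem isCCG_iff {H : C(CCGDisc × Chord, ℂ)} :
    IsCCG q H ↔ ∀ z, IsCavitySolution q (z : CCGDisc) fun x => H (z, x) := by
  constructor
  · exact fun h z => ⟨by fun_prop, fun x => h.norm_le _, fun x => h.fixedPoint z x⟩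
  · exact fun h => ⟨fun p => (h p.1).norm_le p.2, fun z x => (h z).fixedPoint x⟩

theorem isCCG_unique {H G : C(CCGDisc × Chord, ℂ)} (hH : IsCCG q H) (hG : IsCCG q G) : G = H := by
  ext ⟨z, x⟩
  exact congrFun ((isCCG_iff.1 hG z).unique (isCCG_iff.1 hH z)) x

/-- Dominated convergence: the integrand is bounded by `1`, and for almost all `y` it is continuous
at the given point although `chordSign` is not. -/
theorem continuous_cavityTerm (q d : ℕ) {H : C(CCGDisc × Chord, ℂ)} (hH : ∀ p, ‖H p‖ ≤ 1) :
    Continuous fun p : CCGDisc × Chord =>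
      cavityTerm q d (chordSign p.2) fun y => H (p.1, y) := by
  rw [continuous_iff_continuousAt]
  intro p
  have hm : ∀ z : CCGDisc, Measurable fun y => H (z, y) := fun z => by fun_prop
  unfold cavityTerm
  refine continuousAt_of_dominated (bound := fun _ => 1) ?_ ?_ (integrable_const 1) ?_
  · exact Eventually.of_forall fun p => (measurable_cavityProd (k := chordSign p.2)
      (h := fun y => H (p.1, y)) (measurable_chordSign_right p.2) (hm p.1)).aestronglyMeasurable
  · exact Eventually.of_forall fun p => Eventually.of_forall
      (norm_cavityProd_le (k := chordSign p.2) (h := fun y => H (p.1, y))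
        (fun y => (abs_chordSign p.2 y).le) fun y => hH _)
  · have h1 : ∀ᵐ y ∂chordsLaw (Fin d), ∀ i, ContinuousAt (fun x' => chordSign x' (y i)) p.2 :=
      eventually_all.2 fun i =>
        (Measure.tendsto_eval_ae_ae (μ := fun _ : Fin d => chordLaw) (i := i)).eventually
          (ae_continuousAt_chordSign p.2)
    filter_upwards [h1] with y hy
    refine ContinuousAt.mul ?_ continuousAt_const
    refine tendsto_finsetProd _ fun i _ => ContinuousAt.mul ?_ ?_
    · exact Complex.continuous_ofReal.continuousAt.comp
        (ContinuousAt.comp (f := Prod.snd) (x := p) (hy i) continuous_snd.continuousAt)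
    · unfold cavityFactor
      fun_prop

/-- The right hand side of the cavity equation. -/
def cavityMap (q : ℕ) (H : Metric.closedBall (0 : C(CCGDisc × Chord, ℂ)) 1) :
    Metric.closedBall (0 : C(CCGDisc × Chord, ℂ)) 1 :=
  have hH : ∀ p, ‖H.1 p‖ ≤ 1 :=
    (ContinuousMap.norm_le _ zero_le_one).1 (mem_closedBall_zero_iff.1 H.2)
  ⟨⟨fun p => p.1 + p.1 * cavitySum q (chordSign p.2) fun y => H.1 (p.1, y), by
      have h1 : Continuous fun p : CCGDisc × Chord =>
          cavitySum q (chordSign p.2) fun y => H.1 (p.1, y) :=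
        continuous_tsum (fun d => continuous_const.mul (continuous_cavityTerm q (d + 1) hH))
          hasSum_one_div_factorial_succ.summable fun d p =>
            norm_cavitySummand_le (fun y => (abs_chordSign p.2 y).le) (fun y => hH _) d
      fun_prop⟩, by
    rw [mem_closedBall_zero_iff, ContinuousMap.norm_le _ zero_le_one]
    intro p
    -- The sum starts at one neighbour, so the image is bounded by `|z| (1 + (e - 1)) = |z| e ≤ 1 /
    -- e`.
    have h1 := norm_cavitySum_le (q := q) (fun y => (abs_chordSign p.2 y).le)
      (fun y => hH (p.1, y))
    have h2 := norm_disc_mul_exp_le p.1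
    have h3 := one_div_exp_one_lt
    simp only [ContinuousMap.coe_mk]
    refine (norm_add_le _ _).trans ?_
    rw [norm_mul]
    have h4 := mul_le_mul_of_nonneg_left h1 (norm_nonneg (p.1 : ℂ))
    linarith⟩

theorem contractingWith_cavityMap (q : ℕ) :
    ContractingWith (1 / Real.exp 1).toNNReal (cavityMap q) := by
  refine ⟨Real.toNNReal_lt_one.2 one_div_exp_one_lt, LipschitzWith.of_dist_le_mul fun H G => ?_⟩
  have hb : ∀ (H : Metric.closedBall (0 : C(CCGDisc × Chord, ℂ)) 1) p, ‖H.1 p‖ ≤ 1 := fun H =>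
    (ContinuousMap.norm_le _ zero_le_one).1 (mem_closedBall_zero_iff.1 H.2)
  rw [Real.coe_toNNReal _ (by positivity), Subtype.dist_eq,
    ContinuousMap.dist_le (mul_nonneg (by positivity) dist_nonneg)]
  intro p
  have hδ : ∀ y, ‖H.1 (p.1, y) - G.1 (p.1, y)‖ ≤ dist H G := fun y => by
    rw [← dist_eq_norm]
    exact ContinuousMap.dist_apply_le_dist _
  have h1 := norm_cavitySum_sub_le (q := q) (measurable_chordSign_right p.2)
    (fun y => (abs_chordSign p.2 y).le) (by fun_prop) (fun y => hb H (p.1, y)) (by fun_prop)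
    (fun y => hb G (p.1, y)) hδ
  have h2 := mul_le_mul_of_nonneg_left h1 (norm_nonneg (p.1 : ℂ))
  rw [dist_eq_norm]
  simp only [cavityMap, ContinuousMap.coe_mk]
  rw [add_sub_add_left_eq_sub, ← mul_sub, norm_mul]
  refine h2.trans ?_
  rw [← mul_assoc]
  exact mul_le_mul_of_nonneg_right (norm_disc_mul_exp_le p.1) dist_nonneg

theorem exists_isCCG (q : ℕ) : ∃ H : C(CCGDisc × Chord, ℂ), IsCCG q H := by
  have : Nonempty (Metric.closedBall (0 : C(CCGDisc × Chord, ℂ)) 1) :=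
    ⟨⟨0, Metric.mem_closedBall_self zero_le_one⟩⟩
  have : CompleteSpace (Metric.closedBall (0 : C(CCGDisc × Chord, ℂ)) 1) :=
    Metric.isClosed_closedBall.completeSpace_coe
  have h := (contractingWith_cavityMap q).fixedPoint_isFixedPt
  set H := ContractingWith.fixedPoint (cavityMap q) (contractingWith_cavityMap q)
  refine ⟨H.1, (ContinuousMap.norm_le _ zero_le_one).1 (mem_closedBall_zero_iff.1 H.2),
    fun z x => ?_⟩
  conv_lhs => rw [← h]
  rfl

/-- `𝓡` is the case of weight `1` in place of the crossing signs with `x`, so one identity for tree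
series serves both `H` and `𝓡`. -/
theorem ccgR_eq (q : ℕ) (H : C(CCGDisc × Chord, ℂ)) (z : CCGDisc) :
    ccgR q H z = z + z * cavitySum q 1 fun x => H (z, x) := by
  simp [ccgR, cavitySum, cavityTerm, cavityFactor]

end Cavity

/-! ### Independent chords -/

section ChordsLaw

variable {ι κ : Type*} [Fintype ι] [Fintype κ]

theorem measurePreserving_pi_comp {Ω : Type*} [MeasurableSpace Ω] (μ : Measure Ω)
    [IsProbabilityMeasure μ] {f : ι → κ} (hf : Function.Injective f) :
    MeasurePreserving (fun X : κ → Ω => X ∘ f) (Measure.pi fun _ => μ) (Measure.pi fun _ => μ) := by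
  have h1 : ProbabilityTheory.iIndepFun (fun (i : κ) (X : κ → Ω) => X i) (Measure.pi fun _ => μ) :=
    ProbabilityTheory.iIndepFun_pi (X := fun _ => id) fun _ => aemeasurable_id
  have h2 := h1.precomp hf
  rw [ProbabilityTheory.iIndepFun_iff_map_fun_eq_pi_map
    fun i => (measurable_pi_apply _).aemeasurable] at h2
  refine ⟨by fun_prop, h2.trans ?_⟩
  congr 1
  funext i
  exact (measurePreserving_eval (fun _ => μ) (f i)).map_eq

theorem integral_comp_injective {f : ι → κ} (hf : Function.Injective f) {F : (ι → Chord) → ℝ}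
    (hF : Measurable F) :
    ∫ X, F (X ∘ f) ∂chordsLaw κ = ∫ X, F X ∂chordsLaw ι := by
  have h : MeasurePreserving (fun X : κ → Chord => X ∘ f) (chordsLaw κ) (chordsLaw ι) :=
    measurePreserving_pi_comp chordLaw hf
  rw [← h.map_eq, integral_map h.measurable.aemeasurable hF.aestronglyMeasurable]

variable [DecidableEq κ]

/-- Resampling one of the independent chords does not change the joint law; this is the form in
which the chord of a removed edge is integrated separately. -/
theorem measurePreserving_update (k : κ) :
    MeasurePreserving (fun p : Chord × (κ → Chord) => Function.update p.2 k p.1)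
      (chordLaw.prod (chordsLaw κ)) (chordsLaw κ) := by
  have hm : Measurable fun p : Chord × (κ → Chord) => Function.update p.2 k p.1 := by
    refine measurable_pi_lambda _ fun i => ?_
    by_cases hi : i = k
    · subst hi
      simpa using measurable_fst
    · simp only [Function.update_of_ne hi]
      fun_prop
  refine ⟨hm, (Measure.pi_eq fun s hs => ?_).symm⟩
  rw [Measure.map_apply hm (MeasurableSet.univ_pi hs)]
  have h : (fun p : Chord × (κ → Chord) => Function.update p.2 k p.1) ⁻¹' Set.univ.pi s =
      s k ×ˢ Set.univ.pi (Function.update s k Set.univ) := by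
    ext ⟨y, X⟩
    simp only [Set.mem_preimage, Set.mem_pi, Set.mem_univ, true_imp_iff, Set.mem_prod]
    constructor
    · intro h
      refine ⟨by simpa using h k, fun i => ?_⟩
      by_cases hi : i = k
      · subst hi
        simp
      · simpa [hi] using h i
    · rintro ⟨h1, h2⟩ i
      by_cases hi : i = k
      · subst hi
        simpa using h1
      · simpa [hi] using h2 i
  rw [h, Measure.prod_prod, Measure.pi_pi, ← Finset.mul_prod_erase univ _ (mem_univ k),
    ← Finset.mul_prod_erase univ (fun i => chordLaw (s i)) (mem_univ k)]
  simp only [Function.update_self, measure_univ, one_mul]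
  congr 1
  exact Finset.prod_congr rfl fun i hi => by rw [Function.update_of_ne (Finset.ne_of_mem_erase hi)]

/-- Integrating out one of the chords first. -/
theorem integral_eq_integral_update (k : κ) {F : (κ → Chord) → ℝ} (hF : Measurable F) {C : ℝ}
    (hC : ∀ X, |F X| ≤ C) :
    ∫ X, F X ∂chordsLaw κ = ∫ y, ∫ X, F (Function.update X k y) ∂chordsLaw κ ∂chordLaw := by
  have h := measurePreserving_update k
  rw [← h.map_eq, integral_map h.measurable.aemeasurable hF.aestronglyMeasurable, h.map_eq,
    integral_prod]
  exact Integrable.of_bound (hF.comp h.measurable).aestronglyMeasurable C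
    (Eventually.of_forall fun _ => hC _)

theorem integral_mul_of_dependsOn {S T : Finset κ} (hST : Disjoint S T)
    {F G : (κ → Chord) → ℝ} (hF : Measurable F) (hG : Measurable G)
    (hFS : DependsOn F (S : Set κ)) (hGT : DependsOn G (T : Set κ)) :
    ∫ X, F X * G X ∂chordsLaw κ = (∫ X, F X ∂chordsLaw κ) * ∫ X, G X ∂chordsLaw κ := by
  have h1 : ProbabilityTheory.iIndepFun (fun (i : κ) (X : κ → Chord) => X i) (chordsLaw κ) :=
    ProbabilityTheory.iIndepFun_pi (X := fun _ => id) fun _ => aemeasurable_id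
  have h2 := h1.indepFun_finset S T hST fun i => measurable_pi_apply i
  -- The default chord outside `S` is irrelevant for functions that depend only on the coordinates
  -- in `S`.
  let ext : (S : Finset κ) → (S → Chord) → κ → Chord := fun S x i =>
    if h : i ∈ S then x ⟨i, h⟩ else (0, 0)
  have hext : ∀ S : Finset κ, Measurable (ext S) := fun S => by
    refine measurable_pi_lambda _ fun i => ?_
    by_cases hi : i ∈ S
    · simp only [ext, dif_pos hi]
      fun_prop
    · simp only [ext, dif_neg hi]
      fun_prop
  have hval : ∀ (S : Finset κ) (H : (κ → Chord) → ℝ), DependsOn H (S : Set κ) →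
      ∀ X : κ → Chord, H (ext S fun i : S => X i) = H X := fun S H hH X => by
    refine hH fun i hi => ?_
    simp only [ext, dif_pos (Finset.mem_coe.1 hi)]
  have h3 := h2.comp (hF.comp (hext S)) (hG.comp (hext T))
  have h4 := h3.integral_fun_mul_eq_mul_integral
    ((hF.comp (hext S)).comp (by fun_prop)).aestronglyMeasurable
    ((hG.comp (hext T)).comp (by fun_prop)).aestronglyMeasurable
  simp only [Function.comp_def, hval S F hFS, hval T G hGT] at h4
  exact h4

theorem integral_prod_of_dependsOn {J : Type*} (s : Finset J) {S : J → Finset κ}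
    (hS : ∀ i j, i ≠ j → Disjoint (S i) (S j)) {F : J → (κ → Chord) → ℝ}
    (hF : ∀ j, Measurable (F j)) (hFS : ∀ j, DependsOn (F j) (S j : Set κ)) :
    ∫ X, ∏ j ∈ s, F j X ∂chordsLaw κ = ∏ j ∈ s, ∫ X, F j X ∂chordsLaw κ := by
  classical
  induction s using Finset.induction_on with
  | empty => simp
  | insert i s hi ih =>
    simp only [Finset.prod_insert hi]
    rw [integral_mul_of_dependsOn (S := S i) (T := s.biUnion S) ?_ (hF i)
      (Finset.measurable_prod _ fun j _ => hF j) (hFS i) ?_, ih]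
    · rw [Finset.disjoint_biUnion_right]
      exact fun j hj => hS i j fun h => hi (h ▸ hj)
    · intro X Y hXY
      refine Finset.prod_congr rfl fun j hj => hFS j fun k hk => hXY k ?_
      simp only [Finset.coe_biUnion, Set.mem_iUnion]
      exact ⟨j, hj, hk⟩

end ChordsLaw

/-! ### Products over pairs -/

section PairProd

set_option linter.unusedSectionVars false

variable {α : Type*} [DecidableEq α]

/-- The product of a symmetric function over the unordered pairs of elements of `T`. -/
def pairProd (k : α → α → ℝ) (hk : ∀ a b, k a b = k b a) (T : Finset α) : ℝ :=
  ∏ p ∈ T.sym2, Sym2.lift ⟨k, hk⟩ p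

variable {k : α → α → ℝ} {hk : ∀ a b, k a b = k b a}

theorem pairProd_empty : pairProd k hk ∅ = 1 := by simp [pairProd]

/-- Unordered pairs include the diagonal, whence the factor `k a a`. For hyperedges of even size it
equals `1`. -/
theorem pairProd_insert {a : α} {T : Finset α} (ha : a ∉ T) :
    pairProd k hk (insert a T) = k a a * (∏ b ∈ T, k a b) * pairProd k hk T := by
  rw [pairProd, Finset.sym2_insert, Finset.prod_union, Finset.prod_image, Finset.prod_insert ha]
  · rfl
  · intro b _ b' _ h
    exact Sym2.congr_right.1 h
  · rw [Finset.disjoint_left]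
    intro p hp hp'
    obtain ⟨b, _, rfl⟩ := Finset.mem_image.1 hp
    exact ha (Finset.mk_mem_sym2_iff.1 hp').1

theorem pairProd_union {S T : Finset α} (hST : Disjoint S T)
    (h : ∀ a ∈ S, ∀ b ∈ T, k a b = 1) :
    pairProd k hk (S ∪ T) = pairProd k hk S * pairProd k hk T := by
  induction S using Finset.induction_on with
  | empty => simp [pairProd_empty]
  | insert a S ha ih =>
    have h1 := Finset.disjoint_insert_left.1 hST
    rw [Finset.insert_union, pairProd_insert (by simp [ha, h1.1]), pairProd_insert ha,
      Finset.prod_union h1.2, ih h1.2 fun b hb => h b (Finset.mem_insert_of_mem hb),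
      Finset.prod_eq_one (s := T) fun b hb => h a (Finset.mem_insert_self a S) b hb]
    ring

theorem pairProd_biUnion {J : Type*} [DecidableEq J] (s : Finset J) {T : J → Finset α}
    (hT : ∀ i j, i ≠ j → Disjoint (T i) (T j))
    (h : ∀ i j, i ≠ j → ∀ a ∈ T i, ∀ b ∈ T j, k a b = 1) :
    pairProd k hk (s.biUnion T) = ∏ j ∈ s, pairProd k hk (T j) := by
  induction s using Finset.induction_on with
  | empty => simp [pairProd_empty]
  | insert i s hi ih =>
    rw [Finset.biUnion_insert, Finset.prod_insert hi, pairProd_union, ih]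
    · rw [Finset.disjoint_biUnion_right]
      exact fun j hj => hT i j fun h => hi (h ▸ hj)
    · intro a ha b hb
      obtain ⟨j, hj, hb⟩ := Finset.mem_biUnion.1 hb
      exact h i j (fun h => hi (h ▸ hj)) a ha b hb

theorem pairProd_map {β : Type*} [DecidableEq β] {k' : β → β → ℝ} {hk' : ∀ a b, k' a b = k' b a}
    (u : β ↪ α) (h : ∀ a b, k (u a) (u b) = k' a b) (T : Finset β) :
    pairProd k hk (T.map u) = pairProd k' hk' T := by
  induction T using Finset.induction_on with
  | empty => simp [pairProd_empty]
  | insert a T ha ih =>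
    rw [Finset.map_insert, pairProd_insert (by simpa using ha), pairProd_insert ha, ih, h,
      Finset.prod_map]
    simp only [h]

theorem pairProd_congr {k' : α → α → ℝ} {hk' : ∀ a b, k' a b = k' b a} {T : Finset α}
    (h : ∀ a ∈ T, ∀ b ∈ T, k a b = k' a b) : pairProd k hk T = pairProd k' hk' T := by
  refine Finset.prod_congr rfl fun p hp => ?_
  induction p using Sym2.ind with
  | _ a b =>
    have := Finset.mk_mem_sym2_iff.1 hp
    exact h a this.1 b this.2

theorem abs_pairProd (h : ∀ a b, |k a b| = 1) (T : Finset α) : |pairProd k hk T| = 1 := by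
  rw [pairProd, Finset.abs_prod]
  refine Finset.prod_eq_one fun p _ => ?_
  induction p using Sym2.ind with
  | _ a b => exact h a b

end PairProd

/-! ### Weights of rooted hypertrees -/

section BranchWeight

variable {V : Type*} [DecidableEq V]

/-- The crossing sign of the chords of two hyperedges, if they share an odd number of nodes. -/
def oddSign (X : Finset V → Chord) (e f : Finset V) : ℝ :=
  if Odd #(e ∩ f) then chordSign (X e) (X f) else 1

theorem oddSign_comm (X : Finset V → Chord) (e f : Finset V) : oddSign X e f = oddSign X f e := by
  rw [oddSign, oddSign, Finset.inter_comm, chordSign_comm]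

theorem abs_oddSign (X : Finset V → Chord) (e f : Finset V) : |oddSign X e f| = 1 := by
  rw [oddSign]
  split_ifs
  · exact abs_chordSign _ _
  · exact abs_one

/-- The product of the weights of the edges at `a` and of the crossing signs. -/
def branchProd (κ : Chord → ℝ) (T : Finset (Finset V)) (a : V) (X : Finset V → Chord) : ℝ :=
  (∏ e ∈ T with a ∈ e, κ (X e)) * pairProd (oddSign X) (oddSign_comm X) T

theorem measurable_pairProd_oddSign (T : Finset (Finset V)) :
    Measurable fun X : Finset V → Chord => pairProd (oddSign X) (oddSign_comm X) T := by
  refine Finset.measurable_prod _ fun p _ => ?_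
  induction p using Sym2.ind with
  | _ e f =>
    simp only [Sym2.lift_mk, oddSign]
    split_ifs
    · exact (measurable_pi_apply e).chordSign (measurable_pi_apply f)
    · exact measurable_const

theorem measurable_branchProd {κ : Chord → ℝ} (hκ : Measurable κ) (T : Finset (Finset V)) (a : V) :
    Measurable (branchProd κ T a) := by
  have := measurable_pairProd_oddSign T
  unfold branchProd
  fun_prop

theorem abs_branchProd_le {κ : Chord → ℝ} (hκ : ∀ x, |κ x| ≤ 1) (T : Finset (Finset V)) (a : V)
    (X : Finset V → Chord) : |branchProd κ T a X| ≤ 1 := by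
  rw [branchProd, abs_mul, abs_pairProd (abs_oddSign X), mul_one, Finset.abs_prod]
  exact Finset.prod_le_one (fun _ _ => abs_nonneg _) fun e _ => hκ _

/-- All finite sets of nodes carry chords, so that all trees share one probability space. Only the
chords of the edges of `T` matter, which makes disjoint branches independent. -/
theorem dependsOn_branchProd (κ : Chord → ℝ) (T : Finset (Finset V)) (a : V) :
    DependsOn (branchProd κ T a) (T : Set (Finset V)) := by
  intro X Y h
  rw [branchProd, branchProd]
  congr 1
  · exact Finset.prod_congr rfl fun e he => by rw [h e (Finset.mem_filter.1 he).1]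
  · exact pairProd_congr fun e he f hf => by rw [oddSign, oddSign, h e he, h f hf]

variable [Fintype V]

/-- The mean of `branchProd` for independent chords. -/
def branchWeight (κ : Chord → ℝ) (T : Finset (Finset V)) (a : V) : ℝ :=
  ∫ X, branchProd κ T a X ∂chordsLaw (Finset V)

theorem abs_branchWeight_le {κ : Chord → ℝ} (hκ : ∀ x, |κ x| ≤ 1) (T : Finset (Finset V)) (a : V) :
    |branchWeight κ T a| ≤ 1 := by
  rw [← Real.norm_eq_abs]
  refine (norm_integral_le_of_norm_le_const
    (Eventually.of_forall (abs_branchProd_le hκ T a))).trans ?_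
  simp

theorem branchWeight_map {W : Type*} [DecidableEq W] [Fintype W] (u : W ↪ V) {κ : Chord → ℝ}
    (hκ : Measurable κ) (T : Finset (Finset W)) (a : W) :
    branchWeight κ (T.map (edgeMap u)) (u a) = branchWeight κ T a := by
  rw [branchWeight, branchWeight,
    ← integral_comp_injective (edgeMap u).injective (measurable_branchProd hκ T a)]
  refine integral_congr_ae (Eventually.of_forall fun X => ?_)
  simp only [branchProd]
  congr 1
  · rw [Finset.filter_map, Finset.prod_map]
    refine Finset.prod_congr ?_ fun _ _ => rfl
    ext e
    simp [edgeMap_apply]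
  · refine pairProd_map _ (fun e f => ?_) T
    have hc : #(edgeMap u e ∩ edgeMap u f) = #(e ∩ f) := by
      rw [edgeMap_apply, edgeMap_apply, ← Finset.map_inter, Finset.card_map]
    simp only [oddSign, hc, Function.comp]

/-- The weights of the branches at the nodes of an edge with chord `y`. -/
def branchKernel {q : ℕ} (κ : Chord → ℝ) (j₀ : Fin q) (y : Chord) (j : Fin q) (x : Chord) : ℝ :=
  (if j = j₀ then κ x else 1) * chordSign y x

theorem abs_branchKernel_le {q : ℕ} {κ : Chord → ℝ} (hκ : ∀ x, |κ x| ≤ 1) (j₀ : Fin q) (y : Chord)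
    (j : Fin q) (x : Chord) : |branchKernel κ j₀ y j x| ≤ 1 := by
  rw [branchKernel, abs_mul, abs_chordSign, mul_one]
  split_ifs
  · exact hκ x
  · simp

theorem measurable_branchKernel {q : ℕ} {κ : Chord → ℝ} (hκ : Measurable κ) (j₀ : Fin q)
    (j : Fin q) : Measurable fun p : Chord × Chord => branchKernel κ j₀ p.1 j p.2 := by
  unfold branchKernel
  have := measurable_chordSign
  split_ifs <;> fun_prop

theorem measurable_branchKernel_right {q : ℕ} {κ : Chord → ℝ} (hκ : Measurable κ) (j₀ : Fin q)
    (y : Chord) (j : Fin q) : Measurable (branchKernel κ j₀ y j) :=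
  (measurable_branchKernel hκ j₀ j).comp (measurable_const.prodMk measurable_id)

theorem measurable_branchWeight_branchKernel {q : ℕ} {κ : Chord → ℝ} (hκ : Measurable κ)
    (j₀ j : Fin q) (T : Finset (Finset V)) (a : V) :
    Measurable fun y => branchWeight (branchKernel κ j₀ y j) T a := by
  have h : Measurable fun p : Chord × (Finset V → Chord) =>
      branchProd (branchKernel κ j₀ p.1 j) T a p.2 := by
    unfold branchProd
    refine Measurable.mul ?_ ((measurable_pairProd_oddSign T).comp measurable_snd)
    refine Finset.measurable_prod _ fun e _ => ?_
    exact (measurable_branchKernel hκ j₀ j).comp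
      (measurable_fst.prodMk ((measurable_pi_apply e).comp measurable_snd))
  exact h.stronglyMeasurable.integral_prod_right.measurable

variable {q : ℕ} {c : V → Fin q} {r : Fin q → V} {T : Fin q → Finset (Finset V)}

theorem image_inter_of_fiber (hr : ∀ j, c (r j) = j) {j : Fin q} {f : Finset V}
    (hf : f ⊆ fiber c j) : univ.image r ∩ f = if r j ∈ f then {r j} else ∅ := by
  have h : ∀ i, r i ∈ f → i = j := fun i hi => by
    have := mem_fiber.1 (hf hi)
    rwa [hr] at this
  ext x
  rw [Finset.mem_inter, Finset.mem_image]
  split_ifs with hj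
  · rw [Finset.mem_singleton]
    constructor
    · rintro ⟨⟨i, -, rfl⟩, hx⟩
      rw [h i hx]
    · rintro rfl
      exact ⟨⟨j, mem_univ j, rfl⟩, hj⟩
  · constructor
    · rintro ⟨⟨i, -, rfl⟩, hx⟩
      exact absurd (h i hx ▸ hx) hj
    · simp

theorem mem_iff_of_fiber (hr : ∀ j, c (r j) = j) {i j : Fin q} {f : Finset V}
    (hf : f ⊆ fiber c j) : r i ∈ f ↔ r j ∈ f ∧ j = i := by
  constructor
  · intro h
    have := mem_fiber.1 (hf h)
    rw [hr] at this
    exact ⟨this ▸ h, this.symm⟩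
  · rintro ⟨h, rfl⟩
    exact h

/-- The factorization of the weight of a tree over the branches at the edge `image r`. -/
theorem branchWeight_insert (hq : 2 ≤ q) (hqe : Even q) (hr : ∀ j, c (r j) = j)
    (hT : ∀ j, ∀ e ∈ T j, e ⊆ fiber c j ∧ #e = q) (j₀ : Fin q) {κ : Chord → ℝ}
    (hκ : Measurable κ) (hκ1 : ∀ x, |κ x| ≤ 1) :
    branchWeight κ (insert (univ.image r) (univ.biUnion T)) (r j₀) =
      ∫ y, κ y * ∏ j, branchWeight (branchKernel κ j₀ y j) (T j) (r j) ∂chordLaw := by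
  have hnot := image_notMem_biUnion hq hT hr
  have hdisj : ∀ i j, i ≠ j → Disjoint (T i) (T j) := fun i j hij =>
    pairwise_disjoint_of_fiber (by omega) hT hij
  have hrinj : Function.Injective r := Function.LeftInverse.injective hr
  set e := univ.image r with he
  have hecard : #e = q := by
    rw [he, Finset.card_image_of_injective _ hrinj]
    simp
  -- Condition on the chord `y` of the removed edge; the branches then involve disjoint sets of
  -- chords.
  rw [branchWeight, integral_eq_integral_update e (measurable_branchProd hκ _ _)
    (abs_branchProd_le hκ1 _ _)]
  refine integral_congr_ae (Eventually.of_forall fun y => ?_)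
  have key : ∀ X : Finset V → Chord,
      branchProd κ (insert e (univ.biUnion T)) (r j₀) (Function.update X e y) =
      κ y * ∏ j, branchProd (branchKernel κ j₀ y j) (T j) (r j) X := fun X => by
    have hne : ∀ f ∈ univ.biUnion T, Function.update X e y f = X f := fun f hf =>
      Function.update_of_ne (fun h : f = e => hnot (by rwa [h] at hf)) _ _
    have h1 : (∏ f ∈ insert e (univ.biUnion T) with r j₀ ∈ f, κ (Function.update X e y f)) =
        κ y * ∏ j, ∏ f ∈ T j with r j ∈ f, if j = j₀ then κ (X f) else 1 := by
      rw [Finset.filter_insert, if_pos (Finset.mem_image_of_mem r (mem_univ j₀)),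
        Finset.prod_insert fun h => hnot (Finset.mem_filter.1 h).1, Function.update_self,
        Finset.prod_filter, Finset.prod_biUnion fun i _ j _ hij => hdisj i j hij]
      congr 1
      refine Finset.prod_congr rfl fun j _ => ?_
      rw [Finset.prod_filter]
      refine Finset.prod_congr rfl fun f hf => ?_
      rw [hne f (Finset.mem_biUnion.2 ⟨j, mem_univ j, hf⟩)]
      simp only [mem_iff_of_fiber hr (i := j₀) (hT j f hf).1]
      by_cases h1 : r j ∈ f <;> by_cases h2 : j = j₀ <;> simp [h1, h2]
    -- An edge of branch `j` meets the removed edge in `r j` or not at all, so exactly the edges at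
    -- `r j` get a crossing sign with `y`. Edges of different branches are disjoint, and the
    -- diagonal factor is `1` since `q` is even.
    have h2 : pairProd (oddSign (Function.update X e y)) (oddSign_comm _)
        (insert e (univ.biUnion T)) =
        (∏ j, ∏ f ∈ T j with r j ∈ f, chordSign y (X f)) *
          ∏ j, pairProd (oddSign X) (oddSign_comm X) (T j) := by
      rw [pairProd_insert hnot, ← pairProd_biUnion univ hdisj]
      · have h3 : oddSign (Function.update X e y) e e = 1 := by
          rw [oddSign, Finset.inter_self, hecard, if_neg (Nat.not_odd_iff_even.2 hqe)]
        rw [h3, one_mul, Finset.prod_biUnion fun i _ j _ hij => hdisj i j hij]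
        congr 1
        · refine Finset.prod_congr rfl fun j _ => ?_
          rw [Finset.prod_filter]
          refine Finset.prod_congr rfl fun f hf => ?_
          rw [oddSign, hne f (Finset.mem_biUnion.2 ⟨j, mem_univ j, hf⟩), Function.update_self,
            image_inter_of_fiber hr (hT j f hf).1]
          split_ifs <;> simp_all
        · exact pairProd_congr fun f hf g hg => by
            rw [oddSign, oddSign, hne f hf, hne g hg]
      · intro i j hij f hf g hg
        have h4 : f ∩ g = ∅ := by
          ext x
          simp only [Finset.mem_inter, Finset.notMem_empty, iff_false, not_and]
          intro hx hx'
          exact hij ((mem_fiber.1 ((hT i f hf).1 hx)).symm.trans (mem_fiber.1 ((hT j g hg).1 hx')))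
        rw [oddSign, h4]
        simp
    rw [branchProd, h1, h2]
    simp only [branchProd, branchKernel, Finset.prod_mul_distrib]
    ring
  simp only [key]
  rw [integral_const_mul, integral_prod_of_dependsOn univ hdisj
    (fun j => measurable_branchProd (measurable_branchKernel_right hκ j₀ y j) _ _)
    fun j => dependsOn_branchProd _ _ _]
  rfl

end BranchWeight

/-! ### Generating functions of rooted hypertrees -/

section RootedTrees

/-- The edge sets of hypertrees on `[v]`. -/
theorem isHypertree_iff {q v : ℕ} {E : Finset (Finset (Fin v))} :
    IsHypertree q v E ↔ E ∈ treesOn q (univ : Finset (Fin v)) := by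
  rw [mem_treesOn, mem_connectedOn]
  constructor
  · exact fun h => ⟨⟨fun e he => ⟨Finset.subset_univ e, h.uniform e he⟩,
      fun a _ b _ => h.connected a b⟩, by simpa using h.card_edges⟩
  · exact fun h => ⟨fun e he => (h.1.1 e he).2, fun a b => h.1.2 a (mem_univ a) b (mem_univ b),
      by simpa using h.2⟩

theorem crossingMean_eq {v : ℕ} (E : Finset (Finset (Fin v))) :
    crossingMean E = ∫ X, pairProd (oddSign X) (oddSign_comm X) E ∂chordsLaw (Finset (Fin v)) := by
  let k : (E → Chord) → E → E → ℝ := fun X e f =>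
    if Odd #(e.1 ∩ f.1) then chordSign (X e) (X f) else 1
  have hk : ∀ X e f, k X e f = k X f e := fun X e f => by
    simp only [k, Finset.inter_comm e.1 f.1, chordSign_comm (X e) (X f)]
  have h1 : ∀ X : E → Chord, crossingSign E X = pairProd (k X) (hk X) univ := fun X => by
    rw [pairProd, Finset.sym2_univ]
    rfl
  have hm : Measurable (crossingSign E) := by
    unfold crossingSign
    refine Finset.measurable_prod _ fun p _ => ?_
    induction p using Sym2.ind with
    | _ e f =>
      simp only [Sym2.lift_mk]
      split_ifs
      · exact (measurable_pi_apply e).chordSign (measurable_pi_apply f)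
      · exact measurable_const
  rw [crossingMean, ← integral_comp_injective Subtype.val_injective hm]
  refine integral_congr_ae (Eventually.of_forall fun X => ?_)
  simp only [h1]
  have h2 := pairProd_map (hk := oddSign_comm X) (hk' := hk (X ∘ Subtype.val))
    (Function.Embedding.subtype (· ∈ E)) (fun e f => rfl) univ
  rw [← h2]
  congr 1
  ext e
  simp

variable {V : Type*} [DecidableEq V]

/-- The number of edges of `T` at `a`. -/
def edgeDegree (T : Finset (Finset V)) (a : V) : ℕ := #{e ∈ T | a ∈ e}

/-- The exponential generating function coefficient of rooted hypertrees, where the edges at the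
root have the weight `κ`, and the degree of the root the weight `w`. -/
def rootedCoeff (q : ℕ) (κ : Chord → ℝ) (w : ℕ → ℝ) (v : ℕ) : ℝ :=
  (∑ T ∈ treesOn q (univ : Finset (Fin v)), ∑ a, w (edgeDegree T a) * branchWeight κ T a) / (v ! : ℝ)

theorem sum_treesOn_branchWeight [Fintype V] (q : ℕ) {κ : Chord → ℝ} (hκ : Measurable κ)
    (w : ℕ → ℝ) (B : Finset V) :
    ∑ a ∈ B, ∑ T ∈ treesOn q B, w (edgeDegree T a) * branchWeight κ T a =
      (#B)! * rootedCoeff q κ w #B := by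
  obtain ⟨u, hu⟩ := exists_map_univ_eq B
  have h : ∑ a ∈ univ.map u, ∑ T ∈ treesOn q (univ.map u), w (edgeDegree T a) * branchWeight κ T a =
      (#B)! * rootedCoeff q κ w #B := by
    have hf : ((#B)! : ℝ) ≠ 0 := by positivity
    rw [rootedCoeff, mul_div_cancel₀ _ hf, Finset.sum_map, Finset.sum_comm]
    rw [← Finset.sum_comm (s := univ), sum_congr rfl fun a _ => sum_treesOn_map u q univ _,
      Finset.sum_comm]
    refine Finset.sum_congr rfl fun T _ => Finset.sum_congr rfl fun a _ => ?_
    rw [branchWeight_map u hκ]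
    congr 2
    rw [edgeDegree, edgeDegree, Finset.filter_map, Finset.card_map]
    congr 1
    ext e
    simp [edgeMap_apply]
  rwa [hu] at h

theorem sum_edgeDegree {T : Finset (Finset V)} [Fintype V] (F : V → ℝ) :
    ∑ e ∈ T, ∑ a ∈ e, F a = ∑ a, edgeDegree T a * F a := by
  have h : ∀ e : Finset V, ∑ a ∈ e, F a = ∑ a, if a ∈ e then F a else 0 := fun e => by
    rw [← Finset.sum_filter]
    simp
  simp only [h]
  rw [Finset.sum_comm]
  refine Finset.sum_congr rfl fun a _ => ?_
  rw [← Finset.sum_filter, Finset.sum_const, edgeDegree, nsmul_eq_mul]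

theorem edgeDegree_insert [Fintype V] {q : ℕ} (hq : 2 ≤ q) {c : V → Fin q} {r : Fin q → V}
    {T : Fin q → Finset (Finset V)} (hr : ∀ j, c (r j) = j)
    (hT : ∀ j, ∀ e ∈ T j, e ⊆ fiber c j ∧ #e = q) (j : Fin q) :
    edgeDegree (insert (univ.image r) (univ.biUnion T)) (r j) = edgeDegree (T j) (r j) + 1 := by
  have hnot := image_notMem_biUnion hq hT hr
  rw [edgeDegree, Finset.filter_insert, if_pos (Finset.mem_image_of_mem r (mem_univ j)),
    Finset.card_insert_of_notMem fun h => hnot (Finset.mem_filter.1 h).1, edgeDegree]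
  congr 2
  ext f
  simp only [Finset.mem_filter, Finset.mem_biUnion, Finset.mem_univ, true_and]
  constructor
  · rintro ⟨⟨i, hf⟩, hj⟩
    have := ((mem_iff_of_fiber hr (hT i f hf).1).1 hj).2
    exact ⟨this ▸ hf, hj⟩
  · exact fun h => ⟨⟨j, h.1⟩, h.2⟩

/-- The degree weights at the nodes of an edge, one of which is the root. -/
def branchDegree {q : ℕ} (w : ℕ → ℝ) (j₀ j : Fin q) (n : ℕ) : ℝ := if j = j₀ then w (n + 1) else 1

/-- The recursion obtained by removing an edge at the root. -/
theorem rootedCoeff_mul_degree {q : ℕ} (hq : 2 ≤ q) (hqe : Even q) {κ : Chord → ℝ}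
    (hκ : Measurable κ) (hκ1 : ∀ x, |κ x| ≤ 1) (w : ℕ → ℝ) (v : ℕ) :
    rootedCoeff q κ (fun n => n * w n) v = 1 / ((q - 1)! : ℝ) * ∫ y, κ y *
      ∑ m ∈ piAntidiag univ v, ∏ j : Fin q,
        rootedCoeff q (branchKernel κ ⟨0, by omega⟩ y j) (branchDegree w ⟨0, by omega⟩ j) (m j)
        ∂chordLaw := by
  have hq0 : 0 < q := by omega
  set j₀ : Fin q := ⟨0, hq0⟩ with hj₀
  have hv : (v ! : ℝ) ≠ 0 := by positivity
  have hqf : ((q - 1)! : ℝ) ≠ 0 := by positivity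
  have hint : ∀ (c : Fin v → Fin q) (r : Fin q → Fin v) (T : Fin q → Finset (Finset (Fin v))),
      Integrable (fun y => κ y * ∏ j, (branchDegree w j₀ j (edgeDegree (T j) (r j)) *
        branchWeight (branchKernel κ j₀ y j) (T j) (r j))) chordLaw := fun c r T => by
    simp only [Finset.prod_mul_distrib]
    have h1 : ∀ j, Measurable fun y => branchWeight (branchKernel κ j₀ y j) (T j) (r j) :=
      fun j => measurable_branchWeight_branchKernel hκ j₀ j (T j) (r j)
    refine Integrable.of_bound (C := |∏ j, branchDegree w j₀ j (edgeDegree (T j) (r j))|)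
      (by fun_prop) (Eventually.of_forall fun y => ?_)
    rw [Real.norm_eq_abs, abs_mul, abs_mul]
    have h2 : |∏ j, branchWeight (branchKernel κ j₀ y j) (T j) (r j)| ≤ 1 := by
      rw [Finset.abs_prod]
      exact Finset.prod_le_one (fun _ _ => abs_nonneg _) fun j _ =>
        abs_branchWeight_le (abs_branchKernel_le hκ1 j₀ y j) _ _
    have h3 := mul_le_of_le_one_right
      (abs_nonneg (∏ j, branchDegree w j₀ j (edgeDegree (T j) (r j)))) h2
    exact (mul_le_of_le_one_left (by positivity) (hκ1 y)).trans h3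
  -- The factor `n` in the root weight marks an edge at the root, and each such edge has `(q - 1)!`
  -- enumerations that begin with the root.
  have h1 : (q - 1)! * (rootedCoeff q κ (fun n => n * w n) v * v !) =
      ∑ c : Fin v → Fin q, ∑ r ∈ Fintype.piFinset (fiber c),
        ∑ T ∈ Fintype.piFinset fun j => treesOn q (fiber c j),
          ∫ y, κ y * ∏ j, (branchDegree w j₀ j (edgeDegree (T j) (r j)) *
            branchWeight (branchKernel κ j₀ y j) (T j) (r j)) ∂chordLaw := by
    rw [rootedCoeff, div_mul_cancel₀ _ hv, Finset.mul_sum]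
    have h2 := sum_treesOn_edges (V := Fin v) hq fun T r =>
      w (edgeDegree T (r j₀)) * branchWeight κ T (r j₀)
    have h3 : ∀ T ∈ treesOn q (univ : Finset (Fin v)),
        ∑ r : Fin q → Fin v with univ.image r ∈ T,
          w (edgeDegree T (r j₀)) * branchWeight κ T (r j₀) =
        (q - 1)! * ∑ a, (edgeDegree T a * w (edgeDegree T a)) * branchWeight κ T a := fun T hT => by
      rw [sum_image_mem_zero hq0
        (fun e he => ((mem_connectedOn.1 (mem_treesOn.1 hT).1).1 e he).2)
        fun _ a => w (edgeDegree T a) * branchWeight κ T a, sum_edgeDegree]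
      simp only [mul_assoc]
    rw [Finset.sum_congr rfl h3] at h2
    rw [h2]
    refine Finset.sum_congr rfl fun c _ => Finset.sum_congr rfl fun r hr =>
      Finset.sum_congr rfl fun T hT => ?_
    have hr' : ∀ j, c (r j) = j := fun j => mem_fiber.1 (Fintype.mem_piFinset.1 hr j)
    have hT' : ∀ j, ∀ e ∈ T j, e ⊆ fiber c j ∧ #e = q := fun j =>
      (mem_connectedOn.1 (mem_treesOn.1 (Fintype.mem_piFinset.1 hT j)).1).1
    rw [edgeDegree_insert hq hr' hT', branchWeight_insert hq hqe hr' hT' j₀ hκ hκ1,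
      ← integral_const_mul]
    refine integral_congr_ae (Eventually.of_forall fun y => ?_)
    have h4 : ∏ j, branchDegree w j₀ j (edgeDegree (T j) (r j)) =
        w (edgeDegree (T j₀) (r j₀) + 1) := by
      rw [Finset.prod_eq_single j₀]
      · simp [branchDegree]
      · intro j _ hj
        simp [branchDegree, hj]
      · simp
    simp only [Finset.prod_mul_distrib, h4]
    ring
  -- For fixed `y` the sum over all ways to distribute the nodes among the `q` branches is a
  -- convolution of exponential generating functions.
  have h5 : ∀ y, ∑ c : Fin v → Fin q, ∑ r ∈ Fintype.piFinset (fiber c),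
        ∑ T ∈ Fintype.piFinset fun j => treesOn q (fiber c j),
          κ y * ∏ j, (branchDegree w j₀ j (edgeDegree (T j) (r j)) *
            branchWeight (branchKernel κ j₀ y j) (T j) (r j)) =
      (κ y * ∑ m ∈ piAntidiag univ v, ∏ j : Fin q,
        rootedCoeff q (branchKernel κ j₀ y j) (branchDegree w j₀ j) (m j)) * v ! := fun y => by
    have h6 := sum_prod_card_fiber (V := Fin v) (q := q) fun j n =>
      n ! * rootedCoeff q (branchKernel κ j₀ y j) (branchDegree w j₀ j) n
    simp only [Fintype.card_fin] at h6
    rw [div_eq_iff hv] at h6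
    have h7 : ∀ m : Fin q → ℕ, ∏ j, ((m j)! *
        rootedCoeff q (branchKernel κ j₀ y j) (branchDegree w j₀ j) (m j) / ((m j)! : ℝ)) =
        ∏ j, rootedCoeff q (branchKernel κ j₀ y j) (branchDegree w j₀ j) (m j) := fun m =>
      Finset.prod_congr rfl fun j _ => mul_div_cancel_left₀ _ (by positivity)
    simp only [h7] at h6
    rw [mul_assoc, ← h6, Finset.mul_sum]
    refine Finset.sum_congr rfl fun c _ => ?_
    simp only [← Finset.mul_sum]
    congr 1
    rw [← Finset.prod_congr rfl fun j _ => sum_treesOn_branchWeight q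
      (measurable_branchKernel_right hκ j₀ y j) (branchDegree w j₀ j) (fiber c j),
      Finset.prod_univ_sum]
    refine Finset.sum_congr rfl fun r _ => ?_
    rw [Finset.prod_univ_sum]
  have h8 : (q - 1)! * (rootedCoeff q κ (fun n => n * w n) v * v !) =
      (∫ y, κ y * ∑ m ∈ piAntidiag univ v, ∏ j : Fin q,
        rootedCoeff q (branchKernel κ j₀ y j) (branchDegree w j₀ j) (m j) ∂chordLaw) * v ! := by
    rw [h1, ← integral_mul_const]
    simp only [← h5]
    rw [integral_finsetSum _ fun c _ => integrable_finsetSum _ fun r _ =>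
      integrable_finsetSum _ fun T _ => hint c r T]
    refine Finset.sum_congr rfl fun c _ => ?_
    rw [integral_finsetSum _ fun r _ => integrable_finsetSum _ fun T _ => hint c r T]
    refine Finset.sum_congr rfl fun r _ => ?_
    rw [integral_finsetSum _ fun T _ => hint c r T]
  rw [← mul_assoc] at h8
  have h9 := mul_right_cancel₀ hv h8
  rw [← h9]
  field_simp

/-- The number of rooted hypertrees on `[v]`, divided by `v!`. -/
def rootedCount (q v : ℕ) : ℝ := v * #(treesOn q (univ : Finset (Fin v))) / (v ! : ℝ)

theorem rootedCount_nonneg (q v : ℕ) : 0 ≤ rootedCount q v := by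
  unfold rootedCount
  positivity

theorem abs_rootedCoeff_le (q : ℕ) {κ : Chord → ℝ} (hκ1 : ∀ x, |κ x| ≤ 1) {w : ℕ → ℝ}
    (hw : ∀ n, |w n| ≤ 1) (v : ℕ) : |rootedCoeff q κ w v| ≤ rootedCount q v := by
  rw [rootedCoeff, rootedCount, abs_div, Nat.abs_cast]
  refine div_le_div_of_nonneg_right ?_ (by positivity)
  refine (Finset.abs_sum_le_sum_abs _ _).trans ?_
  have h : ∀ T ∈ treesOn q (univ : Finset (Fin v)),
      |∑ a, w (edgeDegree T a) * branchWeight κ T a| ≤ v := fun T _ => by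
    refine (Finset.abs_sum_le_sum_abs _ _).trans ?_
    refine (Finset.sum_le_card_nsmul univ _ 1 fun a _ => ?_).trans (by simp)
    rw [abs_mul]
    exact mul_le_one₀ (hw _) (abs_nonneg _) (abs_branchWeight_le hκ1 _ _)
  refine (Finset.sum_le_card_nsmul _ _ _ h).trans ?_
  rw [nsmul_eq_mul, mul_comm]

theorem measurable_rootedCoeff_branchKernel {q : ℕ} {κ : Chord → ℝ} (hκ : Measurable κ)
    (j₀ j : Fin q) (w : ℕ → ℝ) (v : ℕ) :
    Measurable fun y => rootedCoeff q (branchKernel κ j₀ y j) w v := by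
  unfold rootedCoeff
  refine Measurable.div_const ?_ _
  refine Finset.measurable_sum _ fun T _ => Finset.measurable_sum _ fun a _ => ?_
  exact (measurable_branchWeight_branchKernel hκ j₀ j T a).const_mul _

/-- Only the single node has degree zero. -/
theorem eq_one_of_edgeDegree_eq_zero {q v : ℕ} {T : Finset (Finset (Fin v))}
    (hT : T ∈ treesOn q (univ : Finset (Fin v))) {a : Fin v} (h : edgeDegree T a = 0) : v = 1 := by
  have h1 : ∀ b, b = a := fun b => by
    have h2 := (mem_connectedOn.1 (mem_treesOn.1 hT).1).2 a (mem_univ a) b (mem_univ b)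
    rcases Relation.ReflTransGen.cases_head h2 with h3 | ⟨c, ⟨e, he, hae, _⟩, _⟩
    · exact h3.symm
    · exact absurd (Finset.mem_filter.2 ⟨he, hae⟩)
        (Finset.eq_empty_iff_forall_notMem.1 (Finset.card_eq_zero.1 h) e)
  have := Fintype.card_eq_one_iff.2 ⟨a, h1⟩
  simpa using this

theorem treesOn_univ_one {q : ℕ} (hq : 2 ≤ q) : treesOn q (univ : Finset (Fin 1)) = {∅} := by
  ext T
  rw [mem_treesOn, Finset.mem_singleton, mem_connectedOn]
  constructor
  · rintro ⟨-, h⟩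
    have h1 : #T * (q - 1) = 0 := by simpa using h
    rcases Nat.mul_eq_zero.1 h1 with h2 | h2
    · exact Finset.card_eq_zero.1 h2
    · omega
  · rintro rfl
    refine ⟨⟨by simp, fun a _ b _ => ?_⟩, by simp⟩
    rw [Subsingleton.elim a b]
    exact Linked.refl _ _

theorem rootedCoeff_degree_zero {q : ℕ} (hq : 2 ≤ q) (κ : Chord → ℝ) (v : ℕ) :
    rootedCoeff q κ (fun n => if n = 0 then 1 else 0) v = if v = 1 then 1 else 0 := by
  split_ifs with hv
  · subst hv
    rw [rootedCoeff, treesOn_univ_one hq]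
    simp [edgeDegree, branchWeight, branchProd, pairProd_empty]
  · rw [rootedCoeff, Finset.sum_eq_zero, zero_div]
    intro T hT
    refine Finset.sum_eq_zero fun a _ => ?_
    rw [if_neg fun h => hv (eq_one_of_edgeDegree_eq_zero hT h), zero_mul]

theorem edgeDegree_lt {q v : ℕ} (hq : 2 ≤ q) {T : Finset (Finset (Fin v))}
    (hT : T ∈ treesOn q (univ : Finset (Fin v))) (a : Fin v) : edgeDegree T a < v := by
  have h1 : #T * (q - 1) + 1 = v := by simpa using (mem_treesOn.1 hT).2
  have h2 : edgeDegree T a ≤ #T := Finset.card_filter_le _ _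
  have h3 : #T * 1 ≤ #T * (q - 1) := Nat.mul_le_mul_left _ (by omega)
  omega

/-- Degrees in a tree on `v` nodes are less than `v`, so truncating the degree weight at a large
bound does not change the coefficient. -/
theorem rootedCoeff_congr {q v : ℕ} (hq : 2 ≤ q) (κ : Chord → ℝ) {w w' : ℕ → ℝ}
    (h : ∀ n < v, w n = w' n) : rootedCoeff q κ w v = rootedCoeff q κ w' v := by
  rw [rootedCoeff, rootedCoeff]
  congr 1
  exact Finset.sum_congr rfl fun T hT => Finset.sum_congr rfl fun a _ => by
    rw [h _ (edgeDegree_lt hq hT a)]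

/-- The coefficients of the generating function of hypertrees weighted by `b_T`. -/
def treeSum (q v : ℕ) : ℝ :=
  (∑ T ∈ treesOn q (univ : Finset (Fin v)), crossingMean T) / (v ! : ℝ)

theorem treeCoeff_eq (q : ℕ) (β : ℝ) (v : ℕ) :
    treeCoeff q β v = treeSum q v * sykRho q β ^ (v - 1) := by
  rw [treeCoeff, treeSum]
  congr 3
  ext E
  simp [isHypertree_iff]

theorem branchWeight_one {v : ℕ} (T : Finset (Finset (Fin v))) (a : Fin v) :
    branchWeight 1 T a = crossingMean T := by
  simp [branchWeight, branchProd, crossingMean_eq]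

/-- A tree with `v` nodes has `(v-1)/(q-1)` edges. -/
theorem rootedCoeff_sub (q : ℕ) (hq : 2 ≤ q) (v : ℕ) :
    rootedCoeff q 1 1 v - ((q : ℝ) - 1) * (1 / q * rootedCoeff q 1 (fun n => n * 1) v) =
      treeSum q v := by
  have hq0 : (q : ℝ) ≠ 0 := by positivity
  have h1 : rootedCoeff q 1 1 v =
      (∑ T ∈ treesOn q (univ : Finset (Fin v)), v * crossingMean T) / (v ! : ℝ) := by
    rw [rootedCoeff]
    congr 1
    refine Finset.sum_congr rfl fun T _ => ?_
    simp [branchWeight_one]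
  -- The sum of the degrees counts each edge `q` times. So the claim reduces, tree by tree, to `v -
  -- (q - 1) * #T = 1`.
  have h2 : rootedCoeff q 1 (fun n => n * 1) v =
      (∑ T ∈ treesOn q (univ : Finset (Fin v)), q * #T * crossingMean T) / (v ! : ℝ) := by
    rw [rootedCoeff]
    congr 1
    refine Finset.sum_congr rfl fun T hT => ?_
    simp only [branchWeight_one, mul_one]
    rw [← sum_edgeDegree fun _ => crossingMean T, Finset.sum_congr rfl fun e he => by
      rw [Finset.sum_const, ((mem_connectedOn.1 (mem_treesOn.1 hT).1).1 e he).2]]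
    rw [Finset.sum_const]
    simp only [nsmul_eq_mul]
    ring
  rw [h1, h2, treeSum, ← mul_assoc, mul_div_assoc', ← sub_div, Finset.mul_sum,
    ← Finset.sum_sub_distrib]
  congr 1
  refine Finset.sum_congr rfl fun T hT => ?_
  have h3 : #T * (q - 1) + 1 = v := by simpa using (mem_treesOn.1 hT).2
  have h4 : (#T : ℝ) * (q - 1) + 1 = v := by
    have := congrArg (Nat.cast : ℕ → ℝ) h3
    rwa [Nat.cast_add, Nat.cast_mul, Nat.cast_sub (by omega : 1 ≤ q), Nat.cast_one] at this
  rw [← h4]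
  field_simp
  ring

end RootedTrees

/-! ### The generating functions solve the cavity equation -/

section Series

theorem sum_piAntidiag_cons {ι : Type*} [DecidableEq ι] {i : ι} {s : Finset ι} (hi : i ∉ s)
    (f : ι → ℕ → ℝ) (v : ℕ) :
    ∑ m ∈ piAntidiag (cons i s hi) v, ∏ j ∈ cons i s hi, f j (m j) =
      ∑ p ∈ antidiagonal v, f i p.1 * ∑ m ∈ piAntidiag s p.2, ∏ j ∈ s, f j (m j) := by
  rw [piAntidiag_cons, Finset.sum_disjiUnion]
  refine Finset.sum_congr rfl fun p _ => ?_
  rw [Finset.sum_map, Finset.mul_sum]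
  refine Finset.sum_congr rfl fun m hm => ?_
  have h1 : m i = 0 := by
    by_contra h
    exact hi ((Finset.mem_piAntidiag.1 hm).2 i h)
  rw [Finset.prod_cons]
  simp only [addRightEmbedding_apply, Pi.add_apply, if_true, h1, zero_add]
  congr 1
  refine Finset.prod_congr rfl fun j hj => ?_
  rw [if_neg (fun h : j = i => hi (h ▸ hj)), add_zero]

theorem cauchyProduct {a b : ℕ → ℝ} (ha : Summable fun v => ‖a v‖) (hb : Summable fun v => ‖b v‖) :
    (Summable fun v => ‖∑ p ∈ antidiagonal v, a p.1 * b p.2‖) ∧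
      ∑' v, ∑ p ∈ antidiagonal v, a p.1 * b p.2 = (∑' v, a v) * ∑' v, b v :=
  ⟨summable_norm_sum_mul_antidiagonal_of_summable_norm ha hb,
    (tsum_mul_tsum_eq_tsum_sum_antidiagonal_of_summable_norm ha hb).symm⟩

/-- The Cauchy product of finitely many absolutely convergent series. -/
theorem prod_tsum_eq_tsum_piAntidiag {ι : Type*} [DecidableEq ι] (s : Finset ι) {f : ι → ℕ → ℝ}
    (hf : ∀ i, Summable fun m => ‖f i m‖) :
    (Summable fun v => ‖∑ m ∈ piAntidiag s v, ∏ j ∈ s, f j (m j)‖) ∧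
      ∑' v, ∑ m ∈ piAntidiag s v, ∏ j ∈ s, f j (m j) = ∏ j ∈ s, ∑' m, f j m := by
  induction s using Finset.cons_induction with
  | empty =>
    have h : ∀ v : ℕ, ∑ m ∈ piAntidiag (∅ : Finset ι) v, ∏ j ∈ (∅ : Finset ι), f j (m j) =
        if v = 0 then 1 else 0 := fun v => by
      rcases Nat.eq_zero_or_pos v with rfl | hv
      · simp
      · simp [Finset.piAntidiag_empty_of_ne_zero hv.ne', hv.ne']
    simp only [h]
    refine ⟨summable_of_ne_finset_zero (s := {0}) fun v hv => ?_, ?_⟩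
    · rw [if_neg (by simpa using hv), norm_zero]
    · rw [tsum_ite_eq]
      simp
  | cons i s hi ih =>
    simp only [sum_piAntidiag_cons hi]
    rw [Finset.prod_cons, ← ih.2]
    exact cauchyProduct (b := fun v => ∑ m ∈ piAntidiag s v, ∏ j ∈ s, f j (m j)) (hf i) ih.1

variable {q : ℕ} {z : ℝ} {κ : Chord → ℝ} {w : ℕ → ℝ}

/-- The exponential generating function of rooted hypertrees. -/
def rootedSeries (q : ℕ) (κ : Chord → ℝ) (w : ℕ → ℝ) (z : ℝ) : ℝ :=
  ∑' v, rootedCoeff q κ w v * z ^ v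

/-- `z` is in the range where the generating functions are absolutely convergent and small. -/
structure IsSmall (q : ℕ) (z : ℝ) : Prop where
  nonneg : 0 ≤ z
  summable : Summable fun v => rootedCount q v * z ^ v
  tsum_le : ∑' v, rootedCount q v * z ^ v ≤ 1

theorem IsSmall.norm_le (hz : IsSmall q z) (hκ1 : ∀ x, |κ x| ≤ 1) (hw : ∀ n, |w n| ≤ 1) (v : ℕ) :
    ‖rootedCoeff q κ w v * z ^ v‖ ≤ rootedCount q v * z ^ v := by
  rw [Real.norm_eq_abs, abs_mul, abs_of_nonneg (pow_nonneg hz.nonneg v)]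
  exact mul_le_mul_of_nonneg_right (abs_rootedCoeff_le q hκ1 hw v) (pow_nonneg hz.nonneg v)

theorem IsSmall.summable_norm (hz : IsSmall q z) (hκ1 : ∀ x, |κ x| ≤ 1) (hw : ∀ n, |w n| ≤ 1) :
    Summable fun v => ‖rootedCoeff q κ w v * z ^ v‖ :=
  Summable.of_nonneg_of_le (fun _ => norm_nonneg _) (hz.norm_le hκ1 hw) hz.summable

theorem IsSmall.abs_rootedSeries_le (hz : IsSmall q z) (hκ1 : ∀ x, |κ x| ≤ 1)
    (hw : ∀ n, |w n| ≤ 1) : |rootedSeries q κ w z| ≤ 1 :=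
  (tsum_of_norm_bounded hz.summable.hasSum (hz.norm_le hκ1 hw)).trans hz.tsum_le

theorem mul_abs_treeSum_le (q v : ℕ) : v * |treeSum q v| ≤ rootedCount q v := by
  rcases Nat.eq_zero_or_pos v with rfl | hv
  · simp [rootedCount]
  · rw [treeSum, rootedCount, abs_div, Nat.abs_cast, mul_div_assoc]
    refine mul_le_mul_of_nonneg_left (div_le_div_of_nonneg_right ?_ (by positivity)) (by positivity)
    refine (Finset.abs_sum_le_sum_abs _ _).trans ?_
    refine (Finset.sum_le_card_nsmul _ _ 1 fun T _ => ?_).trans ?_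
    · rw [← branchWeight_one T ⟨0, hv⟩]
      exact abs_branchWeight_le (fun x => by simp) _ _
    · rw [nsmul_eq_mul, mul_one]

theorem treeSum_zero (q : ℕ) : treeSum q 0 = 0 := by
  have : treesOn q (univ : Finset (Fin 0)) = ∅ := by
    ext T
    simp [mem_treesOn]
  rw [treeSum, this]
  simp

theorem abs_treeSum_le (q v : ℕ) : |treeSum q v| ≤ rootedCount q v := by
  rcases Nat.eq_zero_or_pos v with rfl | hv
  · simp [treeSum_zero, rootedCount]
  · exact (le_mul_of_one_le_left (abs_nonneg _) (by exact_mod_cast hv)).trans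
      (mul_abs_treeSum_le q v)

theorem IsSmall.summable_treeSum (hz : IsSmall q z) : Summable fun v => treeSum q v * z ^ v := by
  refine Summable.of_norm_bounded hz.summable fun v => ?_
  rw [Real.norm_eq_abs, abs_mul, abs_of_nonneg (pow_nonneg hz.nonneg v)]
  exact mul_le_mul_of_nonneg_right (abs_treeSum_le q v) (pow_nonneg hz.nonneg v)

theorem IsSmall.measurable_rootedSeries (hz : IsSmall q z) (hκ : Measurable κ)
    (hκ1 : ∀ x, |κ x| ≤ 1) (hw : ∀ n, |w n| ≤ 1) (j₀ j : Fin q) :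
    Measurable fun y => rootedSeries q (branchKernel κ j₀ y j) w z := by
  refine measurable_of_tendsto_metrizable
    (f := fun n y => ∑ v ∈ range n, rootedCoeff q (branchKernel κ j₀ y j) w v * z ^ v)
    (fun n => Finset.measurable_sum _ fun v _ =>
      (measurable_rootedCoeff_branchKernel hκ j₀ j w v).mul_const _) ?_
  rw [tendsto_pi_nhds]
  exact fun y => ((hz.summable_norm (abs_branchKernel_le hκ1 j₀ y j) hw).of_norm).hasSum.tendsto_sum_nat

theorem abs_branchDegree_le (hw : ∀ n, |w n| ≤ 1) (j₀ j : Fin q) (n : ℕ) :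
    |branchDegree w j₀ j n| ≤ 1 := by
  rw [branchDegree]
  split_ifs
  · exact hw _
  · simp

/-- The Cauchy product turns the convolution in `rootedCoeff_mul_degree` into a product of series;
convolutions of `rootedCount` dominate and justify exchanging the sum with the integral. -/
theorem IsSmall.rootedSeries_mul_degree (hz : IsSmall q z) (hq : 2 ≤ q) (hqe : Even q)
    (hκ : Measurable κ) (hκ1 : ∀ x, |κ x| ≤ 1) (hw : ∀ n, |w n| ≤ 1) :
    rootedSeries q κ (fun n => n * w n) z = 1 / ((q - 1)! : ℝ) * ∫ y, κ y *
      ∏ j : Fin q, rootedSeries q (branchKernel κ ⟨0, by omega⟩ y j)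
        (branchDegree w ⟨0, by omega⟩ j) z ∂chordLaw := by
  set j₀ : Fin q := ⟨0, by omega⟩ with hj₀
  let a : Chord → Fin q → ℕ → ℝ := fun y j v =>
    rootedCoeff q (branchKernel κ j₀ y j) (branchDegree w j₀ j) v * z ^ v
  have ha : ∀ y j, Summable fun v => ‖a y j v‖ := fun y j =>
    hz.summable_norm (abs_branchKernel_le hκ1 j₀ y j) (abs_branchDegree_le hw j₀ j)
  let F : ℕ → Chord → ℝ := fun v y =>
    κ y * ∑ m ∈ piAntidiag univ v, ∏ j : Fin q, a y j (m j)
  have hF : ∀ v, rootedCoeff q κ (fun n => n * w n) v * z ^ v =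
      1 / ((q - 1)! : ℝ) * ∫ y, F v y ∂chordLaw := fun v => by
    rw [rootedCoeff_mul_degree hq hqe hκ hκ1, mul_assoc, ← integral_mul_const]
    congr 2
    funext y
    simp only [F, a]
    rw [mul_assoc, Finset.sum_mul]
    congr 1
    refine Finset.sum_congr rfl fun m hm => ?_
    rw [Finset.prod_mul_distrib, Finset.prod_pow_eq_pow_sum, (Finset.mem_piAntidiag.1 hm).1]
  have hm : ∀ v, Measurable (F v) := fun v => by
    refine hκ.mul (Finset.measurable_sum _ fun m _ => Finset.measurable_prod _ fun j _ => ?_)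
    exact (measurable_rootedCoeff_branchKernel hκ j₀ j _ _).mul_const _
  let D : ℕ → ℝ := fun v => ∑ m ∈ piAntidiag univ v, ∏ j : Fin q, (rootedCount q (m j) * z ^ (m j))
  have hpos : ∀ m, 0 ≤ rootedCount q m * z ^ m := fun m =>
    mul_nonneg (rootedCount_nonneg q m) (pow_nonneg hz.nonneg m)
  have hD : Summable D :=
    (prod_tsum_eq_tsum_piAntidiag (univ : Finset (Fin q))
      (f := fun _ m => rootedCount q m * z ^ m) fun _ => hz.summable.norm).1.of_norm
  have hFD : ∀ v y, ‖F v y‖ ≤ D v := fun v y => by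
    rw [Real.norm_eq_abs, abs_mul]
    refine (mul_le_of_le_one_left (abs_nonneg _) (hκ1 y)).trans ?_
    refine (Finset.abs_sum_le_sum_abs _ _).trans (Finset.sum_le_sum fun m _ => ?_)
    rw [Finset.abs_prod]
    exact Finset.prod_le_prod (fun _ _ => abs_nonneg _) fun j _ =>
      hz.norm_le (abs_branchKernel_le hκ1 j₀ y j) (abs_branchDegree_le hw j₀ j) (m j)
  have hFi : ∀ v, Integrable (F v) chordLaw := fun v =>
    Integrable.of_bound (hm v).aestronglyMeasurable (D v) (Eventually.of_forall (hFD v))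
  have hsum := hasSum_integral_of_summable_integral_norm hFi
    (Summable.of_nonneg_of_le (fun v => integral_nonneg fun _ => norm_nonneg _) (fun v => by
      refine (integral_mono (hFi v).norm (integrable_const (D v)) (hFD v)).trans ?_
      simp) hD)
  rw [rootedSeries]
  simp only [hF]
  rw [tsum_mul_left, hsum.tsum_eq]
  congr 2
  funext y
  simp only [F]
  rw [tsum_mul_left, (prod_tsum_eq_tsum_piAntidiag univ (ha y)).2]
  rfl

theorem chordPairSign_cons {d : ℕ} (x : Chord) (y : Fin d → Chord) :
    chordPairSign (Fin.cons x y : Fin (d + 1) → Chord) =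
      (∏ i, chordSign x (y i)) * chordPairSign y := by
  rw [chordPairSign, Fin.prod_univ_succ, Fin.prod_Ioi_zero]
  simp only [Fin.prod_Ioi_succ, Fin.cons_zero, Fin.cons_succ, chordPairSign]

theorem integral_chordsLaw_succ {d : ℕ} {F : (Fin (d + 1) → Chord) → ℝ} (hF : Measurable F)
    {C : ℝ} (hC : ∀ X, |F X| ≤ C) :
    ∫ X, F X ∂chordsLaw (Fin (d + 1)) =
      ∫ x, ∫ y, F (Fin.cons x y) ∂chordsLaw (Fin d) ∂chordLaw := by
  have h := (measurePreserving_piFinSuccAbove (fun _ : Fin (d + 1) => chordLaw) 0).symm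
  have h1 := h.integral_comp' (g := F)
  have h2 : ∀ (x : Chord) (y : Fin d → Chord),
      (MeasurableEquiv.piFinSuccAbove (fun _ : Fin (d + 1) => Chord) 0).symm (x, y) =
        Fin.cons x y := fun x y => Fin.insertNth_zero' x y
  rw [← h1, integral_prod]
  · simp only [h2]
  · exact Integrable.of_bound (hF.comp (MeasurableEquiv.measurable _)).aestronglyMeasurable C
      (Eventually.of_forall fun _ => hC _)

/-- The `q-1` branches at the other nodes of an edge with chord `y`. -/
def edgeFactor (q : ℕ) (z : ℝ) (y : Chord) : ℝ :=
  rootedSeries q (chordSign y) 1 z ^ (q - 1) / ((q - 1)! : ℝ)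

theorem IsSmall.abs_rootedSeries_chordSign_le (hz : IsSmall q z) (y : Chord) :
    |rootedSeries q (chordSign y) 1 z| ≤ 1 :=
  hz.abs_rootedSeries_le (fun x => (abs_chordSign y x).le) fun n => by simp

theorem IsSmall.measurable_rootedSeries_chordSign (hz : IsSmall q z) (hq : 2 ≤ q) :
    Measurable fun y => rootedSeries q (chordSign y) 1 z := by
  have h := hz.measurable_rootedSeries (κ := 1) (w := 1) measurable_const (fun x => by simp)
    (fun n => by simp) ⟨0, by omega⟩ ⟨0, by omega⟩
  have h1 : ∀ y, branchKernel (q := q) 1 ⟨0, by omega⟩ y ⟨0, by omega⟩ = chordSign y := fun y => by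
    funext x
    simp [branchKernel]
  simpa only [h1] using h

theorem IsSmall.measurable_edgeFactor (hz : IsSmall q z) (hq : 2 ≤ q) :
    Measurable (edgeFactor q z) :=
  ((hz.measurable_rootedSeries_chordSign hq).pow_const _).div_const _

theorem IsSmall.abs_edgeFactor_le (hz : IsSmall q z) (y : Chord) : |edgeFactor q z y| ≤ 1 := by
  have h1 : (1 : ℝ) ≤ (q - 1)! := by exact_mod_cast (q - 1).factorial_pos
  rw [edgeFactor, abs_div, abs_pow, Nat.abs_cast]
  exact (div_le_one (by linarith)).2
    ((pow_le_one₀ (abs_nonneg _) (hz.abs_rootedSeries_chordSign_le y)).trans h1)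

/-- The weight that selects the degree `d`. -/
def degreeIndicator (d n : ℕ) : ℝ := if n = d then 1 else 0

theorem abs_degreeIndicator_le (d n : ℕ) : |degreeIndicator d n| ≤ 1 := by
  rw [degreeIndicator]
  split_ifs <;> simp

/-- The contribution of the rooted hypertrees with root degree `d`. -/
theorem IsSmall.rootedSeries_degree (hz : IsSmall q z) (hq : 2 ≤ q) (hqe : Even q) (d : ℕ) :
    ∀ {κ : Chord → ℝ}, Measurable κ → (∀ x, |κ x| ≤ 1) →
      rootedSeries q κ (degreeIndicator d) z = z * (1 / (d ! : ℝ) *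
        ∫ y, (∏ i, κ (y i) * edgeFactor q z (y i)) * chordPairSign y ∂chordsLaw (Fin d)) := by
  induction d with
  | zero =>
    intro κ _ _
    have h1 : ∀ v, rootedCoeff q κ (degreeIndicator 0) v * z ^ v = if v = 1 then z else 0 :=
      fun v => by
        have := rootedCoeff_degree_zero hq κ v
        unfold degreeIndicator
        rw [this]
        split_ifs with hv
        · rw [hv]
          ring
        · ring
    rw [rootedSeries]
    simp only [h1]
    rw [tsum_ite_eq]
    simp [chordPairSign]
  | succ d ih =>
    intro κ hκ hκ1
    have h1 := hz.rootedSeries_mul_degree hq hqe hκ hκ1 (abs_degreeIndicator_le (d + 1))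
    set j₀ : Fin q := ⟨0, by omega⟩ with hj₀
    -- Under the indicator of degree `d + 1` the weight `n` is the constant `d + 1`, the number of
    -- root edges that can be removed.
    have h2 : rootedSeries q κ (fun n => n * degreeIndicator (d + 1) n) z =
        (d + 1) * rootedSeries q κ (degreeIndicator (d + 1)) z := by
      rw [rootedSeries, rootedSeries, ← tsum_mul_left]
      refine tsum_congr fun v => ?_
      rw [← mul_assoc, rootedCoeff, rootedCoeff, mul_div_assoc', Finset.mul_sum]
      congr 2
      refine Finset.sum_congr rfl fun T _ => ?_
      rw [Finset.mul_sum]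
      refine Finset.sum_congr rfl fun a _ => ?_
      rw [← mul_assoc, degreeIndicator]
      split_ifs with h
      · rw [h]
        push_cast
        ring
      · ring
    have h3 : ∀ y, κ y * ∏ j : Fin q, rootedSeries q (branchKernel κ j₀ y j)
        (branchDegree (degreeIndicator (d + 1)) j₀ j) z =
        (q - 1)! * (z * (1 / (d ! : ℝ) * ∫ y', (κ y * edgeFactor q z y *
          ∏ i, chordSign y (y' i) * (κ (y' i) * edgeFactor q z (y' i))) * chordPairSign y'
          ∂chordsLaw (Fin d))) := fun y => by
      -- The branch at the root has degree `d` left, and its root edges carry the extra sign with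
      -- `y`. In the induction these signs extend `chordPairSign` by the new chord. The other `q -
      -- 1` branches are unrestricted and give `edgeFactor`.
      have hk : branchKernel κ j₀ y j₀ = fun x => κ x * chordSign y x := by
        funext x
        simp [branchKernel]
      have hw : branchDegree (degreeIndicator (d + 1)) j₀ j₀ = degreeIndicator d := by
        funext n
        simp [branchDegree, degreeIndicator]
      have hrest : ∀ j ∈ univ.erase j₀, rootedSeries q (branchKernel κ j₀ y j)
          (branchDegree (degreeIndicator (d + 1)) j₀ j) z = rootedSeries q (chordSign y) 1 z :=
        fun j hj => by
          have hj := Finset.ne_of_mem_erase hj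
          congr 1
          · funext x
            simp [branchKernel, hj]
          · funext n
            simp [branchDegree, hj]
      rw [← Finset.mul_prod_erase univ _ (mem_univ j₀), Finset.prod_congr rfl hrest,
        Finset.prod_const, Finset.card_erase_of_mem (mem_univ j₀), Finset.card_univ,
        Fintype.card_fin, hk, hw, ih (κ := fun x => κ x * chordSign y x) (hκ.mul (measurable_chordSign_right y)) fun x => by
          rw [abs_mul, abs_chordSign, mul_one]
          exact hκ1 x]
      have hG : rootedSeries q (chordSign y) 1 z ^ (q - 1) = (q - 1)! * edgeFactor q z y := by
        rw [edgeFactor, mul_div_cancel₀]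
        positivity
      simp only [mul_assoc (κ y * edgeFactor q z y)]
      rw [hG, integral_const_mul]
      have h4 : ∀ y' : Fin d → Chord, (∏ i, κ (y' i) * chordSign y (y' i) * edgeFactor q z (y' i)) =
          ∏ i, chordSign y (y' i) * (κ (y' i) * edgeFactor q z (y' i)) := fun y' =>
        Finset.prod_congr rfl fun i _ => by ring
      simp only [h4]
      ring
    have hm : Measurable fun y : Fin (d + 1) → Chord =>
        (∏ i, κ (y i) * edgeFactor q z (y i)) * chordPairSign y := by
      have := hz.measurable_edgeFactor hq
      have := measurable_chordPairSign (d + 1)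
      fun_prop
    have hb : ∀ y : Fin (d + 1) → Chord,
        |(∏ i, κ (y i) * edgeFactor q z (y i)) * chordPairSign y| ≤ 1 := fun y => by
      rw [abs_mul, abs_chordPairSign, mul_one, Finset.abs_prod]
      refine Finset.prod_le_one (fun _ _ => abs_nonneg _) fun i _ => ?_
      rw [abs_mul]
      exact mul_le_one₀ (hκ1 _) (abs_nonneg _) (hz.abs_edgeFactor_le _)
    have hqf : ((q - 1)! : ℝ) ≠ 0 := by positivity
    rw [integral_chordsLaw_succ hm hb]
    simp only [Fin.prod_univ_succ, Fin.cons_zero, Fin.cons_succ, chordPairSign_cons]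
    rw [h2] at h1
    simp only [h3] at h1
    rw [integral_const_mul, integral_const_mul, integral_const_mul, ← mul_assoc,
      one_div_mul_cancel hqf, one_mul] at h1
    have h5 : ∀ (y : Chord) (y' : Fin d → Chord), (κ y * edgeFactor q z y *
        ∏ i, κ (y' i) * edgeFactor q z (y' i)) * ((∏ i, chordSign y (y' i)) * chordPairSign y') =
        (κ y * edgeFactor q z y * ∏ i, chordSign y (y' i) * (κ (y' i) * edgeFactor q z (y' i))) *
          chordPairSign y' := fun y y' => by
      rw [Finset.prod_mul_distrib (f := fun i => chordSign y (y' i))]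
      ring
    simp only [h5]
    have hd : ((d : ℝ) + 1) ≠ 0 := by positivity
    rw [Nat.factorial_succ, Nat.cast_mul, Nat.cast_succ]
    rw [← mul_right_inj' hd, h1]
    field_simp

/-- The generating functions solve the cavity equation. -/
theorem IsSmall.rootedSeries_eq (hz : IsSmall q z) (hq : 2 ≤ q) (hqe : Even q)
    (hκ : Measurable κ) (hκ1 : ∀ x, |κ x| ≤ 1) :
    (rootedSeries q κ 1 z : ℂ) = z + z * cavitySum q κ fun y => rootedSeries q (chordSign y) 1 z := by
  have hterm : ∀ d, (rootedSeries q κ (degreeIndicator d) z : ℂ) = z * (1 / (d ! : ℂ) *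
      cavityTerm q d κ fun y => rootedSeries q (chordSign y) 1 z) := fun d => by
    rw [hz.rootedSeries_degree hq hqe d hκ hκ1, cavityTerm]
    have h1 : ∀ y : Fin d → Chord, (∏ i, (κ (y i) : ℂ) *
        cavityFactor q (rootedSeries q (chordSign (y i)) 1 z)) * (chordPairSign y : ℂ) =
        (((∏ i, κ (y i) * edgeFactor q z (y i)) * chordPairSign y : ℝ) : ℂ) := fun y => by
      simp [cavityFactor, edgeFactor]
    simp only [h1]
    rw [integral_complex_ofReal]
    push_cast
    rfl
  have hzero : rootedSeries q κ (degreeIndicator 0) z = z := by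
    rw [hz.rootedSeries_degree hq hqe 0 hκ hκ1]
    simp [chordPairSign]
  have hh1 : ∀ y, ‖(rootedSeries q (chordSign y) 1 z : ℂ)‖ ≤ 1 := fun y => by
    rw [Complex.norm_real]
    exact hz.abs_rootedSeries_chordSign_le y
  have hs := (summable_cavitySum (q := q) (k := κ)
    (h := fun y => (rootedSeries q (chordSign y) 1 z : ℂ)) hκ1 hh1).hasSum.tendsto_sum_nat
  have hlim := (hs.const_mul (z : ℂ)).const_add (z : ℂ)
  have hpart : ∀ D : ℕ, (z : ℂ) + z * ∑ d ∈ range D, 1 / ((d + 1)! : ℂ) *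
      cavityTerm q (d + 1) κ (fun y => (rootedSeries q (chordSign y) 1 z : ℂ)) =
      ((∑ d ∈ range (D + 1), rootedSeries q κ (degreeIndicator d) z : ℝ) : ℂ) := fun D => by
    rw [Finset.sum_range_succ', hzero, Finset.mul_sum]
    push_cast
    rw [add_comm]
    congr 1
    exact Finset.sum_congr rfl fun d _ => (hterm (d + 1)).symm
  simp only [hpart] at hlim
  refine tendsto_nhds_unique ?_ hlim
  have hw : ∀ D n : ℕ, |(if n < D + 1 then 1 else 0 : ℝ)| ≤ 1 := fun D n => by
    split_ifs <;> simp
  -- Summing over root degrees up to `D` amounts to truncating the degree weight. Each coefficient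
  -- is eventually that of the full series, and `rootedCount` dominates.
  have hsum : ∀ D : ℕ, ∑ d ∈ range (D + 1), rootedSeries q κ (degreeIndicator d) z =
      rootedSeries q κ (fun n => if n < D + 1 then 1 else 0) z := fun D => by
    simp only [rootedSeries]
    rw [← Summable.tsum_finsetSum fun d _ =>
      (hz.summable_norm hκ1 (abs_degreeIndicator_le d)).of_norm]
    refine tsum_congr fun v => ?_
    rw [← Finset.sum_mul]
    congr 1
    simp only [rootedCoeff]
    rw [← Finset.sum_div, Finset.sum_comm]
    congr 1
    refine Finset.sum_congr rfl fun T _ => ?_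
    rw [Finset.sum_comm]
    refine Finset.sum_congr rfl fun a _ => ?_
    rw [← Finset.sum_mul]
    congr 1
    simp [degreeIndicator]
  simp only [hsum]
  refine (Complex.continuous_ofReal.tendsto _).comp ?_
  simp only [rootedSeries]
  refine tendsto_tsum_of_dominated_convergence hz.summable (fun v => ?_)
    (Eventually.of_forall fun D v => hz.norm_le hκ1 (hw D) v)
  refine tendsto_const_nhds.congr' ?_
  filter_upwards [eventually_ge_atTop v] with D hD
  rw [rootedCoeff_congr hq κ (w := 1) (w' := fun n => if n < D + 1 then 1 else 0)]
  intro n hn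
  rw [if_pos (by omega)]
  rfl

theorem IsSmall.isCavitySolution (hz : IsSmall q z) (hq : 2 ≤ q) (hqe : Even q) :
    IsCavitySolution q z fun x => (rootedSeries q (chordSign x) 1 z : ℂ) where
  measurable := Complex.measurable_ofReal.comp (hz.measurable_rootedSeries_chordSign hq)
  norm_le x := by
    rw [Complex.norm_real]
    exact hz.abs_rootedSeries_chordSign_le x
  fixedPoint x := hz.rootedSeries_eq hq hqe (measurable_chordSign_right x)
    fun y => (abs_chordSign x y).le

/-- The generating function of the hypertrees in terms of the Chord-Cavity-Generator. -/
theorem IsSmall.tsum_treeSum (hz : IsSmall q z) (hq : 2 ≤ q) (hqe : Even q)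
    {H : C(CCGDisc × Chord, ℂ)} (hH : IsCCG q H) {w : CCGDisc} (hw : (w : ℂ) = z) :
    ccgR q H w - ((q : ℂ) - 1) * ccgE q H w = ((∑' v, treeSum q v * z ^ v : ℝ) : ℂ) := by
  -- Uniqueness at the single point `w` identifies `H (w, ·)` with the tree series.
  have hHw : (fun x => H (w, x)) = fun x => (rootedSeries q (chordSign x) 1 z : ℂ) := by
    refine (isCCG_iff.1 hH w).unique ?_
    rw [hw]
    exact hz.isCavitySolution hq hqe
  have hone : ∀ n : ℕ, |(1 : ℕ → ℝ) n| ≤ 1 := fun n => by simp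
  have hone' : ∀ x : Chord, |(1 : Chord → ℝ) x| ≤ 1 := fun x => by simp
  have hR : ccgR q H w = (rootedSeries q 1 1 z : ℂ) := by
    rw [ccgR_eq, hHw, hw, ← hz.rootedSeries_eq (κ := 1) hq hqe measurable_const hone']
  have hE : ccgE q H w = ((1 / q * rootedSeries q 1 (fun n => n * (1 : ℕ → ℝ) n) z : ℝ) : ℂ) := by
    rw [hz.rootedSeries_mul_degree (κ := 1) hq hqe measurable_const hone' hone, ccgE]
    simp only [funext_iff] at hHw
    simp only [hHw]
    -- With trivial root weights all `q` branches at the marked edge have the same series, and `1 /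
    -- q` times `1 / (q - 1)!` is the `1 / q!` of `𝓔`.
    have h1 : ∀ y, (1 : Chord → ℝ) y * ∏ j : Fin q, rootedSeries q
        (branchKernel 1 ⟨0, by omega⟩ y j) (branchDegree 1 ⟨0, by omega⟩ j) z =
        rootedSeries q (chordSign y) 1 z ^ q := fun y => by
      rw [Finset.prod_congr rfl fun j _ => show rootedSeries q (branchKernel 1 ⟨0, by omega⟩ y j)
        (branchDegree 1 ⟨0, by omega⟩ j) z = rootedSeries q (chordSign y) 1 z from ?_]
      · simp
      · congr 1
        · funext x
          simp [branchKernel]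
        · funext n
          simp [branchDegree]
    simp only [h1]
    have h2 : ∀ y, (rootedSeries q (chordSign y) 1 z : ℂ) ^ q =
        ((rootedSeries q (chordSign y) 1 z ^ q : ℝ) : ℂ) := fun y => by push_cast; rfl
    simp only [h2]
    rw [integral_complex_ofReal]
    have h3 : (q ! : ℂ) = q * (q - 1)! := by
      exact_mod_cast (Nat.mul_factorial_pred (by omega : q ≠ 0)).symm
    push_cast
    rw [h3]
    have : ((q - 1)! : ℂ) ≠ 0 := by exact_mod_cast (q - 1).factorial_ne_zero
    have : (q : ℂ) ≠ 0 := by exact_mod_cast (by omega : q ≠ 0)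
    field_simp
  rw [hR, hE]
  have h4 : ∑' v, treeSum q v * z ^ v = rootedSeries q 1 1 z -
      ((q : ℝ) - 1) * (1 / q * rootedSeries q 1 (fun n => n * (1 : ℕ → ℝ) n) z) := by
    have hs1 := (hz.summable_norm (κ := 1) (w := 1) hone' hone).of_norm
    have hs2 := hz.summable_treeSum
    simp only [rootedSeries]
    rw [← tsum_mul_left, ← tsum_mul_left, eq_sub_iff_add_eq, ← eq_sub_iff_add_eq',
      ← hs1.tsum_sub hs2]
    refine tsum_congr fun v => ?_
    rw [← rootedCoeff_sub q hq v]
    simp only [Pi.one_apply]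
    ring
  rw [h4]
  push_cast
  ring

end Series

/-! ### Words in which each letter occurs twice, and independent chords -/

section OrderStatistics

set_option linter.unusedSectionVars false

/-- The factors count the pairs in which an endpoint of the first chord precedes one of the second.
This number is `1` or `3` for crossing chords and `0`, `2` or `4` otherwise. -/
theorem chordSign_min_max (p q r s : unitInterval) (h1 : p ≠ r) (h2 : p ≠ s) (h3 : q ≠ r)
    (h4 : q ≠ s) : chordSign (min p q, max p q) (min r s, max r s) =
      ((if p < r then -1 else 1) * (if p < s then -1 else 1)) *
        ((if q < r then -1 else 1) * (if q < s then -1 else 1)) := by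
  unfold chordSign
  rcases le_total p q with a | a <;> rcases le_total r s with b | b <;>
    simp only [min_eq_left, min_eq_right, max_eq_left, max_eq_right, a, b] <;>
    split_ifs <;> first | (norm_num; done) | (exfalso; grind)

theorem wordSign_ofFn {α : Type*} (η : α → α → ℝ) (e : α → ℕ) {k : ℕ} (f : Fin k → α) :
    wordSign η e (List.ofFn f) =
      ∏ i, ∏ j, if i < j then (if e (f j) < e (f i) then η (f i) (f j) else 1) else 1 := by
  induction k with
  | zero => simp [wordSign]
  | succ k ih =>
    rw [List.ofFn_succ, wordSign, ih, Fin.prod_univ_succ]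
    congr 1
    · rw [Fin.prod_univ_succ, List.map_ofFn, List.prod_ofFn]
      simp
    · refine Finset.prod_congr rfl fun i _ => ?_
      rw [Fin.prod_univ_succ]
      simp

theorem pairProd_eq_prod {α : Type*} [DecidableEq α] {k : α → α → ℝ} {hk : ∀ a b, k a b = k b a}
    {e : α → ℕ} (he : Function.Injective e) (hk1 : ∀ a, k a a = 1) (S : Finset α) :
    pairProd k hk S = ∏ a ∈ S, ∏ b ∈ S, if e b < e a then k a b else 1 := by
  induction S using Finset.induction_on with
  | empty => simp [pairProd_empty]
  | insert a S ha ih =>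
    rw [pairProd_insert ha, ih, hk1, one_mul, Finset.prod_insert ha, Finset.prod_insert ha,
      if_neg (lt_irrefl _), one_mul]
    have hp : ∀ f : α → ℝ, ∏ x ∈ insert a S, f x = f a * ∏ x ∈ S, f x := fun f =>
      Finset.prod_insert ha
    simp only [hp]
    have h2 : ∏ b ∈ S, k a b = (∏ b ∈ S, if e b < e a then k a b else 1) *
        ∏ b ∈ S, if e a < e b then k b a else 1 := by
      rw [← Finset.prod_mul_distrib]
      refine Finset.prod_congr rfl fun b hb => ?_
      rcases lt_trichotomy (e a) (e b) with h | h | h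
      · rw [if_neg h.not_gt, if_pos h, one_mul, hk]
      · exact absurd (he h ▸ hb) ha
      · rw [if_pos h, if_neg h.not_gt, mul_one]
    rw [h2, Finset.prod_mul_distrib, mul_assoc]

variable {V : Type*} [Fintype V] [DecidableEq V] {E : Finset (Finset V)}

/-- The hyperedge of an endpoint. -/
def edgeLabel (E : Finset (Finset V)) : E ⊕ E → Finset V := Sum.elim Subtype.val Subtype.val

theorem edgeLabel_inl (a : E) : edgeLabel E (Sum.inl a) = a.1 := by simp [edgeLabel]

theorem edgeLabel_inr (a : E) : edgeLabel E (Sum.inr a) = a.1 := by simp [edgeLabel]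

/-- The chords with given endpoints. -/
def chordsOfEndpoints (W : E ⊕ E → unitInterval) (e : E) : Chord :=
  (min (W (Sum.inl e)) (W (Sum.inr e)), max (W (Sum.inl e)) (W (Sum.inr e)))

theorem edgeSign_eq (a b : Finset V) : edgeSign a b = if Odd #(a ∩ b) then -1 else 1 := by
  rw [edgeSign]
  split_ifs with h
  · exact h.neg_one_pow
  · exact (Nat.not_odd_iff_even.1 h).neg_one_pow

/-- Read from left to right, the endpoints spell a word. Sorting it exchanges two letters once for
each inversion, and by `chordSign_min_max` the exchanges of two anticommuting letters multiply to
the crossing sign of their chords. -/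
theorem wordSign_edgeLabel {W : E ⊕ E → unitInterval} (hW : Function.Injective W) {k : ℕ}
    (π : Fin k ≃ E ⊕ E) (hπ : StrictMono fun i => W (π i)) :
    wordSign edgeSign edgeKey (List.ofFn fun i => edgeLabel E (π i)) =
      ∏ a : E, ∏ b : E, if edgeKey b.1 < edgeKey a.1 then
        (if Odd #(a.1 ∩ b.1) then chordSign (chordsOfEndpoints W a) (chordsOfEndpoints W b)
          else 1) else 1 := by
  have h1 : wordSign edgeSign edgeKey (List.ofFn fun i => edgeLabel E (π i)) =
      ∏ x, ∏ y, if W x < W y then (if edgeKey (edgeLabel E y) < edgeKey (edgeLabel E x) then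
        edgeSign (edgeLabel E x) (edgeLabel E y) else 1) else 1 := by
    rw [wordSign_ofFn, ← Equiv.prod_comp π]
    refine Finset.prod_congr rfl fun i _ => ?_
    rw [← Equiv.prod_comp π]
    refine Finset.prod_congr rfl fun j _ => ?_
    simp only [hπ.lt_iff_lt]
  rw [h1, Fintype.prod_sum_type]
  simp only [Fintype.prod_sum_type]
  rw [← Finset.prod_mul_distrib]
  refine Finset.prod_congr rfl fun a _ => ?_
  rw [← Finset.prod_mul_distrib, ← Finset.prod_mul_distrib, ← Finset.prod_mul_distrib]
  refine Finset.prod_congr rfl fun b _ => ?_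
  simp only [edgeLabel_inl, edgeLabel_inr]
  by_cases hab : edgeKey b.1 < edgeKey a.1
  · have hne : a ≠ b := fun h => by simp [h] at hab
    simp only [if_pos hab]
    rw [chordsOfEndpoints, chordsOfEndpoints, chordSign_min_max, edgeSign_eq]
    · by_cases ho : Odd #(a.1 ∩ b.1)
      · simp only [if_pos ho]
      · simp only [if_neg ho, ite_self, mul_one]
    all_goals
      refine fun h => hne ?_
      simpa using hW h
  · simp only [if_neg hab, ite_self, mul_one]

theorem crossingSign_eq_wordSign {v : ℕ} {E : Finset (Finset (Fin v))} (hE : ∀ e ∈ E, Even #e)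
    {W : E ⊕ E → unitInterval} (hW : Function.Injective W) {k : ℕ}
    (π : Fin k ≃ E ⊕ E) (hπ : StrictMono fun i => W (π i)) :
    crossingSign E (chordsOfEndpoints W) =
      wordSign edgeSign edgeKey (List.ofFn fun i => edgeLabel E (π i)) := by
  rw [wordSign_edgeLabel hW π hπ]
  have h := pairProd_eq_prod (α := E) (S := univ) (e := fun a => edgeKey a.1)
    (k := fun e f => if Odd #(e.1 ∩ f.1) then
      chordSign (chordsOfEndpoints W e) (chordsOfEndpoints W f) else 1)
    (hk := fun e f => by simp only [Finset.inter_comm e.1 f.1, chordSign_comm (_ : Chord)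
      (chordsOfEndpoints W f)])
    (fun a b hab => Subtype.ext (edgeKey_injective hab))
    (fun a => by
      simp only [Finset.inter_self]
      rw [if_neg (Nat.not_odd_iff_even.2 (hE a.1 a.2))])
  rw [← h, pairProd, Finset.sym2_univ]
  rfl

theorem card_sum_self : Fintype.card (E ⊕ E) = 2 * #E := by
  rw [Fintype.card_sum, Fintype.card_coe, two_mul]

theorem exists_sorting {W : E ⊕ E → unitInterval} (hW : Function.Injective W) :
    ∃ τ : Fin (2 * #E) ≃ E ⊕ E, StrictMono fun i => W (τ i) := by
  have hc : #(univ.image W) = 2 * #E := by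
    rw [Finset.card_image_of_injective _ hW, Finset.card_univ, card_sum_self]
  let o := (univ.image W).orderIsoOfFin hc
  let f : E ⊕ E → univ.image W := fun x => ⟨W x, Finset.mem_image_of_mem W (mem_univ x)⟩
  have hf : Function.Bijective f := by
    refine ⟨fun x y h => hW (congrArg Subtype.val h), fun ⟨y, hy⟩ => ?_⟩
    obtain ⟨x, -, hx⟩ := Finset.mem_image.1 hy
    exact ⟨x, Subtype.ext hx⟩
  refine ⟨o.toEquiv.trans (Equiv.ofBijective f hf).symm, fun i j hij => ?_⟩
  have h : ∀ i, W ((Equiv.ofBijective f hf).symm (o i)) = (o i).1 := fun i =>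
    congrArg Subtype.val ((Equiv.ofBijective f hf).apply_symm_apply (o i))
  change W ((Equiv.ofBijective f hf).symm (o i)) < W ((Equiv.ofBijective f hf).symm (o j))
  rw [h, h]
  exact o.strictMono hij

/-- Permuting a fixed set of distinct endpoints realizes every left-to-right order exactly once: the
order is the sorting `τ` followed by the inverse permutation. In particular the sum does not depend
on `W`. -/
theorem sum_perm_crossingSign {v : ℕ} {E : Finset (Finset (Fin v))} (hE : ∀ e ∈ E, Even #e)
    {W : E ⊕ E → unitInterval} (hW : Function.Injective W) :
    ∑ σ : Equiv.Perm (E ⊕ E), crossingSign E (chordsOfEndpoints (W ∘ σ)) =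
      ∑ π : Fin (2 * #E) ≃ E ⊕ E,
        wordSign edgeSign edgeKey (List.ofFn fun i => edgeLabel E (π i)) := by
  obtain ⟨τ, hτ⟩ := exists_sorting hW
  refine Fintype.sum_bijective (fun σ : Equiv.Perm (E ⊕ E) => τ.trans σ.symm) ⟨?_, ?_⟩ _ _ ?_
  · intro σ σ' h
    have : ∀ x, σ.symm x = σ'.symm x := fun x => by
      have := Equiv.congr_fun h (τ.symm x)
      simpa using this
    exact Equiv.symm_bijective.1 (Equiv.ext this)
  · exact fun π => ⟨π.symm.trans τ, by ext; simp⟩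
  · intro σ
    refine crossingSign_eq_wordSign hE (hW.comp σ.injective) _ fun i j hij => ?_
    simpa using hτ hij

theorem card_edgeLabel_fiber (a : Finset V) :
    Fintype.card {x : E ⊕ E // edgeLabel E x = a} = if a ∈ E then 2 else 0 := by
  rw [Fintype.card_subtype, Finset.card_filter, Fintype.sum_sum_type]
  simp only [edgeLabel_inl, edgeLabel_inr]
  have h : ∑ x : E, (if x.1 = a then 1 else 0) = if a ∈ E then 1 else 0 := by
    rw [Finset.sum_coe_sort E fun x => if x = a then 1 else 0, Finset.sum_ite_eq']
  rw [h]
  split_ifs <;> rfl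

/-- All `#E` letters occur at least twice in a word of length `2 * #E`, hence exactly twice. -/
theorem card_fiber_of_mem_evenWords {f : Fin (2 * #E) → Finset V} (hf : f ∈ evenWords E (2 * #E))
    (a : Finset V) : Fintype.card {i // f i = a} = if a ∈ E then 2 else 0 := by
  obtain ⟨h1, h2⟩ := mem_evenWords.1 hf
  rw [Fintype.card_subtype]
  split_ifs with ha
  · have hle : ∀ b ∈ E, 2 ≤ #{i | f i = b} := fun b hb => by
      rw [← h1] at hb
      obtain ⟨i, -, hi⟩ := Finset.mem_image.1 hb
      have hpos : 0 < #{i | f i = b} := Finset.card_pos.2 ⟨i, by simpa using hi⟩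
      obtain ⟨m, hm⟩ := h2 b
      omega
    have hsum : ∑ b ∈ E, 2 = ∑ b ∈ E, #{i | f i = b} := by
      have := Finset.card_eq_sum_card_image f univ
      rw [h1, Finset.card_univ, Fintype.card_fin] at this
      rw [← this, Finset.sum_const, smul_eq_mul, mul_comm]
    exact ((Finset.sum_eq_sum_iff_of_le hle).1 hsum a ha).symm
  · refine Finset.card_eq_zero.2 (Finset.filter_eq_empty_iff.2 fun i _ hi => ha ?_)
    rw [← h1, ← hi]
    exact Finset.mem_image_of_mem f (mem_univ i)

theorem edgeLabel_mem_evenWords (π : Fin (2 * #E) ≃ E ⊕ E) :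
    (fun i => edgeLabel E (π i)) ∈ evenWords E (2 * #E) := by
  rw [mem_evenWords]
  constructor
  · ext a
    simp only [Finset.mem_image, Finset.mem_univ, true_and]
    constructor
    · rintro ⟨i, rfl⟩
      rcases π i with x | x <;> exact x.2
    · exact fun ha => ⟨π.symm (Sum.inl ⟨a, ha⟩), by simp [edgeLabel]⟩
  · intro a
    rw [← Fintype.card_subtype, Fintype.card_congr (π.subtypeEquiv
      (q := fun x => edgeLabel E x = a) fun i => Iff.rfl), card_edgeLabel_fiber]
    split_ifs <;> decide

/-- For each letter one chooses which occurrence is the left copy. Formally, the lifts of a word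
correspond to the permutations of `E ⊕ E` that preserve the labels. -/
theorem card_edgeLabel_lifts {f : Fin (2 * #E) → Finset V} (hf : f ∈ evenWords E (2 * #E)) :
    #{π : Fin (2 * #E) ≃ E ⊕ E | (fun i => edgeLabel E (π i)) = f} = 2 ^ #E := by
  have hcard : ∀ a, Fintype.card {i // f i = a} = Fintype.card {x // edgeLabel E x = a} :=
    fun a => by rw [card_fiber_of_mem_evenWords hf, card_edgeLabel_fiber]
  let π₀ : Fin (2 * #E) ≃ E ⊕ E := Equiv.ofFiberEquiv fun a => Fintype.equivOfCardEq (hcard a)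
  have hπ₀ : ∀ i, edgeLabel E (π₀ i) = f i := fun i => Equiv.ofFiberEquiv_map _ i
  have h1 : ∏ a : Finset V, (Fintype.card {x : E ⊕ E // edgeLabel E x = a})! = 2 ^ #E := by
    rw [Finset.prod_congr rfl fun a _ => show _ = if a ∈ E then 2 else 1 by
      rw [card_edgeLabel_fiber]
      split_ifs <;> rfl]
    rw [Finset.prod_ite_mem, Finset.univ_inter, Finset.prod_const]
  rw [← h1, ← DomMulAct.stabilizer_card, ← Fintype.card_subtype]
  refine Fintype.card_congr (((Equiv.equivCongr π₀ (Equiv.refl _)).subtypeEquiv) fun π => ?_)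
  constructor
  · intro h
    funext x
    have := congrFun h (π₀.symm x)
    rw [← hπ₀, Equiv.apply_symm_apply] at this
    simpa [Equiv.equivCongr] using this
  · intro h
    funext i
    have := congrFun h (π₀ i)
    rw [hπ₀] at this
    simpa [Equiv.equivCongr] using this

theorem sum_edgeLabel (F : (Fin (2 * #E) → Finset V) → ℝ) :
    ∑ π : Fin (2 * #E) ≃ E ⊕ E, F (fun i => edgeLabel E (π i)) =
      2 ^ #E * ∑ f ∈ evenWords E (2 * #E), F f := by
  rw [← Finset.sum_fiberwise_of_maps_to (t := evenWords E (2 * #E))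
    (g := fun π : Fin (2 * #E) ≃ E ⊕ E => fun i => edgeLabel E (π i))
    fun π _ => edgeLabel_mem_evenWords π, Finset.mul_sum]
  refine Finset.sum_congr rfl fun f hf => ?_
  rw [Finset.sum_congr rfl fun π hπ => show _ = F f by rw [(Finset.mem_filter.1 hπ).2],
    Finset.sum_const, card_edgeLabel_lifts hf]
  simp

theorem measurePreserving_chordsOfEndpoints (E : Finset (Finset V)) :
    MeasurePreserving (chordsOfEndpoints (E := E))
      (Measure.pi fun _ => (volume : Measure unitInterval)) (chordsLaw E) := by
  have h0 : MeasurePreserving (fun u : unitInterval × unitInterval => (min u.1 u.2, max u.1 u.2))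
      (volume.prod volume) chordLaw := ⟨by fun_prop, rfl⟩
  have h1 := measurePreserving_pi (fun _ : E => (volume : Measure unitInterval).prod volume)
    (fun _ : E => chordLaw) (fun _ => h0)
  have h2 := (measurePreserving_arrowProdEquivProdArrow unitInterval unitInterval E
    (fun _ => volume) (fun _ => volume)).symm
  have h3 := measurePreserving_sumPiEquivProdPi
    (fun _ : E ⊕ E => (volume : Measure unitInterval))
  exact h1.comp (h2.comp h3)

theorem ae_injective {ι : Type*} [Fintype ι] :
    ∀ᵐ W ∂(Measure.pi fun _ : ι => (volume : Measure unitInterval)), Function.Injective W := by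
  have h : ∀ x y : ι, x ≠ y →
      ∀ᵐ W ∂(Measure.pi fun _ : ι => (volume : Measure unitInterval)), W x ≠ W y := by
    intro x y hxy
    have h1 : ProbabilityTheory.iIndepFun (fun (i : ι) (X : ι → unitInterval) => X i)
        (Measure.pi fun _ => volume) :=
      ProbabilityTheory.iIndepFun_pi (X := fun _ => id) fun _ => aemeasurable_id
    have h2 := (ProbabilityTheory.indepFun_iff_map_prod_eq_prod_map_map
      (measurable_pi_apply x).aemeasurable (measurable_pi_apply y).aemeasurable).1
      (h1.indepFun hxy)
    have h3 : ∀ i : ι, Measure.map (fun X : ι → unitInterval => X i)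
        (Measure.pi fun _ => volume) = volume := fun i =>
      (measurePreserving_eval (fun _ : ι => (volume : Measure unitInterval)) i).map_eq
    rw [h3, h3] at h2
    have h4 : ∀ᵐ p ∂((volume : Measure unitInterval).prod volume), p.1 ≠ p.2 := by
      have hd : MeasurableSet {p : unitInterval × unitInterval | p.1 = p.2} :=
        measurableSet_eq_fun measurable_fst measurable_snd
      rw [ae_iff]
      simp only [not_not]
      rw [Measure.measure_prod_null hd]
      refine Eventually.of_forall fun a => ?_
      have : Prod.mk a ⁻¹' {p : unitInterval × unitInterval | p.1 = p.2} = {a} := by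
        ext b
        simp [eq_comm]
      exact (congrArg volume this).trans (volume_unitInterval_singleton a)
    rw [← h2] at h4
    exact ae_of_ae_map (f := fun W : ι → unitInterval => (W x, W y))
      (p := fun p : unitInterval × unitInterval => p.1 ≠ p.2) (by fun_prop) h4
  have h5 : ∀ᵐ W ∂(Measure.pi fun _ : ι => (volume : Measure unitInterval)),
      ∀ x y, x ≠ y → W x ≠ W y := by
    rw [eventually_all]
    intro x
    rw [eventually_all]
    intro y
    by_cases hxy : x = y
    · exact Eventually.of_forall fun W h => absurd hxy h
    · exact (h x y hxy).mono fun W hW _ => hW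
  filter_upwards [h5] with W hW x y hxy
  by_contra hne
  exact hW x y hne hxy

theorem measurable_crossingSign {v : ℕ} (E : Finset (Finset (Fin v))) :
    Measurable (crossingSign E) := by
  unfold crossingSign
  refine Finset.measurable_prod _ fun p _ => ?_
  induction p using Sym2.ind with
  | _ e f =>
    simp only [Sym2.lift_mk]
    split_ifs
    · exact (measurable_pi_apply e).chordSign (measurable_pi_apply f)
    · exact measurable_const

theorem abs_crossingSign {v : ℕ} (E : Finset (Finset (Fin v))) (X : E → Chord) :
    |crossingSign E X| = 1 := by
  rw [crossingSign, Finset.abs_prod]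
  refine Finset.prod_eq_one fun p _ => ?_
  induction p using Sym2.ind with
  | _ e f =>
    simp only [Sym2.lift_mk]
    split_ifs
    · exact abs_chordSign _ _
    · exact abs_one

/-- The words in which each letter occurs twice describe the crossings of independent chords. -/
theorem wordCoeff_eq_crossingMean {v : ℕ} {E : Finset (Finset (Fin v))}
    (hE : ∀ e ∈ E, Even #e) :
    2 ^ #E * wordCoeff edgeSign edgeKey E (2 * #E) = (2 * #E)! * crossingMean E := by
  have hmp := measurePreserving_chordsOfEndpoints E
  set P : Measure (E ⊕ E → unitInterval) := Measure.pi fun _ => volume with hP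
  have hm : Measurable fun W : E ⊕ E → unitInterval => crossingSign E (chordsOfEndpoints W) :=
    (measurable_crossingSign E).comp hmp.measurable
  have h1 : crossingMean E = ∫ W, crossingSign E (chordsOfEndpoints W) ∂P := by
    change ∫ X, crossingSign E X ∂chordsLaw E = _
    rw [← hmp.map_eq, integral_map hmp.measurable.aemeasurable
      (measurable_crossingSign E).aestronglyMeasurable]
  -- Independent uniform endpoints are exchangeable, so every permutation gives the same mean.
  have h2 : ∀ σ : Equiv.Perm (E ⊕ E),
      ∫ W, crossingSign E (chordsOfEndpoints (W ∘ σ)) ∂P = crossingMean E := fun σ => by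
    have hσ := measurePreserving_pi_comp (volume : Measure unitInterval) σ.injective
    rw [h1, hP]
    conv_rhs => rw [← hσ.map_eq, integral_map hσ.measurable.aemeasurable hm.aestronglyMeasurable]
  have h3 : ∫ W, ∑ σ : Equiv.Perm (E ⊕ E), crossingSign E (chordsOfEndpoints (W ∘ σ)) ∂P =
      (2 * #E)! * crossingMean E := by
    rw [integral_finsetSum]
    · simp only [h2, Finset.sum_const, Finset.card_univ, Fintype.card_perm, card_sum_self,
        nsmul_eq_mul]
    · intro σ _
      refine Integrable.of_bound (C := 1) ?_ (Eventually.of_forall fun W =>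
        (abs_crossingSign E _).le)
      exact (hm.comp (measurePreserving_pi_comp (volume : Measure unitInterval)
        σ.injective).measurable).aestronglyMeasurable
  -- Almost surely the endpoints are distinct, and there the sum over permutations is a constant,
  -- the signed number of words times the number of lifts of each.
  have h4 : ∫ W, ∑ σ : Equiv.Perm (E ⊕ E), crossingSign E (chordsOfEndpoints (W ∘ σ)) ∂P =
      ∫ _, 2 ^ #E * wordCoeff edgeSign edgeKey E (2 * #E) ∂P := by
    refine integral_congr_ae ?_
    filter_upwards [ae_injective (ι := E ⊕ E)] with W hW
    rw [sum_perm_crossingSign hE hW,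
      sum_edgeLabel fun f => wordSign edgeSign edgeKey (List.ofFn f), wordCoeff]
  rw [← h3, h4]
  simp

end OrderStatistics

/-! ### Bounds on the coefficients -/

/-- A normalized sequence whose first `n` terms decay geometrically. -/
structure IsDominated (μ : ℕ → ℝ) (n : ℕ) : Prop where
  coeff_one : μ 1 = 1
  sum_le : ∑ v ∈ Icc 2 n, (v : ℝ) * |μ v| * 8 ^ v ≤ 1 / 8

/-- The larger radius absorbs the polynomial factor: `v ^ 2 ≤ 4 ^ v` and `4 * 2 = 8`. -/
theorem IsDominated.isNearId {μ : ℕ → ℝ} {n : ℕ} (h : IsDominated μ n) (hn : 1 ≤ n) :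
    IsNearId μ n := by
  refine ⟨hn, h.coeff_one, (Finset.sum_le_sum fun v _ => ?_).trans h.sum_le⟩
  have h1 : (v : ℝ) ^ 2 ≤ 4 ^ v := by
    have : (v : ℝ) ≤ 2 ^ v := by exact_mod_cast (Nat.lt_two_pow_self (n := v)).le
    calc (v : ℝ) ^ 2 ≤ (2 ^ v) ^ 2 := by gcongr
      _ = 4 ^ v := by rw [← pow_mul, mul_comm, pow_mul]; norm_num
  calc (v : ℝ) ^ 3 * |μ v| * 2 ^ v = v * |μ v| * (v ^ 2 * 2 ^ v) := by ring
    _ ≤ v * |μ v| * (4 ^ v * 2 ^ v) := by gcongr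
    _ = v * |μ v| * 8 ^ v := by rw [← mul_pow]; norm_num

theorem IsDominated.mul_abs_le {μ : ℕ → ℝ} {n v : ℕ} (h : IsDominated μ n) (hv : v ∈ Icc 1 n) :
    v * |μ v| ≤ 8 * (1 / 8) ^ v := by
  obtain ⟨hv1, hvn⟩ := Finset.mem_Icc.1 hv
  rcases hv1.eq_or_lt with rfl | hv2
  · simp [h.coeff_one]
  · have h1 : (v : ℝ) * |μ v| * 8 ^ v ≤ 1 / 8 :=
      (Finset.single_le_sum (f := fun v : ℕ => (v : ℝ) * |μ v| * 8 ^ v)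
        (fun _ _ => by positivity) (Finset.mem_Icc.2 ⟨hv2, hvn⟩)).trans h.sum_le
    rw [one_div, inv_pow, ← div_eq_mul_inv, le_div_iff₀ (by positivity)]
    linarith

theorem cosh_sub_one_le {s : ℝ} (hs : |s| ≤ 1) : Real.cosh s - 1 ≤ s ^ 2 := by
  have h0 : s ^ 2 ≤ 1 := by rw [← sq_abs]; exact pow_le_one₀ (abs_nonneg s) hs
  have h1 := (Real.cosh_le_exp_half_sq s).trans
    (Real.exp_bound_div_one_sub_of_interval (by positivity) (by linarith))
  have h2 : 1 / (1 - s ^ 2 / 2) ≤ 1 + s ^ 2 := by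
    rw [div_le_iff₀ (by linarith)]
    nlinarith [sq_nonneg s]
  linarith

theorem abs_clusterWeight_le (q : ℕ) (s : ℝ) (v : ℕ) :
    |clusterWeight q s v| ≤ connectedWeight q (Real.cosh s - 1) v :=
  (Finset.abs_sum_le_sum_abs _ _).trans
    (Finset.sum_le_sum fun G _ => abs_wordSum_le abs_edgeSign edgeKey_injective G s)

theorem clusterCoeff_one {q : ℕ} (hq : 2 ≤ q) (n : ℕ) (s : ℝ) : clusterCoeff q n s 1 = 1 := by
  simp [clusterCoeff, clusterWeight, connectedOn_singleton hq, wordSum_empty]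

/-- Without signs each edge has weight `cosh s - 1 ≤ s ^ 2`, so smallness of `s ^ 2 * n ^ (q - 1)`
is what the bound on connected hypergraphs requires. -/
theorem isDominated_clusterCoeff {q n : ℕ} {κ s : ℝ} (hq : 2 ≤ q) (hn : 1 ≤ n)
    (hκ : ∀ n : ℕ, 1 ≤ n → ∀ lam : ℝ, 0 ≤ lam → lam * (n : ℝ) ^ (q - 1) ≤ κ →
      rootedWeightSum q 8 n lam ≤ 1 / 8)
    (hs : |s| ≤ 1) (hsn : s ^ 2 * (n : ℝ) ^ (q - 1) ≤ κ) : IsDominated (clusterCoeff q n s) n := by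
  refine ⟨clusterCoeff_one hq n s, ?_⟩
  refine le_trans (Finset.sum_le_sum fun v _ => ?_) (hκ n hn (Real.cosh s - 1)
    (by linarith [Real.one_le_cosh s])
    ((mul_le_mul_of_nonneg_right (cosh_sub_one_le hs) (by positivity)).trans hsn))
  rw [clusterCoeff, abs_div, abs_mul, Nat.abs_cast, abs_pow, Nat.abs_cast]
  have := abs_clusterWeight_le q s v
  calc (v : ℝ) * (|clusterWeight q s v| * n ^ (v - 1) / v !) * 8 ^ v
      = v * |clusterWeight q s v| * n ^ (v - 1) * 8 ^ v / v ! := by ring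
    _ ≤ _ := by gcongr

/-- The bound on connected hypergraphs controls the hypertrees. -/
theorem sum_rootedCount_le {q n : ℕ} {b : ℝ} (hn : 1 ≤ n) (hb : 0 ≤ b)
    (hκ : ∀ n : ℕ, 1 ≤ n → ∀ lam : ℝ, 0 ≤ lam → lam * (n : ℝ) ^ (q - 1) ≤ b ^ (q - 1) →
      rootedWeightSum q 8 n lam ≤ 1 / 8) :
    ∑ v ∈ Icc 2 n, rootedCount q v * b ^ (v - 1) * 8 ^ v ≤ 1 / 8 := by
  have hn0 : (0 : ℝ) < n := by exact_mod_cast hn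
  -- With the edge weight `(b / n) ^ (q - 1)` a tree on `v` nodes weighs `(b / n) ^ (v - 1)`, which
  -- cancels the powers of `n` in `rootedWeightSum`.
  refine le_trans (Finset.sum_le_sum fun v hv => ?_) (hκ n hn ((b / n) ^ (q - 1)) (by positivity)
    (by rw [← mul_pow, div_mul_cancel₀ _ hn0.ne']))
  have h1 : #(treesOn q (univ : Finset (Fin v))) * (b / n) ^ (v - 1) ≤
      connectedWeight q ((b / n) ^ (q - 1)) v := by
    rw [← nsmul_eq_mul, ← Finset.sum_const]
    refine (Finset.sum_le_sum fun G hG => ?_).trans (Finset.sum_le_sum_of_subset_of_nonneg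
      (Finset.filter_subset _ _) fun _ _ _ => by positivity)
    have := (mem_treesOn.1 hG).2
    rw [Finset.card_univ, Fintype.card_fin] at this
    rw [← pow_mul, mul_comm, show #G * (q - 1) = v - 1 by omega]
  calc rootedCount q v * b ^ (v - 1) * 8 ^ v
      = v * (#(treesOn q (univ : Finset (Fin v))) * (b / n) ^ (v - 1)) * n ^ (v - 1) * 8 ^ v / v ! := by
        rw [rootedCount, div_pow]
        field_simp
    _ ≤ _ := by gcongr

/-- The single node contributes `z ≤ 1 / 2`, and for `v ≥ 2` the bound `z ^ v ≤ b ^ (v - 1)` reduces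
the rest to `1 / 8`. -/
theorem isSmall_of_sum_rootedCount_le {q : ℕ} {b z : ℝ} (hq : 2 ≤ q) (hz : 0 ≤ z) (hzb : z ≤ b)
    (hz2 : z ≤ 1 / 2)
    (h : ∀ n : ℕ, 1 ≤ n → ∑ v ∈ Icc 2 n, rootedCount q v * b ^ (v - 1) * 8 ^ v ≤ 1 / 8) :
    IsSmall q z := by
  have hr : ∀ n, ∑ v ∈ range n, rootedCount q v * z ^ v ≤ 1 := fun n => by
    have h1 : ∑ v ∈ range n, rootedCount q v * z ^ v ≤
        ∑ v ∈ range (n + 2), rootedCount q v * z ^ v :=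
      Finset.sum_le_sum_of_subset_of_nonneg (Finset.range_mono (by omega)) fun v _ _ =>
        mul_nonneg (rootedCount_nonneg q v) (by positivity)
    have h2 : range (n + 2) = insert 0 (insert 1 (Icc 2 (n + 1))) := by
      ext k
      simp only [Finset.mem_range, Finset.mem_insert, Finset.mem_Icc]
      omega
    rw [h2, Finset.sum_insert (by simp), Finset.sum_insert (by simp)] at h1
    have h3 : ∑ v ∈ Icc 2 (n + 1), rootedCount q v * z ^ v ≤ 1 / 8 := by
      refine le_trans (Finset.sum_le_sum fun v hv => ?_) (h (n + 1) (by omega))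
      have hv := (Finset.mem_Icc.1 hv).1
      have h4 : z ^ v ≤ b ^ (v - 1) * 1 := by
        rw [← Nat.sub_add_cancel (show 1 ≤ v by omega), pow_succ, Nat.add_sub_cancel]
        have := hz.trans hzb
        gcongr
        linarith
      rw [mul_assoc]
      refine mul_le_mul_of_nonneg_left (h4.trans ?_) (rootedCount_nonneg q v)
      have := hz.trans hzb
      gcongr
      exact one_le_pow₀ (by norm_num)
    have h5 : rootedCount q 0 = 0 := by simp [rootedCount]
    have h6 : rootedCount q 1 = 1 := by rw [rootedCount, treesOn_univ_one hq]; simp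
    rw [h5, h6] at h1
    simp only [zero_mul, pow_one, one_mul, zero_add] at h1
    linarith
  have hs := summable_of_sum_range_le
    (fun v => mul_nonneg (rootedCount_nonneg q v) (pow_nonneg hz v)) hr
  exact ⟨hz, hs, hs.tsum_le_of_sum_range_le hr⟩

theorem treeCoeff_one {q : ℕ} (hq : 2 ≤ q) (β : ℝ) : treeCoeff q β 1 = 1 := by
  have : crossingMean (∅ : Finset (Finset (Fin 1))) = 1 := by
    simp [crossingMean, crossingSign]
  rw [treeCoeff_eq, treeSum, treesOn_univ_one hq]
  simp [this]

theorem sykRho_nonneg (q : ℕ) (β : ℝ) : 0 ≤ sykRho q β := by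
  unfold sykRho
  positivity

theorem isDominated_treeCoeff {q : ℕ} {b β : ℝ} (hq : 2 ≤ q) (hβ : sykRho q β ≤ b)
    (h : ∀ n : ℕ, 1 ≤ n → ∑ v ∈ Icc 2 n, rootedCount q v * b ^ (v - 1) * 8 ^ v ≤ 1 / 8)
    {n : ℕ} (hn : 1 ≤ n) : IsDominated (treeCoeff q β) n := by
  refine ⟨treeCoeff_one hq β, (Finset.sum_le_sum fun v _ => ?_).trans (h n hn)⟩
  have h0 := sykRho_nonneg q β
  have h1 := mul_abs_treeSum_le q v
  have h2 := rootedCount_nonneg q v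
  rw [treeCoeff_eq, abs_mul, abs_of_nonneg (pow_nonneg h0 _), ← mul_assoc]
  gcongr

/-! ### The limit of the coefficients -/

/-- A connected hypergraph with `k` edges contributes to order `u ^ (2 k) * n ^ (v - 1)`, that is,
`n ^ (v - 1 - k (q - 1))`. The exponent is never positive, and it is `0` exactly for hypertrees. -/
theorem tendsto_clusterCoeff {q v : ℕ} {r : ℝ} {u : ℕ → ℝ} (hqe : Even q) (hv : 1 ≤ v)
    (hu : Tendsto u atTop (𝓝 0)) (hu0 : ∀ᶠ n in atTop, u n ≠ 0)
    (hur : ∀ᶠ n : ℕ in atTop, u n ^ 2 * (n : ℝ) ^ (q - 1) = 2 * r ^ (q - 1)) :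
    Tendsto (fun n => clusterCoeff q n (u n) v) atTop (𝓝 (treeSum q v * r ^ (v - 1))) := by
  have hsum : treeSum q v * r ^ (v - 1) = ∑ G ∈ connectedOn q (univ : Finset (Fin v)),
      (if #G * (q - 1) + 1 = v then crossingMean G * r ^ (v - 1) / v ! else 0) := by
    rw [← Finset.sum_filter, treeSum, treesOn, Finset.sum_div, Finset.sum_mul]
    simp only [Finset.card_univ, Fintype.card_fin]
    exact Finset.sum_congr rfl fun G _ => by ring
  simp only [hsum, clusterCoeff, clusterWeight, Finset.sum_mul, Finset.sum_div]
  refine tendsto_finsetSum _ fun G hG => ?_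
  have hle : v ≤ #G * (q - 1) + 1 := by simpa using card_le_of_mem_connectedOn hG
  have heven : ∀ e ∈ G, Even #e := fun e he => ((mem_connectedOn.1 hG).1 e he).2 ▸ hqe
  set k := #G * (q - 1) + 1 - v with hk
  have h1 : ∀ᶠ n : ℕ in atTop, wordSum edgeSign edgeKey G (u n) / u n ^ (2 * #G) *
      ((2 * r ^ (q - 1)) ^ #G * (n : ℝ)⁻¹ ^ k / v !) =
        wordSum edgeSign edgeKey G (u n) * (n : ℝ) ^ (v - 1) / v ! := by
    filter_upwards [hu0, hur, eventually_ge_atTop 1] with n hn0 hnr hn1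
    have hn : (n : ℝ) ≠ 0 := by positivity
    have h2 : (n : ℝ) ^ ((q - 1) * #G) = n ^ (v - 1) * n ^ k := by
      rw [← pow_add]
      congr 1
      rw [mul_comm]
      omega
    rw [← hnr, mul_pow, ← pow_mul, ← pow_mul, h2, inv_pow]
    field_simp
  refine Tendsto.congr' h1 ?_
  have h3 := tendsto_wordSum_div abs_edgeSign edgeKey G hu hu0
  have h4 := wordCoeff_eq_crossingMean heven
  split_ifs with hG1
  · have hk0 : k = 0 := by omega
    -- The `2` in `2 * r ^ (q - 1)` yields the `2 ^ #G` that `wordCoeff_eq_crossingMean` needs.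
    have h5 : wordCoeff edgeSign edgeKey G (2 * #G) / ((2 * #G)! : ℝ) *
        ((2 * r ^ (q - 1)) ^ #G / v !) = crossingMean G * r ^ (v - 1) / v ! := by
      have h6 : v - 1 = (q - 1) * #G := by rw [mul_comm]; omega
      rw [mul_pow, h6, pow_mul]
      have : ((2 * #G)! : ℝ) ≠ 0 := by positivity
      field_simp
      linear_combination (r ^ (q - 1)) ^ #G * h4
    rw [← h5]
    simpa [hk0] using h3.mul_const ((2 * r ^ (q - 1)) ^ #G / (v ! : ℝ))
  · have hk0 : k ≠ 0 := by omega
    have h6 : Tendsto (fun n : ℕ => (n : ℝ)⁻¹ ^ k) atTop (𝓝 0) := by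
      simpa [hk0] using (tendsto_inv_atTop_nhds_zero_nat (𝕜 := ℝ)).pow k
    have h7 := h3.mul ((h6.const_mul ((2 * r ^ (q - 1)) ^ #G)).div_const (v ! : ℝ))
    simpa using h7

/-! ### Series with dominated coefficients -/

theorem sum_Icc_one_eq_sum_range (F : ℕ → ℝ) (n : ℕ) :
    ∑ v ∈ Icc 1 n, F v = ∑ v ∈ range n, F (v + 1) := by
  induction n with
  | zero => simp
  | succ n ih => rw [Finset.sum_Icc_succ_top (by omega), ih, Finset.sum_range_succ]

/-- Domination gives `v * |μ n v| ≤ 8 * 8 ^ (-v)`, so the terms are at most `8 * 4 ^ (-v)` and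
dominated convergence applies. -/
theorem tendsto_sum_of_isDominated {μ : ℕ → ℕ → ℝ} {ν c : ℕ → ℝ}
    (hμ : ∀ᶠ n in atTop, IsDominated (μ n) n)
    (hlim : ∀ v, 1 ≤ v → Tendsto (fun n => μ n v) atTop (𝓝 (ν v)))
    (hc : ∀ v, 1 ≤ v → |c v| ≤ v * 2 ^ v) :
    Tendsto (fun n => ∑ v ∈ Icc 1 n, μ n v * c v) atTop (𝓝 (∑' v, ν (v + 1) * c (v + 1))) := by
  have h1 : ∀ n, ∑ v ∈ Icc 1 n, μ n v * c v =
      ∑' v, if v < n then μ n (v + 1) * c (v + 1) else 0 := fun n => by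
    rw [sum_Icc_one_eq_sum_range fun v => μ n v * c v, tsum_eq_sum (s := range n)]
    · exact Finset.sum_congr rfl fun v hv => (if_pos (Finset.mem_range.1 hv)).symm
    · exact fun v hv => if_neg (by simpa using hv)
  simp only [h1]
  refine tendsto_tsum_of_dominated_convergence (bound := fun v => 2 * (1 / 4 : ℝ) ^ v)
    ((summable_geometric_of_lt_one (by norm_num) (by norm_num)).mul_left 2) (fun v => ?_) ?_
  · refine ((hlim (v + 1) (by omega)).mul_const (c (v + 1))).congr' ?_
    filter_upwards [eventually_gt_atTop v] with n hn
    rw [if_pos hn]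
  · filter_upwards [hμ] with n hn v
    split_ifs with hv
    · have h2 := hn.mul_abs_le (v := v + 1) (Finset.mem_Icc.2 ⟨by omega, hv⟩)
      have h3 := hc (v + 1) (by omega)
      rw [Real.norm_eq_abs, abs_mul]
      calc |μ n (v + 1)| * |c (v + 1)| ≤ |μ n (v + 1)| * (((v + 1 : ℕ) : ℝ) * 2 ^ (v + 1)) := by
            gcongr
        _ = ((v + 1 : ℕ) : ℝ) * |μ n (v + 1)| * 2 ^ (v + 1) := by ring
        _ ≤ 8 * (1 / 8) ^ (v + 1) * 2 ^ (v + 1) := by gcongr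
        _ = 2 * (1 / 4) ^ v := by
          rw [mul_assoc, ← mul_pow, pow_succ]
          norm_num
          ring
    · rw [norm_zero]
      positivity

/-- The function `t ↦ t Φ'(t)`. -/
def logDerivSeries (μ : ℕ → ℝ) (t : ℝ) : ℝ := ∑' v : ℕ, μ (v + 1) * (((v + 1 : ℕ) : ℝ) * t ^ (v + 1))

theorem abs_mul_pow_le_two {t : ℝ} (ht : t ∈ Set.Icc (0 : ℝ) 2) (v : ℕ) :
    |(v : ℝ) * t ^ v| ≤ v * 2 ^ v := by
  rw [abs_mul, abs_pow, abs_of_nonneg ht.1, Nat.abs_cast]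
  have := ht.1
  have := ht.2
  gcongr

theorem tendsto_logDerivSum {μ : ℕ → ℕ → ℝ} {ν : ℕ → ℝ}
    (hμ : ∀ᶠ n in atTop, IsDominated (μ n) n)
    (hlim : ∀ v, 1 ≤ v → Tendsto (fun n => μ n v) atTop (𝓝 (ν v))) {t : ℝ}
    (ht : t ∈ Set.Icc (0 : ℝ) 2) :
    Tendsto (fun n => logDerivSum (μ n) n t) atTop (𝓝 (logDerivSeries ν t)) :=
  tendsto_sum_of_isDominated hμ hlim fun v _ => abs_mul_pow_le_two ht v

theorem tendsto_truncPhiReal {μ : ℕ → ℕ → ℝ} {ν : ℕ → ℝ}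
    (hμ : ∀ᶠ n in atTop, IsDominated (μ n) n)
    (hlim : ∀ v, 1 ≤ v → Tendsto (fun n => μ n v) atTop (𝓝 (ν v))) {t : ℝ}
    (ht : t ∈ Set.Icc (0 : ℝ) 2) :
    Tendsto (fun n => truncPhiReal (μ n) n t) atTop (𝓝 (∑' v, ν (v + 1) * t ^ (v + 1))) := by
  refine tendsto_sum_of_isDominated hμ hlim fun v hv => ?_
  rw [abs_pow, abs_of_nonneg ht.1]
  exact (pow_le_pow_left₀ ht.1 ht.2 v).trans
    (le_mul_of_one_le_left (by positivity) (by exact_mod_cast hv))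

section Series

variable {μ : ℕ → ℝ}

theorem tendsto_logDerivSum_self (hμ : ∀ n, 1 ≤ n → IsDominated μ n) {t : ℝ}
    (ht : t ∈ Set.Icc (0 : ℝ) 2) :
    Tendsto (fun n => logDerivSum μ n t) atTop (𝓝 (logDerivSeries μ t)) :=
  tendsto_logDerivSum ((eventually_ge_atTop 1).mono hμ) (fun _ _ => tendsto_const_nhds) ht

theorem abs_logDerivSeries_sub_le (hμ : ∀ n, 1 ≤ n → IsDominated μ n) {t : ℝ}
    (ht : t ∈ Set.Icc (0 : ℝ) 2) : |logDerivSeries μ t - t| ≤ 1 / 8 := by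
  refine le_of_tendsto ((tendsto_logDerivSum_self hμ ht).sub_const t).abs ?_
  filter_upwards [eventually_ge_atTop 1] with n hn
  exact ((hμ n hn).isNearId hn).abs_logDerivSum_sub_le ht

theorem abs_logDerivSeries_sub_sub_le (hμ : ∀ n, 1 ≤ n → IsDominated μ n) {x y : ℝ}
    (hx : x ∈ Set.Icc (0 : ℝ) 2) (hy : y ∈ Set.Icc (0 : ℝ) 2) :
    |logDerivSeries μ x - logDerivSeries μ y - (x - y)| ≤ |x - y| / 8 := by
  refine le_of_tendsto (((tendsto_logDerivSum_self hμ hx).sub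
    (tendsto_logDerivSum_self hμ hy)).sub_const (x - y)).abs ?_
  filter_upwards [eventually_ge_atTop 1] with n hn
  exact ((hμ n hn).isNearId hn).logDerivSum_sub hx hy

theorem exists_logDerivSeries_eq_one (hμ : ∀ n, 1 ≤ n → IsDominated μ n) :
    ∃ t ∈ Set.Ioo (1 / 2 : ℝ) (3 / 2), logDerivSeries μ t = 1 := by
  have hsub : Set.Icc (1 / 2 : ℝ) (3 / 2) ⊆ Set.Icc 0 2 := Set.Icc_subset_Icc (by norm_num)
    (by norm_num)
  have hcont : ContinuousOn (logDerivSeries μ) (Set.Icc (1 / 2) (3 / 2)) := by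
    refine LipschitzOnWith.continuousOn (K := 2) (LipschitzOnWith.of_dist_le_mul fun x hx y hy => ?_)
    have h := abs_le.1 (abs_logDerivSeries_sub_sub_le hμ (hsub hx) (hsub hy))
    rw [Real.dist_eq, Real.dist_eq, abs_le]
    have := le_abs_self (x - y)
    have := neg_abs_le (x - y)
    constructor <;> norm_num <;> linarith [abs_nonneg (x - y), h.1, h.2]
  have h1 := abs_le.1 (abs_logDerivSeries_sub_le hμ (hsub (Set.left_mem_Icc.2 (by norm_num))))
  have h2 := abs_le.1 (abs_logDerivSeries_sub_le hμ (hsub (Set.right_mem_Icc.2 (by norm_num))))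
  exact intermediate_value_Ioo (by norm_num) hcont
    ⟨by linarith [h1.2], by linarith [h2.1]⟩

theorem eq_of_logDerivSeries_eq (hμ : ∀ n, 1 ≤ n → IsDominated μ n) {x y : ℝ}
    (hx : x ∈ Set.Icc (0 : ℝ) 2) (hy : y ∈ Set.Icc (0 : ℝ) 2)
    (hxy : logDerivSeries μ x = logDerivSeries μ y) : x = y := by
  have h := abs_logDerivSeries_sub_sub_le hμ hx hy
  rw [hxy, sub_self, zero_sub, abs_neg] at h
  exact sub_eq_zero.1 (abs_nonpos_iff.1 (by linarith))

theorem norm_coeff_mul_pow_le (hμ : ∀ n, 1 ≤ n → IsDominated μ n) {z : ℂ} (hz : ‖z‖ ≤ 4) (v : ℕ) :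
    ‖(μ (v + 1) : ℂ) * z ^ (v + 1)‖ ≤ 4 * (1 / 2) ^ v := by
  have h1 := (hμ (v + 1) (by omega)).mul_abs_le (v := v + 1) (Finset.mem_Icc.2 ⟨by omega, le_rfl⟩)
  have h2 : |μ (v + 1)| ≤ 8 * (1 / 8) ^ (v + 1) :=
    (le_mul_of_one_le_left (abs_nonneg _) (by norm_num)).trans h1
  rw [norm_mul, norm_pow, Complex.norm_real, Real.norm_eq_abs]
  calc |μ (v + 1)| * ‖z‖ ^ (v + 1) ≤ 8 * (1 / 8) ^ (v + 1) * 4 ^ (v + 1) := by gcongr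
    _ = 4 * (1 / 2) ^ v := by
      rw [mul_assoc, ← mul_pow, pow_succ]
      norm_num
      ring

theorem summable_bound : Summable fun v : ℕ => 4 * (1 / 2 : ℝ) ^ v :=
  (summable_geometric_of_lt_one (by norm_num) (by norm_num)).mul_left 4

theorem summable_coeff_mul_pow (hμ : ∀ n, 1 ≤ n → IsDominated μ n) {z : ℂ} (hz : ‖z‖ ≤ 4) :
    Summable fun v : ℕ => (μ (v + 1) : ℂ) * z ^ (v + 1) :=
  Summable.of_norm_bounded summable_bound (norm_coeff_mul_pow_le hμ hz)

theorem analyticOnNhd_tsum_coeff (hμ : ∀ n, 1 ≤ n → IsDominated μ n) :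
    AnalyticOnNhd ℂ (fun z : ℂ => ∑' v : ℕ, (μ (v + 1) : ℂ) * z ^ (v + 1)) (Metric.ball 0 4) :=
  (Complex.differentiableOn_tsum_of_summable_norm summable_bound
    (fun _ => by fun_prop) Metric.isOpen_ball fun v z hz =>
      norm_coeff_mul_pow_le hμ (mem_ball_zero_iff.1 hz).le v).analyticOnNhd Metric.isOpen_ball

theorem mul_deriv_tsum_coeff (hμ : ∀ n, 1 ≤ n → IsDominated μ n) {t : ℝ}
    (ht : t ∈ Set.Icc (0 : ℝ) 2) :
    (t : ℂ) * deriv (fun z : ℂ => ∑' v : ℕ, (μ (v + 1) : ℂ) * z ^ (v + 1)) t =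
      (logDerivSeries μ t : ℂ) := by
  have hmem : (t : ℂ) ∈ Metric.ball (0 : ℂ) 4 := by
    rw [mem_ball_zero_iff, Complex.norm_real, Real.norm_eq_abs, abs_of_nonneg ht.1]
    linarith [ht.2]
  have h := Complex.hasSum_deriv_of_summable_norm summable_bound
    (F := fun (v : ℕ) (z : ℂ) => (μ (v + 1) : ℂ) * z ^ (v + 1))
    (fun v => by fun_prop) Metric.isOpen_ball
    (fun v z hz => norm_coeff_mul_pow_le hμ (mem_ball_zero_iff.1 hz).le v) hmem
  rw [← h.tsum_eq, ← tsum_mul_left, logDerivSeries, Complex.ofReal_tsum]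
  refine tsum_congr fun v => ?_
  rw [deriv_const_mul_field, deriv_pow_field]
  push_cast
  ring

end Series

/-! ### The parameters -/

theorem sykRho_pow {q : ℕ} (hq : 2 ≤ q) (β : ℝ) :
    sykRho q β ^ (q - 1) = ((q - 1)! : ℝ) * β ^ 2 / 2 ^ (q + 1) := by
  have h : (1 / ((q : ℝ) - 1)) * ((q - 1 : ℕ) : ℝ) = 1 := by
    rw [Nat.cast_sub (by omega), Nat.cast_one, one_div, inv_mul_cancel₀]
    have : (2 : ℝ) ≤ q := by exact_mod_cast hq
    linarith
  rw [sykRho, ← Real.rpow_natCast, ← Real.rpow_mul (by positivity), h, Real.rpow_one]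

theorem sykRho_pos (q : ℕ) {β : ℝ} (hβ : β ≠ 0) : 0 < sykRho q β :=
  Real.rpow_pos_of_pos (by positivity) _

theorem exists_sykRho_le {q : ℕ} (hq : 2 ≤ q) {ε : ℝ} (hε : 0 < ε) :
    ∃ βstar : ℝ, 0 < βstar ∧ ∀ β : ℝ, |β| ≤ βstar → sykRho q β ≤ ε := by
  have hq1 : (0 : ℝ) < 1 / ((q : ℝ) - 1) := by
    have : (2 : ℝ) ≤ q := by exact_mod_cast hq
    exact one_div_pos.2 (by linarith)
  have hcont : Continuous (sykRho q) :=
    (by fun_prop : Continuous fun β : ℝ => ((q - 1)! : ℝ) * β ^ 2 / 2 ^ (q + 1)).rpow_const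
      fun _ => Or.inr hq1.le
  have h0 : sykRho q 0 = 0 := by
    rw [sykRho, zero_pow two_ne_zero, mul_zero, zero_div, Real.zero_rpow hq1.ne']
  obtain ⟨δ, hδ, h⟩ := Metric.continuousAt_iff.1 hcont.continuousAt ε hε
  refine ⟨δ / 2, by linarith, fun β hβ => ?_⟩
  have := h (x := β) (by rw [Real.dist_eq, sub_zero]; linarith)
  rw [h0, Real.dist_eq, sub_zero] at this
  exact (le_abs_self _).trans this.le

/-- The definition of `ρ` is made for this: both sides equal `(q - 1)! β² / 2 ^ q`, independently of
`n`. -/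
theorem sykParam_sq_mul {n q : ℕ} (hq : 2 ≤ q) (hqe : Even q) (hn : 1 ≤ n) (β : ℝ) :
    sykParam n q β ^ 2 * (n : ℝ) ^ (q - 1) = 2 * sykRho q β ^ (q - 1) := by
  have hn0 : (0 : ℝ) < n := by exact_mod_cast hn
  have h2 : ((2 : ℝ) ^ (q / 2)) ^ 2 = 2 ^ q := by
    rw [← pow_mul, Nat.div_mul_cancel hqe.two_dvd]
  rw [sykRho_pow hq, sykParam, couplingScale, div_pow, mul_pow, Real.sq_sqrt (by positivity), h2,
    pow_succ 2 q]
  field_simp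

theorem tendsto_sykParam {q : ℕ} (hq : 2 ≤ q) (hqe : Even q) (β : ℝ) :
    Tendsto (fun n => sykParam n q β) atTop (𝓝 0) := by
  rw [tendsto_zero_iff_abs_tendsto_zero]
  have h1 : Tendsto (fun n : ℕ => √(2 * sykRho q β ^ (q - 1) / (n : ℝ) ^ (q - 1))) atTop (𝓝 0) := by
    have h2 : Tendsto (fun n : ℕ => (n : ℝ) ^ (q - 1)) atTop atTop :=
      (tendsto_pow_atTop (by omega)).comp tendsto_natCast_atTop_atTop
    simpa using (Tendsto.const_div_atTop h2 (2 * sykRho q β ^ (q - 1))).sqrt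
  refine h1.congr' ?_
  filter_upwards [eventually_ge_atTop 1] with n hn
  have hn0 : (0 : ℝ) < n := by exact_mod_cast hn
  rw [← sykParam_sq_mul hq hqe hn, mul_div_cancel_right₀ _ (by positivity), Real.sqrt_sq_eq_abs]
  rfl

theorem sykParam_ne_zero {n q : ℕ} {β : ℝ} (hβ : β ≠ 0) (hn : 1 ≤ n) : sykParam n q β ≠ 0 := by
  have hn0 : (0 : ℝ) < n := by exact_mod_cast hn
  unfold sykParam couplingScale
  positivity

/-! ### The free energy -/

theorem clusterPartition_univ_eq {m q : ℕ} (hq : 0 < q) (hqe : Even q)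
    {ψ : Fin (2 * m) → Matrix (Qubits m) (Qubits m) ℂ} (hψ : IsMajorana ψ) (s : ℝ) :
    ((clusterPartition q s (univ : Finset (Fin (2 * m))) * ((2 * m : ℕ) : ℝ) ^ (2 * m) : ℝ) : ℂ) =
      iteratedDeriv (2 * m)
        (fun z => Complex.exp ((2 * m : ℕ) * truncPhi (clusterCoeff q (2 * m) s) (2 * m) z)) 0 := by
  -- The matrices only realize the commutation signs; any complete algebra norm would do.
  let _ : NormedRing (Matrix (Qubits m) (Qubits m) ℂ) := Matrix.linftyOpNormedRing
  let _ : NormedAlgebra ℝ (Matrix (Qubits m) (Qubits m) ℂ) := Matrix.linftyOpNormedAlgebra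
  have := clusterPartition_eq_iteratedDeriv hq (isInvolutive_majoranaInvolution hqe hψ) s univ
  simpa only [Finset.card_univ, Fintype.card_fin] using this

theorem annealedFreeEnergy_eq {m q : ℕ} (hqe : Even q)
    {ψ : Fin (2 * m) → Matrix (Qubits m) (Qubits m) ℂ} (hψ : IsMajorana ψ) (β : ℝ) :
    annealedFreeEnergy q β ψ =
      1 / β * Real.log (clusterPartition q (sykParam (2 * m) q β) (univ : Finset (Fin (2 * m)))) := by
  rw [annealedFreeEnergy, integral_sykPartition hqe hψ, clusterPartition]

theorem tendsto_annealedFreeEnergy {q : ℕ} {κ β t : ℝ} (hq : 2 ≤ q) (hqe : Even q) (hβ : β ≠ 0)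
    (hκ : ∀ n : ℕ, 1 ≤ n → ∀ lam : ℝ, 0 ≤ lam → lam * (n : ℝ) ^ (q - 1) ≤ κ →
      rootedWeightSum q 8 n lam ≤ 1 / 8)
    (hρ : 2 * sykRho q β ^ (q - 1) ≤ κ)
    (ht : t ∈ Set.Icc (1 / 2 : ℝ) (3 / 2)) (hD : logDerivSeries (treeCoeff q β) t = 1)
    {ψ : (m : ℕ) → Fin (2 * m) → Matrix (Qubits m) (Qubits m) ℂ} (hψ : ∀ m, IsMajorana (ψ m)) :
    Tendsto (fun m : ℕ => annealedFreeEnergy q β (ψ m) / ((2 * m : ℕ) : ℝ)) atTop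
      (𝓝 ((∑' v, treeCoeff q β (v + 1) * t ^ (v + 1) - 1 - Real.log t) / β)) := by
  have hu := tendsto_sykParam hq hqe β
  have hdom : ∀ᶠ n in atTop, IsDominated (clusterCoeff q n (sykParam n q β)) n := by
    filter_upwards [eventually_ge_atTop 1, hu.abs.eventually_le_const (u := 1) (by simp)] with n hn hs
    exact isDominated_clusterCoeff hq hn hκ hs ((sykParam_sq_mul hq hqe hn β).trans_le hρ)
  have hlim : ∀ v, 1 ≤ v → Tendsto (fun n => clusterCoeff q n (sykParam n q β) v) atTop
      (𝓝 (treeCoeff q β v)) := fun v hv => by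
    rw [treeCoeff_eq]
    exact tendsto_clusterCoeff hqe hv hu
      ((eventually_ge_atTop 1).mono fun n hn => sykParam_ne_zero hβ hn)
      ((eventually_ge_atTop 1).mono fun n hn => sykParam_sq_mul hq hqe hn β)
  have ht2 : t ∈ Set.Icc (0 : ℝ) 2 := ⟨by linarith [ht.1], by linarith [ht.2]⟩
  have htwo : Tendsto (fun m : ℕ => 2 * m) atTop atTop :=
    tendsto_id.const_mul_atTop' (by norm_num)
  have hle : map (fun m : ℕ => 2 * m) atTop ≤ atTop := htwo
  -- The coefficient asymptotics hold along any filter below `atTop`. Even `n` are selected here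
  -- because the Taylor coefficient formula uses Majorana operators, which are given for `2 * m`
  -- only.
  have h := tendsto_log_coeff (l := map (fun m : ℕ => 2 * m) atTop) hle
    (μ := fun n => clusterCoeff q n (sykParam n q β))
    (Z := fun n => clusterPartition q (sykParam n q β) (univ : Finset (Fin n)))
    (hle ((hdom.and (eventually_ge_atTop 1)).mono fun n hn => hn.1.isNearId hn.2))
    (eventually_map.2 (Eventually.of_forall fun m =>
      clusterPartition_univ_eq (by omega) hqe (hψ m) _)) ht
    ((hD ▸ tendsto_logDerivSum hdom hlim ht2).mono_left hle)
    ((tendsto_truncPhiReal hdom hlim ht2).mono_left hle)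
  refine ((tendsto_map'_iff.1 h).div_const β).congr fun m => ?_
  rw [annealedFreeEnergy_eq hqe (hψ m)]
  simp only [Function.comp_apply]
  ring

theorem ccgF_eq {q : ℕ} {β t : ℝ} (hq : 2 ≤ q) (hqe : Even q) (hβ : β ≠ 0)
    {H : C(CCGDisc × Chord, ℂ)} (hH : IsCCG q H) (hs : IsSmall q (sykRho q β * t))
    (ht : (sykRho q β : ℂ) * (t : ℂ) ∈ Metric.closedBall (0 : ℂ) (1 / Real.exp 1 ^ 2)) :
    ccgF q β H t ht = ((∑' v, treeCoeff q β (v + 1) * t ^ (v + 1) : ℝ) : ℂ) := by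
  have hρ := (sykRho_pos q hβ).ne'
  have h1 : ∑' v, treeSum q v * (sykRho q β * t) ^ v =
      sykRho q β * ∑' v, treeCoeff q β (v + 1) * t ^ (v + 1) := by
    rw [hs.summable_treeSum.tsum_eq_zero_add, treeSum_zero, zero_mul, zero_add, ← tsum_mul_left]
    refine tsum_congr fun v => ?_
    rw [treeCoeff_eq, Nat.add_sub_cancel, mul_pow]
    ring
  rw [ccgF, hs.tsum_treeSum hq hqe hH (by push_cast; rfl), h1, Complex.ofReal_mul,
    inv_mul_cancel_left₀ (by exact_mod_cast hρ)]

end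

/-! ### The main theorem. -/

theorem theorem1 (q : ℕ) (hq : Even q) (hq0 : 0 < q) :
    ∃ H : C(CCGDisc × Chord, ℂ), IsCCG q H ∧ (∀ G, IsCCG q G → G = H) ∧
      ∃ βstar : ℝ, 0 < βstar ∧ ∀ β : ℝ, |β| ≤ βstar →
        (∀ z : ℂ, ‖z‖ ≤ 2 → Summable fun v : ℕ => (treeCoeff q β (v + 1) : ℂ) * z ^ (v + 1)) ∧
        AnalyticOnNhd ℂ (treePhi q β) (Metric.closedBall 0 2) ∧
        ∃ t : ℝ, IsTStar q β t ∧ (∀ s, IsTStar q β s → s = t) ∧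
          ∃ ht : (sykRho q β : ℂ) * (t : ℂ) ∈ Metric.closedBall (0 : ℂ) (1 / Real.exp 1 ^ 2),
            β ≠ 0 →
              ∀ ψ : (m : ℕ) → Fin (2 * m) → Matrix (Qubits m) (Qubits m) ℂ,
                (∀ m, IsMajorana (ψ m)) →
                  Tendsto
                    (fun m : ℕ => ((annealedFreeEnergy q β (ψ m) / ((2 * m : ℕ) : ℝ) : ℝ) : ℂ))
                    atTop (𝓝 ((ccgF q β H t ht - 1 - (Real.log t : ℂ)) / (β : ℂ))) := by
  have hq2 : 2 ≤ q := by
    obtain ⟨k, rfl⟩ := hq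
    omega
  obtain ⟨H, hH⟩ := exists_isCCG q
  refine ⟨H, hH, fun G hG => isCCG_unique hH hG, ?_⟩
  -- The values `8` and `1 / 8` are those in `IsDominated`.
  obtain ⟨κ, hκ0, hκ⟩ := exists_rootedWeightSum_le hq2 (s := 8) (η := 1 / 8) (by norm_num)
    (by norm_num)
  set b : ℝ := κ ^ (((q - 1 : ℕ) : ℝ)⁻¹)
  have hb0 : 0 < b := Real.rpow_pos_of_pos hκ0 _
  have hbκ : b ^ (q - 1) = κ := Real.rpow_inv_natCast_pow hκ0.le (by omega)
  have hb : ∀ n : ℕ, 1 ≤ n → ∑ v ∈ Icc 2 n, rootedCount q v * b ^ (v - 1) * 8 ^ v ≤ 1 / 8 :=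
    fun n hn => sum_rootedCount_le hn hb0.le (by rwa [hbκ])
  -- Since `t < 3 / 2`, the bounds `b / 2`, `1 / 3` and half of `e⁻²` place `ρ t` below `b`, `1 / 2`
  -- and `e⁻²`. As `ρ ≤ 1`, the bound `κ / 2` gives `2 ρ ^ (q - 1) ≤ κ`.
  set ε : ℝ := min (min (b / 2) (κ / 2)) (min (1 / 3) (1 / Real.exp 1 ^ 2 / 2)) with hε
  obtain ⟨βstar, hβ0, hβ⟩ := exists_sykRho_le hq2 (ε := ε) (by positivity)
  refine ⟨βstar, hβ0, fun β hββ => ?_⟩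
  have hρ := hβ β hββ
  simp only [hε, le_min_iff] at hρ
  obtain ⟨⟨hρ1, hρ2⟩, hρ3, hρ4⟩ := hρ
  have hρ0 := sykRho_nonneg q β
  have hμ : ∀ n, 1 ≤ n → IsDominated (treeCoeff q β) n := fun n hn =>
    isDominated_treeCoeff hq2 (by linarith) hb hn
  -- The condition on the complex derivative becomes one on a real series, to which the Lipschitz
  -- estimates apply. The case `β = 0` is included: then `ρ = 0`, and the convention `0 ^ 0 = 1`
  -- keeps the term `v = 1`.
  have hstar : ∀ t : ℝ, IsTStar q β t ↔
      t ∈ Set.Ioo (1 / 2 : ℝ) (3 / 2) ∧ logDerivSeries (treeCoeff q β) t = 1 := fun t =>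
    and_congr_right fun ht => by
      have := mul_deriv_tsum_coeff hμ (t := t) ⟨by linarith [ht.1], by linarith [ht.2]⟩
      rw [show treePhi q β = fun z : ℂ => ∑' v : ℕ, (treeCoeff q β (v + 1) : ℂ) * z ^ (v + 1) from rfl,
        this]
      exact_mod_cast Iff.rfl
  refine ⟨fun z hz => summable_coeff_mul_pow hμ (by linarith), ?_, ?_⟩
  · exact (analyticOnNhd_tsum_coeff hμ).mono (Metric.closedBall_subset_ball (by norm_num))
  obtain ⟨t, ht, hD⟩ := exists_logDerivSeries_eq_one hμ
  have h32 : sykRho q β * t ≤ sykRho q β * (3 / 2) := mul_le_mul_of_nonneg_left ht.2.le hρ0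
  have ht0 : 0 ≤ t := by linarith [ht.1]
  refine ⟨t, (hstar t).2 ⟨ht, hD⟩, fun s hs => ?_, ?_, fun hβ1 ψ hψ => ?_⟩
  · obtain ⟨hs, hs1⟩ := (hstar s).1 hs
    exact eq_of_logDerivSeries_eq hμ ⟨by linarith [hs.1], by linarith [hs.2]⟩
      ⟨ht0, by linarith [ht.2]⟩ (hs1.trans hD.symm)
  · rw [mem_closedBall_zero_iff, ← Complex.ofReal_mul, Complex.norm_real, Real.norm_eq_abs,
      abs_of_nonneg (mul_nonneg hρ0 ht0)]
    have : 0 < 1 / Real.exp 1 ^ 2 := by positivity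
    linarith
  · have hsmall : IsSmall q (sykRho q β * t) := isSmall_of_sum_rootedCount_le hq2
      (mul_nonneg hρ0 ht0) (by linarith) (by linarith) hb
    have hρκ : 2 * sykRho q β ^ (q - 1) ≤ κ := by
      have := pow_le_of_le_one hρ0 (by linarith) (show q - 1 ≠ 0 by omega)
      linarith
    have h := tendsto_annealedFreeEnergy hq2 hq hβ1 hκ hρκ (Set.Ioo_subset_Icc_self ht) hD hψ
    rw [ccgF_eq hq2 hq hβ1 hH hsmall]
    exact_mod_cast (Complex.continuous_ofReal.tendsto _).comp h
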